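/- Let $d\ge 2$, let $d\sigma$ be the surface measure on the unit sphere $\mathbb S^{d-1}\subset\mathbb R^d$, and let $\beta:[-1,1]\to[0,\infty)$ be an angular collision kernel, i.e. a measurable function with $\int_{\mathbb S^{d-1}}(1-k\cdot\sigma)\,\beta(k\cdot\sigma)\,d\sigma<\infty$ for $k\in\mathbb S^{d-1}$ ($\beta(k\cdot\sigma)$ itself need not be integrable). For smooth $f:\mathbb S^{d-1}\to\mathbb R$ set $$L_\beta f(k)=\int_{\mathbb S^{d-1}}[f(\sigma)-f(k)]\,\beta(k\cdot\sigma)\,d\sigma:=\lim_{\varepsilon\downarrow0}\int_{\{k\cdot\sigma\le 1-\varepsilon\}}[f(\sigma)-f(k)]\,\beta(k\cdot\sigma)\,d\sigma .$$ For $f,g\in L^2(\mathbb S^{d-1})$ we say that $f$ is in the domain of $L_\beta$ on $L^2$ and $L_\beta f=g$ if $\int f\,L_\beta\varphi\,d\sigma=\int g\,\varphi\,d\sigma$ for all $\varphi\in C^\infty(\mathbb S^{d-1})$. For $\ell\in\{0,1,2,\dots\}$ let $H_\ell\subset C^\infty(\mathbb S^{d-1})$ be the space of spherical harmonics of degree $\ell$,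 i.e. the eigenspace of $-\Delta$ ($\Delta$ the Laplace--Beltrami operator) for the eigenvalue $\ell(\ell+d-2)$, and let $P_\ell^{(d)}$ be the Legendre polynomial of degree $\ell$ in dimension $d$: $P_0^{(d)}=1$, $P_1^{(d)}(x)=x$, and $(\ell+d-2)P_{\ell+1}^{(d)}(x)=(2\ell+d-2)\,x\,P_\ell^{(d)}(x)-\ell\,P_{\ell-1}^{(d)}(x)$ for $\ell\ge1$. Then the linear Boltzmann operator is diagonalised by spherical harmonics, in the following sense. 1. For every $f\in C^\infty(\mathbb S^{d-1})$ the limit defining $L_\beta f(k)$ exists for every $k$, and $L_\beta f\in L^2(\mathbb S^{d-1})$. 2. $L^2(\mathbb S^{d-1})$ is the orthogonal Hilbert sum of the spaces $H_\ell$, $\ell\ge0$; $\dim H_0=1$, and for $\ell\ge1$ $$\dim H_\ell=N(d,\ell)=\frac{2\ell+d-2}{\ell}\binom{\ell+d-3}{\ell-1}.$$ 3. For each $\ell\ge0$ the following integrals converge absolutely, the first for every $k\in\mathbb S^{d-1}$, with a value that does not depend on $k$: $$\nu_\ell=\int_{\mathbb S^{d-1}}\bigl[1-P_\ell^{(d)}(k\cdot\sigma)\bigr]\beta(k\cdot\sigma)\,d\sigma=|\mathbb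 S^{d-2}|\int_0^\pi\bigl[1-P_\ell^{(d)}(\cos\theta)\bigr]\beta(\cos\theta)\sin^{d-2}\theta\,d\theta .$$ 4. Each $H_\ell$ is invariant under $L_\beta$: $L_\beta Y(k)=-\nu_\ell\,Y(k)$ for all $Y\in H_\ell$ and $k\in\mathbb S^{d-1}$ (where the integral defining $L_\beta Y(k)$ is an ordinary Lebesgue integral whenever its integrand is integrable). 5. For $f,g\in L^2(\mathbb S^{d-1})$, $f$ is in the domain of $L_\beta$ with $L_\beta f=g$ if and only if $\langle Y,g\rangle=-\nu_\ell\langle Y,f\rangle$ for all $\ell\ge0$ and $Y\in H_\ell$. The eigenvalues of $-L_\beta$ on $L^2(\mathbb S^{d-1})$ are exactly the numbers $\nu_\ell$, $\ell\ge0$ (which need not be distinct). -/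

import Mathlib

open MeasureTheory Filter Topology
open scoped RealInnerProductSpace

noncomputable section

namespace SphereBoltzmann

/-- The Euclidean space `ℝ^d`. -/
abbrev E (d : ℕ) : Type := EuclideanSpace ℝ (Fin d)

/-- The unit sphere `S^{d-1}` of `ℝ^d`. -/
abbrev S (d : ℕ) : Type := Metric.sphere (0 : E d) 1

/-- The (unnormalised) surface measure `dσ` on `S^{d-1}`. -/
abbrev surf (d : ℕ) : Measure (S d) := (volume : Measure (E d)).toSphere

/-- The total surface area of the unit sphere of `ℝ^d`, i.e. `|S^{d-1}|`. -/
def sphereArea (d : ℕ) : ℝ := (surf d).real Set.univ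

/-- The real Hilbert space `L^2(S^{d-1}, dσ)`. -/
abbrev L2 (d : ℕ) : Type := Lp ℝ 2 (surf d)

/-! ### Smooth functions, the Laplace-Beltrami operator and its eigenspaces -/

/-- The `0`-homogeneous extension `x ↦ f (x / |x|)` of a function on the sphere
(with the irrelevant value `0` at the origin). -/
def radialExt {d : ℕ} (f : S d → ℝ) (x : E d) : ℝ :=
  if hx : x ≠ 0 then
    f ⟨‖x‖⁻¹ • x, by
      rw [mem_sphere_zero_iff_norm, norm_smul, norm_inv, norm_norm,
        inv_mul_cancel₀ (norm_ne_zero_iff.mpr hx)]⟩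
  else 0

/-- `f ∈ C^∞(S^{d-1})`: the extension `x ↦ f (x / |x|)` is infinitely differentiable
on `ℝ^d` minus the origin. -/
def IsSmooth {d : ℕ} (f : S d → ℝ) : Prop :=
  ContDiffOn ℝ ((⊤ : ℕ∞) : WithTop ℕ∞) (radialExt f) {0}ᶜ

/-- The Laplace-Beltrami operator on `S^{d-1}`: `Δ f` at `x` is the usual Laplacian of
`y ↦ f (y / |y|)`, evaluated at `x`. -/
def sphereLaplacian {d : ℕ} (f : S d → ℝ) (x : S d) : ℝ :=
  Laplacian.laplacian (radialExt f) (x : E d)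

lemma radialExt_add {d : ℕ} (f g : S d → ℝ) :
    radialExt (f + g) = radialExt f + radialExt g := by
  funext x
  by_cases hx : x = 0 <;> simp [radialExt, hx]

lemma radialExt_smul {d : ℕ} (c : ℝ) (f : S d → ℝ) :
    radialExt (c • f) = c • radialExt f := by
  funext x
  by_cases hx : x = 0 <;> simp [radialExt, hx]

lemma radialExt_zero {d : ℕ} : radialExt (0 : S d → ℝ) = fun _ => 0 := by
  funext x
  by_cases hx : x = 0 <;> simp [radialExt, hx]

lemma IsSmooth.contDiffAt {d : ℕ} {f : S d → ℝ} (hf : IsSmooth f) (x : S d) :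
    ContDiffAt ℝ 2 (radialExt f) (x : E d) := by
  have hx : (x : E d) ≠ 0 := by
    have h := mem_sphere_zero_iff_norm.mp x.2
    intro h0
    rw [h0, norm_zero] at h
    exact zero_ne_one h
  have h1 : ContDiffAt ℝ ((⊤ : ℕ∞) : WithTop ℕ∞) (radialExt f) (x : E d) :=
    ContDiffOn.contDiffAt hf (isOpen_compl_singleton.mem_nhds hx)
  exact h1.of_le (by norm_cast)

/-- `H_ℓ`, the space of spherical harmonics of degree `ℓ`: the eigenspace of `-Δ` on
`C^∞(S^{d-1})` associated with the eigenvalue `ℓ (ℓ + d - 2)`. -/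
def sphericalHarmonics (d ℓ : ℕ) : Submodule ℝ (S d → ℝ) where
  carrier := {f | IsSmooth f ∧
    ∀ x, -sphereLaplacian f x = (ℓ : ℝ) * ((ℓ : ℝ) + (d : ℝ) - 2) * f x}
  add_mem' := by
    rintro f g ⟨hf, hf'⟩ ⟨hg, hg'⟩
    refine ⟨?_, fun x => ?_⟩
    · unfold IsSmooth
      rw [radialExt_add]
      exact ContDiffOn.add hf hg
    · have h1 := hf' x
      have h2 := hg' x
      have h3 : sphereLaplacian (f + g) x = sphereLaplacian f x + sphereLaplacian g x := by
        unfold sphereLaplacian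
        rw [radialExt_add]
        exact ContDiffAt.laplacian_add (hf.contDiffAt x) (hg.contDiffAt x)
      rw [h3, Pi.add_apply]
      linarith
  zero_mem' := by
    refine ⟨?_, fun x => ?_⟩
    · unfold IsSmooth
      rw [radialExt_zero]
      exact contDiffOn_const
    · simp [sphereLaplacian, radialExt_zero]
  smul_mem' := by
    rintro c f ⟨hf, hf'⟩
    refine ⟨?_, fun x => ?_⟩
    · unfold IsSmooth
      rw [radialExt_smul]
      exact ContDiffOn.const_smul c hf
    · have h1 := hf' x
      have h3 : sphereLaplacian (c • f) x = c * sphereLaplacian f x := by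
        unfold sphereLaplacian
        rw [radialExt_smul, InnerProductSpace.laplacian_smul c (hf.contDiffAt x), smul_eq_mul]
      rw [h3, Pi.smul_apply, smul_eq_mul]
      linear_combination c * h1

/-- `H_ℓ` viewed as a subspace of `L^2(S^{d-1})`. -/
def sphericalHarmonicsL2 (d ℓ : ℕ) : Submodule ℝ (L2 d) where
  carrier := {F | ∃ Y ∈ sphericalHarmonics d ℓ, F =ᵐ[surf d] Y}
  add_mem' := by
    rintro F G ⟨Y, hY, hFY⟩ ⟨Z, hZ, hGZ⟩
    exact ⟨Y + Z, Submodule.add_mem _ hY hZ, (Lp.coeFn_add F G).trans (hFY.add hGZ)⟩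
  zero_mem' := ⟨0, Submodule.zero_mem _, Lp.coeFn_zero ℝ 2 (surf d)⟩
  smul_mem' := by
    rintro c F ⟨Y, hY, hFY⟩
    exact ⟨c • Y, Submodule.smul_mem _ c hY, (Lp.coeFn_smul c F).trans (hFY.const_smul c)⟩

/-- `N(d, ℓ) = ((2 ℓ + d - 2) / ℓ) * binom (ℓ + d - 3) (ℓ - 1)`, for `d ≥ 2` and `ℓ ≥ 1`. -/
def harmonicDim (d ℓ : ℕ) : ℝ :=
  (2 * (ℓ : ℝ) + (d : ℝ) - 2) / (ℓ : ℝ) * (Nat.choose (ℓ + d - 3) (ℓ - 1) : ℝ)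

/-- The Legendre polynomials `P_ℓ^{(d)}` in dimension `d`: `P_0 = 1`, `P_1 = X` and
`(ℓ + d - 2) P_{ℓ+1} - (2 ℓ + d - 2) X P_ℓ + ℓ P_{ℓ-1} = 0` for `ℓ ≥ 1`. -/
def legendre (d : ℕ) : ℕ → Polynomial ℝ
  | 0 => 1
  | 1 => Polynomial.X
  | n + 2 =>
      Polynomial.C (((n : ℝ) + 1 + (d : ℝ) - 2)⁻¹) *
        (Polynomial.C (2 * ((n : ℝ) + 1) + (d : ℝ) - 2) * Polynomial.X * legendre d (n + 1)
          - Polynomial.C ((n : ℝ) + 1) * legendre d n)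

/-! ### The linear Boltzmann operator -/

/-- An angular collision kernel on `S^{d-1}`: a nonnegative measurable function `β` of
`k · σ = cos θ ∈ [-1, 1]` with `∫ (1 - k · σ) β (k · σ) dσ < ∞`. The kernel `β` itself need
not be integrable (grazing collisions `σ → k` may have infinite total weight). -/
structure IsAngularKernel (d : ℕ) (β : ℝ → ℝ) : Prop where
  measurable : Measurable β
  nonneg : ∀ t ∈ Set.Icc (-1 : ℝ) 1, 0 ≤ β t
  momentum : ∀ k : S d,
    Integrable (fun σ : S d => (1 - ⟪(k : E d), (σ : E d)⟫) * β ⟪(k : E d), (σ : E d)⟫) (surf d)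

/-- The linear Boltzmann integral `∫ [f(σ) - f(k)] β(k · σ) dσ` restricted to the collisions
with `k · σ ≤ 1 - ε`. -/
def truncBoltzmann {d : ℕ} (β : ℝ → ℝ) (f : S d → ℝ) (k : S d) (ε : ℝ) : ℝ :=
  ∫ σ in {σ : S d | ⟪(k : E d), (σ : E d)⟫ ≤ 1 - ε},
    (f σ - f k) * β ⟪(k : E d), (σ : E d)⟫ ∂(surf d)

/-- `L_β f (k) = v`, where `L_β f (k) = ∫ [f(σ) - f(k)] β(k · σ) dσ` is understood as a
principal value at `σ = k`; it agrees with the Lebesgue integral whenever the integrand is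
integrable, and it is needed since the condition `∫ (1 - k · σ) β (k · σ) dσ < ∞` does not
imply that the integrand is integrable, even for smooth `f`. -/
def HasBoltzmannValue {d : ℕ} (β : ℝ → ℝ) (f : S d → ℝ) (k : S d) (v : ℝ) : Prop :=
  Tendsto (truncBoltzmann β f k) (𝓝[>] (0 : ℝ)) (𝓝 v)

/-- The value `L_β f (k)` (meaningful when the principal value exists). -/
def linBoltzmann {d : ℕ} (β : ℝ → ℝ) (f : S d → ℝ) (k : S d) : ℝ :=
  limUnder (𝓝[>] (0 : ℝ)) (truncBoltzmann β f k)

/-- The graph of `L_β` as an (unbounded) operator on `L^2(S^{d-1})`: `f` lies in the domain and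
`L_β f = g`, in the weak sense `∫ f L_β φ dσ = ∫ g φ dσ` for all `φ ∈ C^∞(S^{d-1})`. -/
def IsBoltzmannImage {d : ℕ} (β : ℝ → ℝ) (f g : L2 d) : Prop :=
  ∀ φ : S d → ℝ, IsSmooth φ →
    ∫ k, f k * linBoltzmann β φ k ∂(surf d) = ∫ k, g k * φ k ∂(surf d)

end SphereBoltzmann

end

open MeasureTheory Filter Topology
open scoped RealInnerProductSpace

noncomputable section

namespace SphereBoltzmann

variable {d : ℕ}

/-! The operator `L_β` commutes with linear isometries of `ℝ^d`. At fixed `k`, the functional `Y ↦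
L_β Y(k)` on `H_ℓ` is therefore invariant under the isometries fixing `k`. By Riesz it is the
pairing with some harmonic that depends only on `k · σ`, and such a harmonic is a multiple of `σ ↦
P_ℓ(k · σ)`. Evaluation at `k` is a functional of the same kind, so the two are proportional
(`funkHecke`). Testing on `P_ℓ(k · σ)` itself gives the factor `-ν_ℓ`, whose integral converges
because `1 - P_ℓ` vanishes at `1`.

Two analytic points make this rigorous. The principal value exists for smooth `f` because the
truncated region is invariant under reflection in the axis `ℝ k`: averaging replaces `f(σ) - f(k)`
by half a second difference, which is `O(1 - k · σ)` (`IsSmooth.exists_secondDiff_bound`). Symmetry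
of the truncated kernel makes `L_β` symmetric on smooth functions
(`integral_mul_linBoltzmann_comm`). The Hilbert sum then turns the pointwise eigenvalue relation
into the description of the weak operator on `L²`.

The Hilbert sum comes from polynomials. Homogeneous polynomials are combinations of `|x|^{2j} h`
with `h` harmonic (`mem_harmonicSpan`), so by Stone-Weierstrass harmonic polynomials are dense.
Green's identity (`integral_mul_sphereLaplacian`) makes distinct eigenspaces orthogonal, and
completeness then leaves no eigenfunctions beyond harmonic polynomials (`exists_polyRestrict_eq`).
Dimensions follow by rank-nullity, since the Laplacian maps homogeneous polynomials onto those two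
degrees lower.

The angular formula identifies the law of `k · σ` with that of `cos θ` under `|S^{d-2}| sin^{d-2} θ
dθ`: all moments agree because they obey the same two-step recursion (`map_inner_surf`). -/

/-! ### Partial derivatives, product rules and powers of the norm. -/

/-- The `i`-th partial derivative on `ℝ^d`. -/
def partialD (i : Fin d) (f : E d → ℝ) (x : E d) : ℝ :=
  fderiv ℝ f x (EuclideanSpace.single i (1 : ℝ))

lemma ne_zero_of_sphere (x : S d) : (x : E d) ≠ 0 := by
  have h := mem_sphere_zero_iff_norm.mp x.2
  intro h0
  rw [h0, norm_zero] at h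
  exact zero_ne_one h

@[simp] lemma norm_sphere (x : S d) : ‖(x : E d)‖ = 1 := mem_sphere_zero_iff_norm.mp x.2

lemma laplacian_eq_sum_partialD {f : E d → ℝ} {x : E d} (hf : ContDiffAt ℝ 2 f x) :
    Laplacian.laplacian f x = ∑ i, partialD i (partialD i f) x := by
  have h := InnerProductSpace.laplacian_eq_iteratedFDeriv_orthonormalBasis f
    (EuclideanSpace.basisFun (Fin d) ℝ)
  rw [h]
  refine Finset.sum_congr rfl fun i _ => ?_
  rw [iteratedFDeriv_two_apply]
  have h1 : DifferentiableAt ℝ (fderiv ℝ f) x :=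
    (hf.fderiv_right (m := 1) (by norm_num)).differentiableAt (by norm_num)
  unfold partialD
  rw [fderiv_clm_apply h1 (differentiableAt_const _)]
  simp

lemma partialD_congr {f g : E d → ℝ} {x : E d} (i : Fin d) (h : f =ᶠ[𝓝 x] g) :
    partialD i f x = partialD i g x := by
  unfold partialD; rw [h.fderiv_eq]

lemma partialD_mul {f g : E d → ℝ} {x : E d} (i : Fin d) (hf : DifferentiableAt ℝ f x)
    (hg : DifferentiableAt ℝ g x) :
    partialD i (fun y => f y * g y) x = f x * partialD i g x + partialD i f x * g x := by
  unfold partialD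
  rw [fderiv_fun_mul hf hg]
  simp
  ring

lemma partialD_sub {f g : E d → ℝ} {x : E d} (i : Fin d) (hf : DifferentiableAt ℝ f x)
    (hg : DifferentiableAt ℝ g x) :
    partialD i (fun y => f y - g y) x = partialD i f x - partialD i g x := by
  unfold partialD
  rw [fderiv_fun_sub hf hg]
  simp

lemma partialD_add {f g : E d → ℝ} {x : E d} (i : Fin d) (hf : DifferentiableAt ℝ f x)
    (hg : DifferentiableAt ℝ g x) :
    partialD i (fun y => f y + g y) x = partialD i f x + partialD i g x := by
  unfold partialD
  rw [fderiv_fun_add hf hg]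
  simp

lemma contDiffAt_partialD {f : E d → ℝ} {x : E d} {n m : WithTop ℕ∞} (i : Fin d)
    (hf : ContDiffAt ℝ n f x) (h : m + 1 ≤ n) : ContDiffAt ℝ m (partialD i f) x := by
  unfold partialD
  exact (hf.fderiv_right h).clm_apply contDiffAt_const

lemma laplacian_mul {f g : E d → ℝ} {x : E d} (hf : ContDiffAt ℝ 2 f x)
    (hg : ContDiffAt ℝ 2 g x) :
    Laplacian.laplacian (fun y => f y * g y) x = f x * Laplacian.laplacian g x
      + 2 * ∑ i, partialD i f x * partialD i g x + Laplacian.laplacian f x * g x := by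
  rw [laplacian_eq_sum_partialD (hf.mul hg), laplacian_eq_sum_partialD hf,
    laplacian_eq_sum_partialD hg, Finset.mul_sum, Finset.mul_sum, Finset.sum_mul,
    ← Finset.sum_add_distrib, ← Finset.sum_add_distrib]
  refine Finset.sum_congr rfl fun i _ => ?_
  have e : partialD i (fun y => f y * g y) =ᶠ[𝓝 x]
      fun y => f y * partialD i g y + partialD i f y * g y := by
    filter_upwards [hf.eventually (by simp), hg.eventually (by simp)] with y h1 h2
    exact partialD_mul i (h1.differentiableAt (by norm_num)) (h2.differentiableAt (by norm_num))
  have hf1 := hf.differentiableAt (by norm_num)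
  have hg1 := hg.differentiableAt (by norm_num)
  have hf2 := (contDiffAt_partialD (m := 1) i hf (by norm_num)).differentiableAt (by norm_num)
  have hg2 := (contDiffAt_partialD (m := 1) i hg (by norm_num)).differentiableAt (by norm_num)
  rw [partialD_congr i e, partialD_add i (hf1.fun_mul hg2) (hf2.fun_mul hg1), partialD_mul i hf1 hg2,
    partialD_mul i hf2 hg1]
  ring

lemma fderiv_apply_eq_sum (f : E d → ℝ) (x v : E d) :
    fderiv ℝ f x v = ∑ i, v i * partialD i f x := by
  conv_lhs => rw [← (EuclideanSpace.basisFun (Fin d) ℝ).sum_repr v]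
  simp [partialD]

lemma partialD_comp_smul (f : E d → ℝ) (c : ℝ) (i : Fin d) (x : E d) :
    partialD i (fun y => f (c • y)) x = c * partialD i f (c • x) := by
  unfold partialD
  rw [fderiv_comp_smul]
  simp

/-- Powers of `|y|²` are smooth off the origin by the chain rule. The case `s = -n/2` is the factor
that makes a polynomial of degree `n` homogeneous of degree `0`. -/
lemma hasFDerivAt_norm_sq_rpow (s : ℝ) {x : E d} (hx : x ≠ 0) :
    HasFDerivAt (fun y : E d => (‖y‖ ^ 2) ^ s)
      ((s * (‖x‖ ^ 2) ^ (s - 1)) • (2 • innerSL ℝ x)) x := by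
  have h1 : HasFDerivAt (fun y : E d => ‖y‖ ^ 2) (2 • innerSL ℝ x) x :=
    (hasStrictFDerivAt_norm_sq x).hasFDerivAt
  exact h1.rpow_const (Or.inl (by positivity))

lemma contDiffAt_norm_sq_rpow (s : ℝ) {x : E d} (hx : x ≠ 0) {n : WithTop ℕ∞} :
    ContDiffAt ℝ n (fun y : E d => (‖y‖ ^ 2) ^ s) x :=
  (contDiff_norm_sq ℝ).contDiffAt.rpow_const_of_ne (by positivity)

lemma partialD_norm_sq_rpow (s : ℝ) {x : E d} (hx : x ≠ 0) (i : Fin d) :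
    partialD i (fun y : E d => (‖y‖ ^ 2) ^ s) x = 2 * s * (x i * (‖x‖ ^ 2) ^ (s - 1)) := by
  unfold partialD
  rw [(hasFDerivAt_norm_sq_rpow s hx).fderiv]
  have : ⟪x, EuclideanSpace.single i (1 : ℝ)⟫ = x i := by
    simp [EuclideanSpace.inner_single_right]
  simp [this]
  ring

lemma partialD_coord (i : Fin d) (x : E d) : partialD i (fun y : E d => y i) x = 1 := by
  unfold partialD
  have h : HasFDerivAt (fun y : E d => y i) (EuclideanSpace.proj i : E d →L[ℝ] ℝ) x :=
    (EuclideanSpace.proj i : E d →L[ℝ] ℝ).hasFDerivAt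
  rw [h.fderiv]
  simp

lemma differentiableAt_coord (i : Fin d) (x : E d) :
    DifferentiableAt ℝ (fun y : E d => y i) x :=
  (EuclideanSpace.proj i : E d →L[ℝ] ℝ).differentiableAt

lemma partialD_const_mul {f : E d → ℝ} {x : E d} (i : Fin d) (c : ℝ)
    (hf : DifferentiableAt ℝ f x) : partialD i (fun y => c * f y) x = c * partialD i f x := by
  unfold partialD
  rw [fderiv_const_mul hf]
  simp

lemma sum_coord_sq (x : E d) : ∑ i, x i ^ 2 = ‖x‖ ^ 2 := by
  rw [EuclideanSpace.norm_sq_eq]; simp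

lemma laplacian_norm_sq_rpow (s : ℝ) (x : S d) :
    Laplacian.laplacian (fun y : E d => (‖y‖ ^ 2) ^ s) (x : E d)
      = 2 * s * (d + 2 * (s - 1)) := by
  have hx := ne_zero_of_sphere x
  rw [laplacian_eq_sum_partialD (contDiffAt_norm_sq_rpow s hx)]
  have h : ∀ i, partialD i (partialD i (fun y : E d => (‖y‖ ^ 2) ^ s)) (x : E d)
      = 2 * s * (1 + 2 * (s - 1) * (x : E d) i ^ 2) := by
    intro i
    have e : partialD i (fun y : E d => (‖y‖ ^ 2) ^ s) =ᶠ[𝓝 (x : E d)]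
        fun y => 2 * s * (y i * (‖y‖ ^ 2) ^ (s - 1)) := by
      filter_upwards [isOpen_compl_singleton.mem_nhds hx] with y hy
      exact partialD_norm_sq_rpow s hy i
    have hd := (contDiffAt_norm_sq_rpow (s - 1) hx (n := 1)).differentiableAt (by norm_num)
    rw [partialD_congr i e, partialD_const_mul i _ ((differentiableAt_coord i _).fun_mul hd),
      partialD_mul i (differentiableAt_coord i _) hd, partialD_norm_sq_rpow _ hx, partialD_coord]
    simp only [norm_sphere, one_pow, Real.one_rpow]
    ring
  simp_rw [h]
  rw [← Finset.mul_sum, Finset.sum_add_distrib, ← Finset.mul_sum, sum_coord_sq]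
  simp

lemma partialD_norm_sq_rpow_sphere (s : ℝ) (x : S d) (i : Fin d) :
    partialD i (fun y : E d => (‖y‖ ^ 2) ^ s) (x : E d) = 2 * s * (x : E d) i := by
  rw [partialD_norm_sq_rpow s (ne_zero_of_sphere x)]
  simp

/-! ### Polynomial functions -/

/-- The function on `ℝ^d` defined by a polynomial in the coordinates. -/
def polyFun (p : MvPolynomial (Fin d) ℝ) (x : E d) : ℝ := MvPolynomial.eval (fun i => x i) p

lemma hasFDerivAt_polyFun (p : MvPolynomial (Fin d) ℝ) (x : E d) :
    DifferentiableAt ℝ (polyFun p) x ∧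
      ∀ i, partialD i (polyFun p) x = polyFun (MvPolynomial.pderiv i p) x := by
  induction p using MvPolynomial.induction_on with
  | C a =>
    have : polyFun (d := d) (MvPolynomial.C a) = fun _ => a := by funext y; simp [polyFun]
    rw [this]
    refine ⟨differentiableAt_const _, fun i => ?_⟩
    simp [partialD, polyFun]
  | add p q hp hq =>
    have : polyFun (p + q) = fun y => polyFun p y + polyFun q y := by
      funext y; simp [polyFun]
    rw [this]
    refine ⟨hp.1.add hq.1, fun i => ?_⟩
    rw [partialD_add i hp.1 hq.1, hp.2, hq.2]
    simp [polyFun]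
  | mul_X p j hp =>
    have : polyFun (p * MvPolynomial.X j) = fun y => polyFun p y * y j := by
      funext y; simp [polyFun]
    rw [this]
    refine ⟨hp.1.mul (differentiableAt_coord j x), fun i => ?_⟩
    rw [partialD_mul i hp.1 (differentiableAt_coord j x), hp.2]
    have h2 : partialD i (fun y : E d => y j) x = if i = j then 1 else 0 := by
      unfold partialD
      have h : HasFDerivAt (fun y : E d => y j) (EuclideanSpace.proj j : E d →L[ℝ] ℝ) x :=
        (EuclideanSpace.proj j : E d →L[ℝ] ℝ).hasFDerivAt
      rw [h.fderiv]
      simp [eq_comm]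
    rw [h2]
    simp only [polyFun, Derivation.leibniz, MvPolynomial.pderiv_X, smul_eq_mul, map_add, map_mul,
      MvPolynomial.eval_X, Pi.single_apply]
    by_cases hij : j = i
    · subst hij; simp; ring
    · have : ¬ i = j := fun h => hij h.symm
      simp [hij, this]; ring

lemma contDiff_polyFun (p : MvPolynomial (Fin d) ℝ) {n : WithTop ℕ∞} :
    ContDiff ℝ n (polyFun p) := by
  induction p using MvPolynomial.induction_on with
  | C a =>
    have : polyFun (d := d) (MvPolynomial.C a) = fun _ => a := by funext y; simp [polyFun]
    rw [this]; exact contDiff_const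
  | add p q hp hq =>
    have : polyFun (p + q) = fun y => polyFun p y + polyFun q y := by
      funext y; simp [polyFun]
    rw [this]; exact hp.add hq
  | mul_X p j hp =>
    have : polyFun (p * MvPolynomial.X j) = fun y => polyFun p y * y j := by
      funext y; simp [polyFun]
    rw [this]; exact hp.mul (EuclideanSpace.proj j : E d →L[ℝ] ℝ).contDiff

lemma partialD_polyFun (p : MvPolynomial (Fin d) ℝ) (i : Fin d) :
    partialD i (polyFun p) = polyFun (MvPolynomial.pderiv i p) :=
  funext fun x => (hasFDerivAt_polyFun p x).2 i

/-- The Laplacian of a polynomial. -/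
def lapPoly : MvPolynomial (Fin d) ℝ →ₗ[ℝ] MvPolynomial (Fin d) ℝ :=
  ∑ i, (MvPolynomial.pderiv i).toLinearMap ∘ₗ (MvPolynomial.pderiv i).toLinearMap

lemma lapPoly_apply (p : MvPolynomial (Fin d) ℝ) :
    lapPoly p = ∑ i, MvPolynomial.pderiv i (MvPolynomial.pderiv i p) := by
  simp [lapPoly]

lemma laplacian_polyFun (p : MvPolynomial (Fin d) ℝ) (x : E d) :
    Laplacian.laplacian (polyFun p) x = polyFun (lapPoly p) x := by
  rw [laplacian_eq_sum_partialD (contDiff_polyFun p).contDiffAt, lapPoly_apply]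
  simp [partialD_polyFun, polyFun]

lemma polyFun_smul {p : MvPolynomial (Fin d) ℝ} {n : ℕ} (hp : p.IsHomogeneous n) (c : ℝ)
    (x : E d) : polyFun p (c • x) = c ^ n * polyFun p x := by
  unfold polyFun
  rw [MvPolynomial.eval_eq', MvPolynomial.eval_eq', Finset.mul_sum]
  refine Finset.sum_congr rfl fun m hm => ?_
  have h1 : ∑ i, m i = n := by
    rw [← Finsupp.degree_eq_sum, Finsupp.degree_eq_weight_one]
    exact hp (MvPolynomial.mem_support_iff.mp hm)
  simp only [PiLp.smul_apply, smul_eq_mul, mul_pow, Finset.prod_mul_distrib,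
    Finset.prod_pow_eq_pow_sum, h1]
  ring

lemma sum_coord_mul_partialD_polyFun {p : MvPolynomial (Fin d) ℝ} {n : ℕ} (hp : p.IsHomogeneous n)
    (x : E d) : ∑ i, x i * partialD i (polyFun p) x = n * polyFun p x := by
  have h := congrArg (MvPolynomial.eval (fun i => x i)) hp.sum_X_mul_pderiv
  simpa [partialD_polyFun, polyFun] using h

/-! ### Radial extensions and the spherical Laplacian of homogeneous polynomials. -/

/-- The restriction of a polynomial to the sphere. -/
def polyRestrict (p : MvPolynomial (Fin d) ℝ) (x : S d) : ℝ := polyFun p (x : E d)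

lemma radialExt_of_ne {f : S d → ℝ} {x : E d} (hx : x ≠ 0) :
    radialExt f x = f ⟨‖x‖⁻¹ • x, by
      rw [mem_sphere_zero_iff_norm, norm_smul, norm_inv, norm_norm,
        inv_mul_cancel₀ (norm_ne_zero_iff.mpr hx)]⟩ := by
  simp [radialExt, hx]

@[simp] lemma radialExt_coe (f : S d → ℝ) (x : S d) : radialExt f (x : E d) = f x := by
  rw [radialExt_of_ne (ne_zero_of_sphere x)]
  congr 1
  ext1
  simp

lemma radialExt_smul_coe (f : S d → ℝ) (x : S d) {r : ℝ} (hr : 0 < r) :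
    radialExt f (r • (x : E d)) = f x := by
  have h : r • (x : E d) ≠ 0 := smul_ne_zero hr.ne' (ne_zero_of_sphere x)
  rw [radialExt_of_ne h]
  congr 1
  ext1
  simp [norm_smul, smul_smul, abs_of_pos hr, hr.ne']

lemma radialExt_smul_arg (f : S d → ℝ) (x : E d) {r : ℝ} (hr : 0 < r) :
    radialExt f (r • x) = radialExt f x := by
  by_cases hx : x = 0
  · simp [hx]
  have h : r • x ≠ 0 := smul_ne_zero hr.ne' hx
  rw [radialExt_of_ne h, radialExt_of_ne hx]
  congr 1
  ext1
  simp only [norm_smul, smul_smul, Real.norm_eq_abs, abs_of_pos hr]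
  congr 1
  field_simp

lemma radialExt_polyRestrict {p : MvPolynomial (Fin d) ℝ} {n : ℕ} (hp : p.IsHomogeneous n)
    {x : E d} (hx : x ≠ 0) :
    radialExt (polyRestrict p) x = (‖x‖ ^ 2) ^ (-(n : ℝ) / 2) * polyFun p x := by
  rw [radialExt_of_ne hx, polyRestrict]
  simp only
  rw [polyFun_smul hp]
  congr 1
  rw [← Real.rpow_natCast ‖x‖ 2, ← Real.rpow_mul (norm_nonneg x)]
  rw [show ((2 : ℕ) : ℝ) * (-(n : ℝ) / 2) = -(n : ℝ) by push_cast; ring,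
    Real.rpow_neg (norm_nonneg x), Real.rpow_natCast, inv_pow]

lemma isSmooth_polyRestrict {p : MvPolynomial (Fin d) ℝ} {n : ℕ} (hp : p.IsHomogeneous n) :
    IsSmooth (polyRestrict p) := by
  intro x hx
  have h : ContDiffAt ℝ ((⊤ : ℕ∞) : WithTop ℕ∞)
      (fun x : E d => (‖x‖ ^ 2) ^ (-(n : ℝ) / 2) * polyFun p x) x :=
    (contDiffAt_norm_sq_rpow _ hx).mul (contDiff_polyFun p).contDiffAt
  exact h.contDiffWithinAt.congr (fun y hy => radialExt_polyRestrict hp hy)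
    (radialExt_polyRestrict hp hx)

/-- Product rule for `|x|^{-n} p` at `|x| = 1`: the Laplacian of `|x|^{-n}` contributes `-n(d - n -
2)`, and the cross term is `-2n²` by Euler's identity. -/
lemma sphereLaplacian_polyRestrict {p : MvPolynomial (Fin d) ℝ} {n : ℕ} (hp : p.IsHomogeneous n)
    (x : S d) : sphereLaplacian (polyRestrict p) x
      = polyRestrict (lapPoly p) x - n * (n + d - 2) * polyRestrict p x := by
  have hx := ne_zero_of_sphere x
  unfold sphereLaplacian
  have e : radialExt (polyRestrict p) =ᶠ[𝓝 (x : E d)]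
      fun x : E d => (‖x‖ ^ 2) ^ (-(n : ℝ) / 2) * polyFun p x := by
    filter_upwards [isOpen_compl_singleton.mem_nhds hx] with y hy
    exact radialExt_polyRestrict hp hy
  rw [(InnerProductSpace.laplacian_congr_nhds e).eq_of_nhds,
    laplacian_mul (contDiffAt_norm_sq_rpow _ hx) (contDiff_polyFun p).contDiffAt,
    laplacian_norm_sq_rpow, laplacian_polyFun]
  simp_rw [partialD_norm_sq_rpow_sphere, mul_assoc]
  rw [← Finset.mul_sum, ← Finset.mul_sum, sum_coord_mul_partialD_polyFun hp]
  simp [polyRestrict]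
  ring

/-! ### Polar coordinates and rotation invariance -/

/-- This transfers integration by parts from `ℝ^d` to the sphere: a function that splits in polar
coordinates has an integral that factors, and its value at the origin is irrelevant. -/
lemma integral_polar_mul [Nontrivial (E d)] (c : ℝ → ℝ) (h : S d → ℝ) (u : E d → ℝ)
    (hu : ∀ (r : ℝ) (x : S d), 0 < r → u (r • (x : E d)) = h x * c r) :
    ∫ x, u x = (∫ x, h x ∂surf d) *
      ∫ r : Set.Ioi (0 : ℝ), c r ∂(Measure.volumeIoiPow (Module.finrank ℝ (E d) - 1)) := by
  calc ∫ x, u x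
      = ∫ x : ({(0 : E d)}ᶜ : Set (E d)), u (x : E d) ∂(volume.comap Subtype.val) := by
        rw [integral_subtype_comap (measurableSet_singleton _).compl fun x => u x,
          restrict_compl_singleton]
    _ = ∫ x, h x.1 * c x.2
        ∂(surf d).prod (Measure.volumeIoiPow (Module.finrank ℝ (E d) - 1)) := by
        rw [← (volume : Measure (E d)).measurePreserving_homeomorphUnitSphereProd.integral_comp
          (Homeomorph.measurableEmbedding _)]
        refine integral_congr_ae (Filter.Eventually.of_forall fun x => ?_)
        simp only
        rw [← hu _ _ (homeomorphUnitSphereProd (E d) x).2.2]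
        congr 1
        rw [← homeomorphUnitSphereProd_symm_apply_coe]
        simp
    _ = _ := integral_prod_mul (μ := surf d)
        (ν := Measure.volumeIoiPow (Module.finrank ℝ (E d) - 1)) h (fun r => c r)

/-- The action of a linear isometry of `ℝ^d` on the sphere. -/
def sphereMap (R : E d ≃ₗᵢ[ℝ] E d) (x : S d) : S d :=
  ⟨R x, by rw [mem_sphere_zero_iff_norm, R.norm_map, norm_sphere]⟩

@[simp] lemma coe_sphereMap (R : E d ≃ₗᵢ[ℝ] E d) (x : S d) : (sphereMap R x : E d) = R x := rfl

/-- The homeomorphism of the sphere induced by a linear isometry of `ℝ^d`. -/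
def sphereHomeo (R : E d ≃ₗᵢ[ℝ] E d) : S d ≃ₜ S d where
  toFun := sphereMap R
  invFun := sphereMap R.symm
  left_inv x := by ext1; simp
  right_inv x := by ext1; simp
  continuous_toFun := by
    exact Continuous.subtype_mk (R.continuous.comp continuous_subtype_val) _
  continuous_invFun := by
    exact Continuous.subtype_mk (R.symm.continuous.comp continuous_subtype_val) _

-- Up to a dimensional factor, the surface measure of `s` is the volume of the cone `(0,1) • s`. The
-- isometry preserves volume and carries cones to cones.
open scoped Pointwise in
lemma measurePreserving_sphereMap (R : E d ≃ₗᵢ[ℝ] E d) :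
    MeasurePreserving (sphereMap R) (surf d) (surf d) := by
  have hm : Measurable (sphereMap R) := (sphereHomeo R).continuous.measurable
  refine ⟨hm, ?_⟩
  ext s hs
  rw [Measure.map_apply hm hs, Measure.toSphere_apply' _ (hm hs),
    Measure.toSphere_apply' _ hs]
  congr 1
  rw [← R.measurePreserving.measure_preimage_equiv (f := R.toMeasurableEquiv)
    (Set.Ioo (0 : ℝ) 1 • (Subtype.val '' s))]
  congr 1
  ext x
  simp only [Set.mem_smul, Set.mem_image, Set.mem_preimage]
  constructor
  · rintro ⟨r, hr, _, ⟨y, hy, rfl⟩, rfl⟩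
    exact ⟨r, hr, _, ⟨sphereMap R y, hy, rfl⟩, by simp⟩
  · rintro ⟨r, hr, _, ⟨y, hy, rfl⟩, h⟩
    have h' : r • (y : E d) = R x := h
    refine ⟨r, hr, _, ⟨sphereMap R.symm y, ?_, rfl⟩, ?_⟩
    · have : sphereMap R (sphereMap R.symm y) = y := by ext1; simp
      simpa [this] using hy
    · apply R.injective
      simpa using h'

lemma measurableEmbedding_sphereMap (R : E d ≃ₗᵢ[ℝ] E d) : MeasurableEmbedding (sphereMap R) :=
  (sphereHomeo R).measurableEmbedding

lemma integral_comp_sphereMap (R : E d ≃ₗᵢ[ℝ] E d) (f : S d → ℝ) :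
    ∫ x, f (sphereMap R x) ∂surf d = ∫ x, f x ∂surf d :=
  (measurePreserving_sphereMap R).integral_comp (measurableEmbedding_sphereMap R) f

/-! ### Smooth functions on the sphere and Green's identity -/

lemma IsSmooth.contDiffAt_of_ne {f : S d → ℝ} (hf : IsSmooth f) {x : E d} (hx : x ≠ 0)
    {n : ℕ} : ContDiffAt ℝ n (radialExt f) x := by
  have h1 : ContDiffAt ℝ ((⊤ : ℕ∞) : WithTop ℕ∞) (radialExt f) x :=
    ContDiffOn.contDiffAt hf (isOpen_compl_singleton.mem_nhds hx)
  exact h1.of_le (by exact_mod_cast le_top)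

lemma IsSmooth.continuous {f : S d → ℝ} (hf : IsSmooth f) : Continuous f := by
  have h : f = fun x : S d => radialExt f (x : E d) := by funext x; simp
  rw [h, continuous_iff_continuousAt]
  intro x
  exact ContinuousAt.comp (f := fun x : S d => (x : E d))
    (hf.contDiffAt_of_ne (ne_zero_of_sphere x) (n := 0)).continuousAt
    continuous_subtype_val.continuousAt

lemma integrable_of_continuous {f : S d → ℝ} (hf : Continuous f) : Integrable f (surf d) :=
  hf.integrable_of_hasCompactSupport (HasCompactSupport.of_compactSpace f)

/-- Euler's identity in degree `0`: the extension is constant along the ray through `x`. -/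
lemma sum_coord_mul_partialD_radialExt {f : S d → ℝ} (hf : IsSmooth f) {x : E d} (hx : x ≠ 0) :
    ∑ i, x i * partialD i (radialExt f) x = 0 := by
  rw [← fderiv_apply_eq_sum]
  have hF : HasFDerivAt (radialExt f) (fderiv ℝ (radialExt f) x) ((1 : ℝ) • x) := by
    rw [one_smul]
    exact ((hf.contDiffAt_of_ne hx (n := 1)).differentiableAt (by norm_num)).hasFDerivAt
  have h1 : HasDerivAt (fun t : ℝ => t • x) x 1 := by
    simpa using (hasDerivAt_id (1 : ℝ)).smul_const x
  have h2 := hF.comp_hasDerivAt (1 : ℝ) h1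
  have h3 : (radialExt f ∘ fun t : ℝ => t • x) =ᶠ[𝓝 1] fun _ => radialExt f x := by
    filter_upwards [lt_mem_nhds (zero_lt_one (α := ℝ))] with t ht
    exact radialExt_smul_arg f x ht
  exact (h2.unique ((hasDerivAt_const (1 : ℝ) _).congr_of_eventuallyEq h3))

/-- Two derivatives of a function of homogeneity `0` have homogeneity `-2`. -/
lemma laplacian_radialExt_smul {f : S d → ℝ} (hf : IsSmooth f) (x : S d) {r : ℝ} (hr : 0 < r) :
    r ^ 2 * Laplacian.laplacian (radialExt f) (r • (x : E d)) = sphereLaplacian f x := by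
  have hx : r • (x : E d) ≠ 0 := smul_ne_zero hr.ne' (ne_zero_of_sphere x)
  unfold sphereLaplacian
  rw [laplacian_eq_sum_partialD (hf.contDiffAt_of_ne hx),
    laplacian_eq_sum_partialD (hf.contDiffAt x), Finset.mul_sum]
  refine Finset.sum_congr rfl fun i _ => ?_
  have h0 : (fun y => radialExt f (r • y)) = radialExt f :=
    funext fun y => radialExt_smul_arg f y hr
  have h1 : partialD i (radialExt f) = fun y => r * partialD i (radialExt f) (r • y) := by
    conv_lhs => rw [← h0]
    funext y
    exact partialD_comp_smul _ _ _ _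
  conv_rhs => rw [h1]
  have h2 : DifferentiableAt ℝ (fun y => partialD i (radialExt f) (r • y)) (x : E d) := by
    have := (contDiffAt_partialD (m := 1) i (hf.contDiffAt_of_ne hx (n := 2))
      (by norm_num)).differentiableAt (by norm_num)
    exact this.comp (x : E d) (differentiableAt_id.const_smul r)
  rw [partialD_const_mul i r h2, partialD_comp_smul]
  ring

/-- The integral of a partial derivative of a compactly supported `C¹` function vanishes. -/
lemma integral_partialD_eq_zero {u : E d → ℝ} (hu : ContDiff ℝ 1 u) (hc : HasCompactSupport u)
    (i : Fin d) : Integrable (partialD i u) ∧ ∫ x, partialD i u x = 0 := by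
  have hcont : Continuous (partialD i u) :=
    (hu.continuous_fderiv (by norm_num)).clm_apply continuous_const
  have hcs : HasCompactSupport (partialD i u) := hc.fderiv_apply ℝ _
  have hint : Integrable (partialD i u) := hcont.integrable_of_hasCompactSupport hcs
  refine ⟨hint, ?_⟩
  have h := integral_mul_fderiv_eq_neg_fderiv_mul_of_integrable (μ := (volume : Measure (E d)))
    (f := fun _ => (1 : ℝ)) (g := u) (v := EuclideanSpace.single i (1 : ℝ))
    (by simp) (by simpa using (show Integrable
      (fun x => fderiv ℝ u x (EuclideanSpace.single i (1 : ℝ))) volume from hint))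
    (by simpa using hu.continuous.integrable_of_hasCompactSupport hc)
    (fun _ _ => differentiableAt_const _) (fun x _ => (hu.differentiable (by norm_num)) x)
  simpa [partialD] using h

/-- A smooth radial cutoff supported in an annulus. -/
lemma exists_radial_cutoff : ∃ b : ℝ → ℝ, ContDiff ℝ 2 b ∧ (∀ t, 0 ≤ b t) ∧ b 1 = 1 ∧
    (∀ t, t ≤ 1 / 2 → b t = 0) ∧ (∀ t, 3 / 2 ≤ t → b t = 0) := by
  let b : ContDiffBump (1 : ℝ) := ⟨1 / 4, 1 / 2, by norm_num, by norm_num⟩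
  refine ⟨b, b.contDiff, fun t => b.nonneg, b.one_of_mem_closedBall (by simp [b]),
    fun t ht => b.zero_of_le_dist ?_, fun t ht => b.zero_of_le_dist ?_⟩
  · rw [Real.dist_eq, abs_of_nonpos (by linarith)]; simp only [b]; linarith
  · rw [Real.dist_eq, abs_of_nonneg (by linarith)]; simp only [b]; linarith

/-- Green's identity. The field `χ (F ∇G - G ∇F)`, with `χ` a radial cutoff supported in an annulus,
has divergence of integral zero. The term with `∇χ` drops out because `F` and `G` have no radial
derivative. What remains is the wanted integrand times a radial function of positive integral. -/
theorem integral_mul_sphereLaplacian [Nontrivial (E d)] {f g : S d → ℝ} (hf : IsSmooth f) (hg : IsSmooth g) :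
    ∫ x, (f x * sphereLaplacian g x - g x * sphereLaplacian f x) ∂surf d = 0 := by
  obtain ⟨b, hb, hb0, hb1, hbl, hbr⟩ := exists_radial_cutoff
  set F := radialExt f with hF
  set G := radialExt g with hG
  -- The extra factor `|x|²` cancels the homogeneity `-2` of the Laplacians, so that the divergence
  -- splits exactly as a spherical factor times `b (r²)`.
  let χ : E d → ℝ := fun x => ‖x‖ ^ 2 * b (‖x‖ ^ 2)
  let m : ℝ → ℝ := fun t => t * b t
  have hm : ContDiff ℝ 2 m := contDiff_id.mul hb
  have hχ : ContDiff ℝ 2 χ := hm.comp (contDiff_norm_sq ℝ)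
  have hχ0 : ∀ᶠ x in 𝓝 (0 : E d), χ x = 0 := by
    have : Tendsto (fun x : E d => ‖x‖ ^ 2) (𝓝 0) (𝓝 0) := by
      have := ((contDiff_norm_sq ℝ (E := E d) (n := 0)).continuous.tendsto (0 : E d))
      simpa using this
    filter_upwards [this.eventually (gt_mem_nhds (show (0 : ℝ) < 1 / 2 by norm_num))] with x hx
    simp [χ, hbl _ hx.le]
  have hχc : ∀ x : E d, x ∉ Metric.closedBall (0 : E d) 2 → χ x = 0 := by
    intro x hx
    have : 2 < ‖x‖ := by simpa using hx
    simp [χ, hbr (‖x‖ ^ 2) (by nlinarith)]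
  have hpχ : ∀ i x, partialD i χ x = 2 * deriv m (‖x‖ ^ 2) * x i := by
    intro i x
    have h1 : HasFDerivAt (fun y : E d => ‖y‖ ^ 2) (2 • innerSL ℝ x) x :=
      (hasStrictFDerivAt_norm_sq x).hasFDerivAt
    have h2 : HasDerivAt m (deriv m (‖x‖ ^ 2)) (‖x‖ ^ 2) :=
      (hm.differentiable (by norm_num)).differentiableAt.hasDerivAt
    have h3 : HasFDerivAt χ (deriv m (‖x‖ ^ 2) • (2 • innerSL ℝ x)) x :=
      h2.comp_hasFDerivAt (h₂ := m) (f := fun y : E d => ‖y‖ ^ 2) x h1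
    have h4 : ⟪x, EuclideanSpace.single i (1 : ℝ)⟫ = x i := by
      simp [EuclideanSpace.inner_single_right]
    unfold partialD
    rw [h3.fderiv]
    simp [h4]
    ring
  let w : Fin d → E d → ℝ := fun i x => F x * partialD i G x - G x * partialD i F x
  let u : Fin d → E d → ℝ := fun i x => χ x * w i x
  have hw : ∀ i x, x ≠ 0 → ContDiffAt ℝ 1 (w i) x := by
    intro i x hx
    have hF2 := hf.contDiffAt_of_ne hx (n := 2)
    have hG2 := hg.contDiffAt_of_ne hx (n := 2)
    exact ((hF2.of_le (by norm_num)).mul (contDiffAt_partialD i hG2 (by norm_num))).sub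
      ((hG2.of_le (by norm_num)).mul (contDiffAt_partialD i hF2 (by norm_num)))
  have hu0 : ∀ i, u i =ᶠ[𝓝 0] fun _ => 0 := by
    intro i
    filter_upwards [hχ0] with x hx
    simp [u, hx]
  have hu : ∀ i, ContDiff ℝ 1 (u i) := by
    intro i
    rw [contDiff_iff_contDiffAt]
    intro x
    by_cases hx : x = 0
    · subst hx
      exact contDiffAt_const.congr_of_eventuallyEq (hu0 i)
    · exact (hχ.contDiffAt.of_le (by norm_num)).mul (hw i x hx)
  have huc : ∀ i, HasCompactSupport (u i) := by
    intro i
    refine HasCompactSupport.intro (isCompact_closedBall (0 : E d) 2) fun x hx => ?_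
    simp [u, hχc x hx]
  have hsum : ∫ x, ∑ i, partialD i (u i) x = 0 := by
    rw [integral_finsetSum _ fun i _ => (integral_partialD_eq_zero (hu i) (huc i) i).1]
    exact Finset.sum_eq_zero fun i _ => (integral_partialD_eq_zero (hu i) (huc i) i).2
  have hkey : ∀ (r : ℝ) (x : S d), 0 < r → ∑ i, partialD i (u i) (r • (x : E d))
      = (f x * sphereLaplacian g x - g x * sphereLaplacian f x) * b (r ^ 2) := by
    intro r x hr
    set y : E d := r • (x : E d) with hy
    have hy0 : y ≠ 0 := smul_ne_zero hr.ne' (ne_zero_of_sphere x)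
    have hF2 := hf.contDiffAt_of_ne hy0 (n := 2)
    have hG2 := hg.contDiffAt_of_ne hy0 (n := 2)
    have dF := hF2.differentiableAt (by norm_num)
    have dG := hG2.differentiableAt (by norm_num)
    have dF2 : ∀ i, DifferentiableAt ℝ (partialD i F) y := fun i =>
      (contDiffAt_partialD (m := 1) i hF2 (by norm_num)).differentiableAt (by norm_num)
    have dG2 : ∀ i, DifferentiableAt ℝ (partialD i G) y := fun i =>
      (contDiffAt_partialD (m := 1) i hG2 (by norm_num)).differentiableAt (by norm_num)
    have h1 : ∀ i, partialD i (u i) y = χ y * (F y * partialD i (partialD i G) y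
        - G y * partialD i (partialD i F) y)
        + 2 * deriv m (‖y‖ ^ 2) * (F y * (y i * partialD i G y) - G y * (y i * partialD i F y)) := by
      intro i
      have e1 : partialD i (u i) y = χ y * partialD i (w i) y + partialD i χ y * w i y :=
        partialD_mul i ((hχ.differentiable (by norm_num)) y)
          ((hw i y hy0).differentiableAt (by norm_num))
      have e2 : partialD i (w i) y = partialD i (fun z => F z * partialD i G z) y
          - partialD i (fun z => G z * partialD i F z) y :=
        partialD_sub i (dF.fun_mul (dG2 i)) (dG.fun_mul (dF2 i))
      rw [e1, e2, partialD_mul i dF (dG2 i), partialD_mul i dG (dF2 i), hpχ]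
      simp only [w]
      ring
    simp_rw [h1]
    rw [Finset.sum_add_distrib, ← Finset.mul_sum, ← Finset.mul_sum, Finset.sum_sub_distrib,
      Finset.sum_sub_distrib, ← Finset.mul_sum, ← Finset.mul_sum, ← Finset.mul_sum,
      ← Finset.mul_sum, sum_coord_mul_partialD_radialExt hg hy0,
      sum_coord_mul_partialD_radialExt hf hy0, ← laplacian_eq_sum_partialD hF2,
      ← laplacian_eq_sum_partialD hG2, ← laplacian_radialExt_smul hf x hr,
      ← laplacian_radialExt_smul hg x hr]
    have hn : ‖y‖ ^ 2 = r ^ 2 := by rw [hy, norm_smul]; simp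
    have hFy : F y = f x := radialExt_smul_coe f x hr
    have hGy : G y = g x := radialExt_smul_coe g x hr
    simp only [χ, hn, hFy, hGy]
    ring
  have h2 := integral_polar_mul (fun r => b (r ^ 2))
    (fun x => f x * sphereLaplacian g x - g x * sphereLaplacian f x)
    (fun x => ∑ i, partialD i (u i) x) hkey
  rw [hsum] at h2
  -- If the radial factor vanished, the integral of the nonnegative bump `b (|x|²)` over `ℝ^d` would
  -- vanish too, although `b 1 = 1`.
  have h3 := integral_polar_mul (d := d) (fun r => b (r ^ 2)) (fun _ => 1)
    (fun x => b (‖x‖ ^ 2)) (fun r x hr => by simp [norm_smul])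
  rcases mul_eq_zero.mp h2.symm with h | h
  · exact h
  · exfalso
    rw [h, mul_zero] at h3
    have hcont : Continuous fun x : E d => b (‖x‖ ^ 2) :=
      hb.continuous.comp (contDiff_norm_sq ℝ (n := 0)).continuous
    have hcs : HasCompactSupport fun x : E d => b (‖x‖ ^ 2) := by
      refine HasCompactSupport.intro (isCompact_closedBall (0 : E d) 2) fun x hx => ?_
      have : 2 < ‖x‖ := by simpa using hx
      exact hbr (‖x‖ ^ 2) (by nlinarith)
    obtain ⟨e, he⟩ := exists_norm_eq (E d) (zero_le_one (α := ℝ))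
    exact (hcont.integral_pos_of_hasCompactSupport_nonneg_nonzero hcs (fun x => hb0 _)
      (x := e) (by simp [he, hb1])).ne' h3

/-! ### The Laplacian on polynomials and the harmonic decomposition. -/

open MvPolynomial in
lemma lapPoly_mul (p q : MvPolynomial (Fin d) ℝ) : lapPoly (p * q)
    = p * lapPoly q + 2 * ∑ i, pderiv i p * pderiv i q + lapPoly p * q := by
  rw [lapPoly_apply, lapPoly_apply, lapPoly_apply, Finset.mul_sum, Finset.mul_sum, Finset.sum_mul,
    ← Finset.sum_add_distrib, ← Finset.sum_add_distrib]
  refine Finset.sum_congr rfl fun i _ => ?_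
  simp only [Derivation.leibniz, smul_eq_mul, map_add]
  ring

/-- The polynomial `|x|²`. -/
def normSqPoly (d : ℕ) : MvPolynomial (Fin d) ℝ := ∑ i, MvPolynomial.X i ^ 2

lemma isHomogeneous_normSqPoly : (normSqPoly d).IsHomogeneous 2 :=
  MvPolynomial.IsHomogeneous.sum _ _ _ fun i _ => MvPolynomial.isHomogeneous_X_pow i 2

open MvPolynomial in
lemma pderiv_normSqPoly (i : Fin d) : pderiv i (normSqPoly d) = 2 * X i := by
  have h : ∀ j : Fin d, pderiv i ((X j : MvPolynomial (Fin d) ℝ) ^ 2)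
      = if j = i then 2 * X i else 0 := by
    intro j
    rw [Derivation.leibniz_pow, pderiv_X]
    by_cases hij : j = i
    · subst hij; simp
    · simp [hij]
  simp [normSqPoly, h]

open MvPolynomial in
lemma lapPoly_normSqPoly : lapPoly (normSqPoly d) = 2 * (d : MvPolynomial (Fin d) ℝ) := by
  rw [lapPoly_apply]
  have h : ∀ i : Fin d, pderiv i (pderiv i (normSqPoly d)) = 2 := by
    intro i
    rw [pderiv_normSqPoly, Derivation.leibniz]
    have : pderiv i (2 : MvPolynomial (Fin d) ℝ) = 0 := by
      rw [← map_ofNat (C : ℝ →+* MvPolynomial (Fin d) ℝ) 2]; exact pderiv_C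
    simp [this]
  simp [h]
  ring

lemma lapPoly_normSqPoly_mul {p : MvPolynomial (Fin d) ℝ} {n : ℕ} (hp : p.IsHomogeneous n) :
    lapPoly (normSqPoly d * p) = (2 * d + 4 * n) * p + normSqPoly d * lapPoly p := by
  rw [lapPoly_mul, lapPoly_normSqPoly]
  simp_rw [pderiv_normSqPoly, mul_assoc]
  rw [← Finset.mul_sum, hp.sum_X_mul_pderiv, nsmul_eq_mul]
  ring

/-- Harmonic homogeneous polynomials of degree `n`. -/
def harmonicPoly (d n : ℕ) : Submodule ℝ (MvPolynomial (Fin d) ℝ) :=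
  MvPolynomial.homogeneousSubmodule (Fin d) ℝ n ⊓ LinearMap.ker lapPoly

lemma mem_harmonicPoly {n : ℕ} {p : MvPolynomial (Fin d) ℝ} :
    p ∈ harmonicPoly d n ↔ p.IsHomogeneous n ∧ lapPoly p = 0 := Iff.rfl

/-- On the family `|x|^{2j} h` the Laplacian lowers `j` by one with an explicit constant, nonzero
for `d > 0`. This allows it to be inverted on the span. -/
lemma lapPoly_normSqPoly_pow_mul {h : MvPolynomial (Fin d) ℝ} {m : ℕ} (hh : h ∈ harmonicPoly d m)
    (j : ℕ) : lapPoly (normSqPoly d ^ (j + 1) * h)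
      = (2 * (j + 1) * (2 * j + 2 * m + d)) * (normSqPoly d ^ j * h) := by
  induction j with
  | zero =>
    rw [zero_add, pow_one, lapPoly_normSqPoly_mul hh.1, (mem_harmonicPoly.mp hh).2]
    push_cast
    ring
  | succ j ih =>
    have hom : (normSqPoly d ^ (j + 1) * h).IsHomogeneous (2 * (j + 1) + m) :=
      (isHomogeneous_normSqPoly.pow (j + 1)).mul hh.1
    rw [pow_succ' _ (j + 1), mul_assoc, lapPoly_normSqPoly_mul hom, ih]
    push_cast
    ring

lemma isHomogeneous_lapPoly {p : MvPolynomial (Fin d) ℝ} {n : ℕ}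
    (hp : p.IsHomogeneous (n + 2)) : (lapPoly p).IsHomogeneous n := by
  rw [lapPoly_apply]
  exact MvPolynomial.IsHomogeneous.sum _ _ _ fun i _ => (hp.pderiv (i := i)).pderiv (i := i)

lemma lapPoly_eq_zero {p : MvPolynomial (Fin d) ℝ} {n : ℕ}
    (hp : p.IsHomogeneous n) (hn : n < 2) : lapPoly p = 0 := by
  rw [lapPoly_apply]
  refine Finset.sum_eq_zero fun i _ => ?_
  have h : (MvPolynomial.pderiv i p).IsHomogeneous 0 := by
    have := hp.pderiv (i := i)
    rwa [show n - 1 = 0 by omega] at this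
  rw [← MvPolynomial.totalDegree_zero_iff_isHomogeneous,
    MvPolynomial.totalDegree_eq_zero_iff_eq_C] at h
  rw [h, MvPolynomial.pderiv_C]

/-- The span of the polynomials `|x|^{2j} h` of degree `n` with `h` harmonic. -/
def harmonicSpan (d n : ℕ) : Submodule ℝ (MvPolynomial (Fin d) ℝ) :=
  Submodule.span ℝ {q | ∃ j m h, m + 2 * j = n ∧ h ∈ harmonicPoly d m ∧ q = normSqPoly d ^ j * h}

lemma isHomogeneous_of_mem_harmonicSpan {n : ℕ} {q : MvPolynomial (Fin d) ℝ}
    (hq : q ∈ harmonicSpan d n) : q.IsHomogeneous n := by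
  rw [← MvPolynomial.mem_homogeneousSubmodule]
  refine (Submodule.span_le.mpr ?_) hq
  rintro _ ⟨j, m, h, rfl, hh, rfl⟩
  rw [add_comm]
  exact (isHomogeneous_normSqPoly.pow j).mul hh.1

lemma exists_lapPoly_eq_of_mem_harmonicSpan (hd : 0 < d) {n : ℕ} {q : MvPolynomial (Fin d) ℝ}
    (hq : q ∈ harmonicSpan d n) : ∃ q' ∈ harmonicSpan d (n + 2), lapPoly q' = q := by
  induction hq using Submodule.span_induction with
  | mem x hx =>
    obtain ⟨j, m, h, hn, hh, rfl⟩ := hx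
    set c : ℝ := 2 * (j + 1) * (2 * j + 2 * m + d) with hc
    have hd' : (0 : ℝ) < d := by exact_mod_cast hd
    have hc0 : c ≠ 0 := by positivity
    refine ⟨c⁻¹ • (normSqPoly d ^ (j + 1) * h), Submodule.smul_mem _ _ (Submodule.subset_span
      ⟨j + 1, m, h, by omega, hh, rfl⟩), ?_⟩
    rw [map_smul, lapPoly_normSqPoly_pow_mul hh]
    have : (2 * (j + 1) * (2 * j + 2 * m + d) : MvPolynomial (Fin d) ℝ) = MvPolynomial.C c := by
      simp [hc, map_ofNat (MvPolynomial.C : ℝ →+* MvPolynomial (Fin d) ℝ) 2]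
    rw [this, MvPolynomial.C_mul', smul_smul, inv_mul_cancel₀ hc0, one_smul]
  | zero => exact ⟨0, Submodule.zero_mem _, map_zero _⟩
  | add x y _ _ hx hy =>
    obtain ⟨x', hx', rfl⟩ := hx
    obtain ⟨y', hy', rfl⟩ := hy
    exact ⟨x' + y', Submodule.add_mem _ hx' hy', map_add _ _ _⟩
  | smul a x _ hx =>
    obtain ⟨x', hx', rfl⟩ := hx
    exact ⟨a • x', Submodule.smul_mem _ _ hx', map_smul _ _ _⟩

/-- Every homogeneous polynomial is a combination of the `|x|^{2j} h` with `h` harmonic. -/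
theorem mem_harmonicSpan (hd : 0 < d) {n : ℕ} {p : MvPolynomial (Fin d) ℝ}
    (hp : p.IsHomogeneous n) : p ∈ harmonicSpan d n := by
  induction n using Nat.strong_induction_on generalizing p with
  | _ n ih =>
    by_cases hn : n < 2
    · exact Submodule.subset_span ⟨0, n, p, rfl, ⟨hp, lapPoly_eq_zero hp hn⟩, by simp⟩
    · obtain ⟨k, rfl⟩ : ∃ k, n = k + 2 := ⟨n - 2, by omega⟩
      -- By induction the Laplacian of `p` lies in the span, so some `q` in the span has the same
      -- Laplacian. Then `p - q` is harmonic.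
      obtain ⟨q, hq, hqp⟩ := exists_lapPoly_eq_of_mem_harmonicSpan hd
        (ih k (by omega) (isHomogeneous_lapPoly hp))
      have h : p - q ∈ harmonicSpan d (k + 2) := by
        refine Submodule.subset_span ⟨0, k + 2, p - q, rfl, ⟨?_, ?_⟩, by simp⟩
        · exact hp.sub (isHomogeneous_of_mem_harmonicSpan hq)
        · simp [hqp]
      simpa using Submodule.add_mem _ h hq

lemma exists_lapPoly_eq (hd : 0 < d) {n : ℕ} {q : MvPolynomial (Fin d) ℝ}
    (hq : q.IsHomogeneous n) : ∃ q', q'.IsHomogeneous (n + 2) ∧ lapPoly q' = q := by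
  obtain ⟨q', h, h'⟩ := exists_lapPoly_eq_of_mem_harmonicSpan hd (mem_harmonicSpan hd hq)
  exact ⟨q', isHomogeneous_of_mem_harmonicSpan h, h'⟩

/-! ### Dimensions -/

instance finite_homogeneousSubmodule (n : ℕ) :
    Module.Finite ℝ (MvPolynomial.homogeneousSubmodule (Fin d) ℝ n) :=
  Module.Finite.iff_fg.mpr (MvPolynomial.homogeneousSubmodule_fg (Fin d) ℝ n)

instance finite_harmonicPoly (n : ℕ) : Module.Finite ℝ (harmonicPoly d n) :=
  Submodule.finiteDimensional_of_le (S₂ := MvPolynomial.homogeneousSubmodule (Fin d) ℝ n)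
    inf_le_left

lemma finrank_homogeneousSubmodule (n : ℕ) :
    Module.finrank ℝ (MvPolynomial.homogeneousSubmodule (Fin d) ℝ n) = (d + n - 1).choose n := by
  classical
  have hs : {m : Fin d →₀ ℕ | m.degree = n}
      = ↑(Finset.finsuppAntidiag (Finset.univ : Finset (Fin d)) n) := by
    ext m
    simp [Finsupp.degree_eq_sum]
  rw [MvPolynomial.homogeneousSubmodule_eq_finsupp_supported,
    (AddMonoidAlgebra.supportedEquivFinsupp (R := ℝ) (S := ℝ) _).finrank_eq, hs]
  simp [Finset.card_finsuppAntidiag_nat_eq_choose]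

lemma harmonicPoly_eq_of_lt {n : ℕ} (hn : n < 2) :
    harmonicPoly d n = MvPolynomial.homogeneousSubmodule (Fin d) ℝ n :=
  inf_eq_left.mpr fun _ hp => lapPoly_eq_zero hp hn

/-- Rank-nullity for the surjective Laplacian from degree `n + 2` to degree `n`, in additive form to
avoid truncated subtraction. -/
lemma finrank_harmonicPoly_add (hd : 0 < d) (n : ℕ) :
    Module.finrank ℝ (harmonicPoly d (n + 2)) + (d + n - 1).choose n
      = (d + n + 1).choose (n + 2) := by
  let A := MvPolynomial.homogeneousSubmodule (Fin d) ℝ (n + 2)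
  let B := MvPolynomial.homogeneousSubmodule (Fin d) ℝ n
  let L : A →ₗ[ℝ] B := lapPoly.restrict fun p hp => isHomogeneous_lapPoly hp
  have hL : LinearMap.range L = ⊤ := by
    rw [LinearMap.range_eq_top]
    rintro ⟨q, hq⟩
    obtain ⟨q', h, h'⟩ := exists_lapPoly_eq hd hq
    exact ⟨⟨q', h⟩, Subtype.ext h'⟩
  have hk : (LinearMap.ker L).map A.subtype = harmonicPoly d (n + 2) := by
    ext p
    simp only [Submodule.mem_map, LinearMap.mem_ker, Submodule.subtype_apply, Subtype.exists]
    constructor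
    · rintro ⟨q, hq, h, rfl⟩
      exact ⟨hq, congrArg Subtype.val h⟩
    · rintro ⟨h1, h2⟩
      exact ⟨p, h1, Subtype.ext h2, rfl⟩
  have h := L.finrank_range_add_finrank_ker
  rw [hL, finrank_top, finrank_homogeneousSubmodule, finrank_homogeneousSubmodule] at h
  rw [← hk, ← (Submodule.equivMapOfInjective A.subtype A.injective_subtype _).finrank_eq]
  rw [show d + n + 1 = d + (n + 2) - 1 by omega]
  omega

lemma finrank_harmonicPoly_zero : Module.finrank ℝ (harmonicPoly d 0) = 1 := by
  rw [harmonicPoly_eq_of_lt (by norm_num), finrank_homogeneousSubmodule]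
  simp

lemma finrank_harmonicPoly (hd : 2 ≤ d) {n : ℕ} (hn : 1 ≤ n) :
    (Module.finrank ℝ (harmonicPoly d n) : ℝ) = harmonicDim d n := by
  obtain ⟨e, rfl⟩ : ∃ e, d = e + 2 := ⟨d - 2, by omega⟩
  unfold harmonicDim
  rcases Nat.lt_or_ge n 2 with h | h
  · obtain rfl : n = 1 := by omega
    rw [harmonicPoly_eq_of_lt (by norm_num), finrank_homogeneousSubmodule]
    simp
  · obtain ⟨k, rfl⟩ : ∃ k, n = k + 2 := ⟨n - 2, by omega⟩
    have h1 := finrank_harmonicPoly_add (d := e + 2) (by omega) k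
    have h2 : (Module.finrank ℝ (harmonicPoly (e + 2) (k + 2)) : ℝ)
        = ((e + k + 3).choose (k + 2) : ℝ) - ((e + k + 1).choose k : ℝ) := by
      have : (Module.finrank ℝ (harmonicPoly (e + 2) (k + 2)) : ℝ) + ((e + k + 1).choose k : ℝ)
          = ((e + k + 3).choose (k + 2) : ℝ) := by
        rw [show e + 2 + k - 1 = e + k + 1 by omega, show e + 2 + k + 1 = e + k + 3 by omega] at h1
        exact_mod_cast h1
      linarith
    rw [h2, show k + 2 + (e + 2) - 3 = e + k + 1 by omega, show k + 2 - 1 = k + 1 by omega]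
    -- Pascal's rule twice. The identity `a2` then expresses the last coefficient through the middle
    -- one, the only binomial in `harmonicDim`.
    have a1 : (e + k + 3).choose (k + 2) = (e + k + 1).choose k + 2 * (e + k + 1).choose (k + 1)
        + (e + k + 1).choose (k + 2) := by
      rw [show e + k + 3 = (e + k + 1 + 1) + 1 by ring, Nat.choose_succ_succ',
        Nat.choose_succ_succ' (e + k + 1), Nat.choose_succ_succ' (e + k + 1) (k + 1)]
      ring
    have a2 : ((e + k + 1).choose (k + 2) : ℝ) * (k + 2) = (e + k + 1).choose (k + 1) * e := by
      have := Nat.choose_succ_right_eq (e + k + 1) (k + 1)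
      rw [show e + k + 1 - (k + 1) = e by omega] at this
      exact_mod_cast this
    rw [a1]
    push_cast
    have hk : (k : ℝ) + 2 ≠ 0 := by positivity
    field_simp
    linear_combination a2

/-! ### Zonal polynomials -/

/-- The linear form `x ↦ k · x`. -/
def linPoly (k : E d) : MvPolynomial (Fin d) ℝ := ∑ i, MvPolynomial.C (k i) * MvPolynomial.X i

/-- The derivative in the direction `k`. -/
def dirDeriv (k : E d) : Derivation ℝ (MvPolynomial (Fin d) ℝ) (MvPolynomial (Fin d) ℝ) :=
  ∑ i, k i • MvPolynomial.pderiv i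

lemma dirDeriv_apply (k : E d) (p : MvPolynomial (Fin d) ℝ) :
    dirDeriv k p = ∑ i, MvPolynomial.C (k i) * MvPolynomial.pderiv i p := by
  let f : Derivation ℝ (MvPolynomial (Fin d) ℝ) (MvPolynomial (Fin d) ℝ) →+
    (MvPolynomial (Fin d) ℝ → MvPolynomial (Fin d) ℝ) := Derivation.coeFnAddMonoidHom
  have h := congrFun (map_sum f (fun i => k i • MvPolynomial.pderiv i) Finset.univ) p
  rw [Finset.sum_apply] at h
  have h' : dirDeriv k p = ∑ i, (k i • MvPolynomial.pderiv i :
      Derivation ℝ (MvPolynomial (Fin d) ℝ) (MvPolynomial (Fin d) ℝ)) p := h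
  rw [h']
  simp [MvPolynomial.smul_eq_C_mul]

open MvPolynomial in
lemma pderiv_linPoly (k : E d) (i : Fin d) : pderiv i (linPoly k) = C (k i) := by
  have h : ∀ j, pderiv i (C (k j) * X j : MvPolynomial (Fin d) ℝ)
      = if j = i then C (k i) else 0 := by
    intro j
    rw [Derivation.leibniz, pderiv_X, pderiv_C]
    by_cases hij : j = i
    · subst hij; simp
    · simp [hij]
  simp [linPoly, h]

lemma isHomogeneous_linPoly (k : E d) : (linPoly k).IsHomogeneous 1 :=
  MvPolynomial.IsHomogeneous.sum _ _ _ fun _ _ => MvPolynomial.isHomogeneous_C_mul_X _ _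

lemma lapPoly_linPoly_mul (k : E d) (p : MvPolynomial (Fin d) ℝ) :
    lapPoly (linPoly k * p) = 2 * dirDeriv k p + linPoly k * lapPoly p := by
  rw [lapPoly_mul, dirDeriv_apply, lapPoly_eq_zero (isHomogeneous_linPoly k) (by norm_num)]
  simp_rw [pderiv_linPoly]
  ring

lemma dirDeriv_linPoly (k : S d) : dirDeriv (k : E d) (linPoly (k : E d)) = 1 := by
  rw [dirDeriv_apply]
  simp_rw [pderiv_linPoly, ← map_mul, ← map_sum]
  have : ∑ i, (k : E d) i * (k : E d) i = 1 := by
    simp_rw [← sq]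
    rw [sum_coord_sq]; simp
  rw [this, map_one]

lemma dirDeriv_normSqPoly (k : E d) : dirDeriv k (normSqPoly d) = 2 * linPoly k := by
  rw [dirDeriv_apply, linPoly, Finset.mul_sum]
  simp_rw [pderiv_normSqPoly]
  exact Finset.sum_congr rfl fun i _ => by ring

/-- The zonal harmonic polynomials `|x|^n P_n(k · x / |x|)`. -/
def zonalPoly (k : E d) : ℕ → MvPolynomial (Fin d) ℝ
  | 0 => 1
  | 1 => linPoly k
  | n + 2 => MvPolynomial.C (((n : ℝ) + 1 + (d : ℝ) - 2)⁻¹) *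
      (MvPolynomial.C (2 * ((n : ℝ) + 1) + (d : ℝ) - 2) * linPoly k * zonalPoly k (n + 1)
        - MvPolynomial.C ((n : ℝ) + 1) * normSqPoly d * zonalPoly k n)

lemma polyFun_linPoly (k x : E d) : polyFun (linPoly k) x = ⟪k, x⟫ := by
  simp [polyFun, linPoly, PiLp.inner_apply, mul_comm]

lemma polyFun_normSqPoly (x : E d) : polyFun (normSqPoly d) x = ‖x‖ ^ 2 := by
  simp [polyFun, normSqPoly, EuclideanSpace.norm_sq_eq]

lemma polyRestrict_zonalPoly (k : E d) (n : ℕ) (x : S d) :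
    polyRestrict (zonalPoly k n) x = (legendre d n).eval ⟪k, (x : E d)⟫ := by
  induction n using Nat.twoStepInduction with
  | zero => simp [polyRestrict, polyFun, zonalPoly, legendre]
  | one => simp [polyRestrict, polyFun_linPoly, zonalPoly, legendre]
  | more n h0 h1 =>
    have h2 := polyFun_linPoly k (x : E d)
    have h3 := polyFun_normSqPoly (x : E d)
    simp only [polyRestrict, polyFun, norm_sphere] at h0 h1 h2 h3 ⊢
    simp [zonalPoly, legendre, h0, h1, h2, h3]

lemma zonalPoly_recursion (hd : 2 ≤ d) (k : E d) (n : ℕ) :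
    ((n : MvPolynomial (Fin d) ℝ) + (d : MvPolynomial (Fin d) ℝ) - 1) * zonalPoly k (n + 2)
      = (2 * n + d) * linPoly k * zonalPoly k (n + 1) - (n + 1) * normSqPoly d * zonalPoly k n := by
  have h0 : ((n : ℝ) + 1 + (d : ℝ) - 2) ≠ 0 := by
    have : (2 : ℝ) ≤ d := by exact_mod_cast hd
    have := Nat.cast_nonneg (α := ℝ) n
    linarith
  have h2 := map_ofNat (MvPolynomial.C : ℝ →+* MvPolynomial (Fin d) ℝ) 2
  have h1 : ((n : MvPolynomial (Fin d) ℝ) + (d : MvPolynomial (Fin d) ℝ) - 1)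
      = MvPolynomial.C ((n : ℝ) + 1 + (d : ℝ) - 2) := by
    simp [h2]; ring
  rw [h1, zonalPoly, ← mul_assoc, ← map_mul, mul_inv_cancel₀ h0]
  simp only [map_add, map_sub, map_mul, map_natCast, map_one, h2]
  ring

lemma natCast_add_sub_ne_zero (hd : 2 ≤ d) (n : ℕ) :
    ((n : MvPolynomial (Fin d) ℝ) + (d : MvPolynomial (Fin d) ℝ) - 1) ≠ 0 := by
  obtain ⟨e, rfl⟩ : ∃ e, d = e + 2 := ⟨d - 2, by omega⟩
  have : ((n : MvPolynomial (Fin (e + 2)) ℝ) + ((e + 2 : ℕ) : MvPolynomial (Fin (e + 2)) ℝ) - 1)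
      = ((n + e + 1 : ℕ) : MvPolynomial (Fin (e + 2)) ℝ) := by push_cast; ring
  rw [this]
  exact Nat.cast_ne_zero.mpr (by omega)

/-- This closed form is what makes the zonal polynomials harmonic: it evaluates the cross term
produced when the Laplacian hits `(k · x) Z_{n+1}` in the recursion. -/
lemma dirDeriv_zonalPoly (hd : 2 ≤ d) (k : S d) (n : ℕ) :
    dirDeriv (k : E d) (zonalPoly (k : E d) (n + 1)) = (n + 1) * zonalPoly (k : E d) n := by
  have hrec : ∀ n : ℕ, ((n : MvPolynomial (Fin d) ℝ) + (d : MvPolynomial (Fin d) ℝ) - 1)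
      * dirDeriv (k : E d) (zonalPoly (k : E d) (n + 2))
      = (2 * n + d) * (zonalPoly (k : E d) (n + 1)
        + linPoly (k : E d) * dirDeriv (k : E d) (zonalPoly (k : E d) (n + 1)))
      - (n + 1) * (2 * linPoly (k : E d) * zonalPoly (k : E d) n
        + normSqPoly d * dirDeriv (k : E d) (zonalPoly (k : E d) n)) := by
    intro n
    have h := congrArg (dirDeriv (k : E d)) (zonalPoly_recursion hd (k : E d) n)
    have hc : ∀ c : ℕ, dirDeriv (k : E d) (c : MvPolynomial (Fin d) ℝ) = 0 :=
      fun c => Derivation.map_natCast _ c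
    have h2 : dirDeriv (k : E d) (2 : MvPolynomial (Fin d) ℝ) = 0 := hc 2
    simp only [Derivation.leibniz, map_sub, map_add, smul_eq_mul, hc, h2, dirDeriv_linPoly,
      dirDeriv_normSqPoly, Derivation.map_one_eq_zero] at h
    linear_combination h
  have h0 : dirDeriv (k : E d) (zonalPoly (k : E d) 0) = 0 := by simp [zonalPoly]
  induction n using Nat.twoStepInduction with
  | zero => simp [zonalPoly, dirDeriv_linPoly]
  | one =>
    have h := hrec 0
    have h1 : dirDeriv (k : E d) (zonalPoly (k : E d) 1) = 1 := dirDeriv_linPoly k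
    apply mul_left_cancel₀ (natCast_add_sub_ne_zero hd 0)
    rw [h, zero_add, h1, h0]
    simp only [zonalPoly]
    push_cast
    ring
  | more n ih0 ih1 =>
    apply mul_left_cancel₀ (natCast_add_sub_ne_zero hd (n + 1))
    rw [hrec (n + 1), ih1, ih0]
    have h := zonalPoly_recursion hd (k : E d) n
    push_cast at h ⊢
    -- The recursion one step lower eliminates `|x|² Z_n`.
    linear_combination -(n + 2 : MvPolynomial (Fin d) ℝ) * h

lemma isHomogeneous_zonalPoly (k : E d) (n : ℕ) : (zonalPoly k n).IsHomogeneous n := by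
  induction n using Nat.twoStepInduction with
  | zero => exact MvPolynomial.isHomogeneous_one _ _
  | one => exact isHomogeneous_linPoly k
  | more n h0 h1 =>
    rw [zonalPoly]
    refine MvPolynomial.IsHomogeneous.C_mul (MvPolynomial.IsHomogeneous.sub ?_ ?_) _
    · have := ((isHomogeneous_linPoly k).C_mul (2 * ((n : ℝ) + 1) + (d : ℝ) - 2)).mul h1
      rwa [show 1 + (n + 1) = n + 2 by ring] at this
    · have := ((isHomogeneous_normSqPoly (d := d)).C_mul ((n : ℝ) + 1)).mul h0
      rwa [show 2 + n = n + 2 by ring] at this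

lemma lapPoly_natCast_mul (c : ℕ) (p : MvPolynomial (Fin d) ℝ) :
    lapPoly ((c : MvPolynomial (Fin d) ℝ) * p) = c * lapPoly p := by
  rw [← nsmul_eq_mul, map_nsmul, nsmul_eq_mul]

/-- Applying the Laplacian to the recursion leaves `2(2n + d) ∂_k Z_{n+1} - (n + 1)(2d + 4n) Z_n`,
and this is zero since `∂_k Z_{n+1} = (n + 1) Z_n`. -/
theorem zonalPoly_mem_harmonicPoly (hd : 2 ≤ d) (k : S d) (n : ℕ) :
    zonalPoly (k : E d) n ∈ harmonicPoly d n := by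
  refine ⟨isHomogeneous_zonalPoly _ n, ?_⟩
  change lapPoly _ = 0
  induction n using Nat.twoStepInduction with
  | zero => exact lapPoly_eq_zero (isHomogeneous_zonalPoly _ 0) (by norm_num)
  | one => exact lapPoly_eq_zero (isHomogeneous_zonalPoly _ 1) (by norm_num)
  | more n h0 h1 =>
    obtain ⟨e, rfl⟩ : ∃ e, d = e + 2 := ⟨d - 2, by omega⟩
    apply mul_left_cancel₀ (natCast_add_sub_ne_zero hd n)
    have h := zonalPoly_recursion hd (k : E (e + 2)) n
    have e1 : ((n : MvPolynomial (Fin (e + 2)) ℝ) + ((e + 2 : ℕ) : MvPolynomial _ ℝ) - 1)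
        = ((n + e + 1 : ℕ) : MvPolynomial (Fin (e + 2)) ℝ) := by push_cast; ring
    have e2 : (2 * (n : MvPolynomial (Fin (e + 2)) ℝ) + ((e + 2 : ℕ) : MvPolynomial _ ℝ))
        = ((2 * n + (e + 2) : ℕ) : MvPolynomial (Fin (e + 2)) ℝ) := by push_cast; ring
    have e3 : ((n : MvPolynomial (Fin (e + 2)) ℝ) + 1)
        = ((n + 1 : ℕ) : MvPolynomial (Fin (e + 2)) ℝ) := by push_cast; ring
    rw [mul_zero, e1, ← lapPoly_natCast_mul, ← e1, h, e2, e3, map_sub, mul_assoc, mul_assoc,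
      lapPoly_natCast_mul, lapPoly_natCast_mul, lapPoly_linPoly_mul,
      lapPoly_normSqPoly_mul (isHomogeneous_zonalPoly _ n), h0, h1, dirDeriv_zonalPoly hd k n]
    push_cast
    ring

lemma nontrivial_E (hd : 2 ≤ d) : Nontrivial (E d) := by
  have : Nonempty (Fin d) := ⟨⟨0, by omega⟩⟩
  infer_instance

lemma nonempty_S (hd : 2 ≤ d) : Nonempty (S d) := by
  have := nontrivial_E hd
  obtain ⟨e, he⟩ := exists_norm_eq (E d) (zero_le_one (α := ℝ))
  exact ⟨⟨e, by simpa using he⟩⟩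

/-! ### Orthogonality of spherical harmonics -/

lemma eigenvalue_injective (hd : 2 ≤ d) {ℓ m : ℕ}
    (h : (ℓ : ℝ) * ((ℓ : ℝ) + (d : ℝ) - 2) = (m : ℝ) * ((m : ℝ) + (d : ℝ) - 2)) : ℓ = m := by
  obtain ⟨e, rfl⟩ : ∃ e, d = e + 2 := ⟨d - 2, by omega⟩
  have h1 : ((ℓ : ℝ) - m) * (ℓ + m + e) = 0 := by push_cast at h; linear_combination h
  rcases mul_eq_zero.mp h1 with h2 | h2
  · exact_mod_cast sub_eq_zero.mp h2
  -- The second factor vanishes only when `d = 2` and both degrees are `0`, where the conclusion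
  -- still holds.
  · have : ℓ + m + e = 0 := by exact_mod_cast h2
    omega

lemma integral_mul_eq_zero (hd : 2 ≤ d) {ℓ m : ℕ} (hlm : ℓ ≠ m) {f g : S d → ℝ}
    (hf : f ∈ sphericalHarmonics d ℓ) (hg : g ∈ sphericalHarmonics d m) :
    ∫ x, f x * g x ∂surf d = 0 := by
  have := nontrivial_E hd
  have h := integral_mul_sphereLaplacian hf.1 hg.1
  have h2 : ∀ x, f x * sphereLaplacian g x - g x * sphereLaplacian f x
      = ((ℓ : ℝ) * ((ℓ : ℝ) + (d : ℝ) - 2) - (m : ℝ) * ((m : ℝ) + (d : ℝ) - 2))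
        * (f x * g x) := by
    intro x
    linear_combination -f x * hg.2 x + g x * hf.2 x
  simp_rw [h2] at h
  rw [integral_const_mul] at h
  rcases mul_eq_zero.mp h with h3 | h3
  · exact absurd (eigenvalue_injective hd (sub_eq_zero.mp h3)) hlm
  · exact h3

lemma polyRestrict_mem {ℓ : ℕ} {p : MvPolynomial (Fin d) ℝ} (hp : p ∈ harmonicPoly d ℓ) :
    polyRestrict p ∈ sphericalHarmonics d ℓ := by
  refine ⟨isSmooth_polyRestrict hp.1, fun x => ?_⟩
  rw [sphereLaplacian_polyRestrict hp.1, (mem_harmonicPoly.mp hp).2]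
  simp [polyRestrict, polyFun]

/-! ### Density of spherical harmonics -/

/-- The class in `L²` of a continuous function on the sphere. -/
def contL2 (d : ℕ) : C(S d, ℝ) →L[ℝ] L2 d := ContinuousMap.toLp 2 (surf d) ℝ

lemma coeFn_contL2 (f : C(S d, ℝ)) : contL2 d f =ᵐ[surf d] f := ContinuousMap.coeFn_toLp _ f

lemma contL2_injective : Function.Injective (contL2 d) := ContinuousMap.toLp_injective _

lemma inner_eq_integral (f g : L2 d) : ⟪f, g⟫ = ∫ x, f x * g x ∂surf d := by
  rw [L2.inner_def]
  refine integral_congr_ae (Filter.Eventually.of_forall fun x => ?_)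
  simp [mul_comm]

lemma inner_contL2 (f g : C(S d, ℝ)) : ⟪contL2 d f, contL2 d g⟫ = ∫ x, f x * g x ∂surf d := by
  rw [inner_eq_integral]
  refine integral_congr_ae ?_
  filter_upwards [coeFn_contL2 f, coeFn_contL2 g] with x h1 h2
  rw [h1, h2]

/-- Restriction of polynomials to the sphere, as an algebra homomorphism. -/
def polyCM (d : ℕ) : MvPolynomial (Fin d) ℝ →ₐ[ℝ] C(S d, ℝ) :=
  MvPolynomial.aeval fun i => ⟨fun x => (x : E d) i, by fun_prop⟩

lemma polyCM_apply (p : MvPolynomial (Fin d) ℝ) (x : S d) : polyCM d p x = polyRestrict p x := by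
  induction p using MvPolynomial.induction_on with
  | C a => simp [polyCM, polyRestrict, polyFun]
  | add p q hp hq =>
    rw [map_add, ContinuousMap.add_apply, hp, hq]
    simp [polyRestrict, polyFun]
  | mul_X p i hp =>
    rw [map_mul, ContinuousMap.mul_apply, hp]
    simp [polyCM, polyRestrict, polyFun]

lemma polyCM_normSqPoly : polyCM d (normSqPoly d) = 1 := by
  ext x
  rw [polyCM_apply, polyRestrict, polyFun_normSqPoly]
  simp

/-- The harmonic polynomials of degree `ℓ`, as a subspace of `L²`. -/
def harmonicL2 (d ℓ : ℕ) : Submodule ℝ (L2 d) :=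
  (harmonicPoly d ℓ).map ((contL2 d).toLinearMap ∘ₗ (polyCM d).toLinearMap)

instance (ℓ : ℕ) : FiniteDimensional ℝ (harmonicL2 d ℓ) := by
  unfold harmonicL2; infer_instance

/-- Since `|x|² = 1` on the sphere, `|x|^{2j} h` restricts to the same function as `h`. -/
lemma contL2_polyCM_mem (hd : 0 < d) (p : MvPolynomial (Fin d) ℝ) :
    contL2 d (polyCM d p) ∈ ⨆ ℓ, harmonicL2 d ℓ := by
  rw [← MvPolynomial.sum_homogeneousComponent p, map_sum, map_sum]
  refine Submodule.sum_mem _ fun n _ => ?_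
  have h := mem_harmonicSpan hd (MvPolynomial.homogeneousComponent_isHomogeneous n p)
  generalize MvPolynomial.homogeneousComponent n p = q at h
  induction h using Submodule.span_induction with
  | mem x hx =>
    obtain ⟨j, m, h, -, hh, rfl⟩ := hx
    rw [map_mul, map_pow, polyCM_normSqPoly, one_pow, one_mul]
    exact Submodule.mem_iSup_of_mem m ⟨h, hh, rfl⟩
  | zero => simp
  | add x y _ _ hx hy =>
    rw [map_add, map_add]
    exact Submodule.add_mem _ hx hy
  | smul a x _ hx =>
    rw [map_smul, map_smul]
    exact Submodule.smul_mem _ _ hx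

lemma closure_range_polyCM : (polyCM d).range.topologicalClosure = ⊤ := by
  apply ContinuousMap.subalgebra_topologicalClosure_eq_top_of_separatesPoints
  intro x y hxy
  have : ∃ i, (x : E d) i ≠ (y : E d) i := by
    by_contra! h
    exact hxy (Subtype.ext (by ext i; exact h i))
  obtain ⟨i, hi⟩ := this
  refine ⟨_, ⟨polyCM d (MvPolynomial.X i), ⟨_, rfl⟩, rfl⟩, ?_⟩
  simpa [polyCM] using hi

/-- Polynomials are uniformly dense in the continuous functions by Stone-Weierstrass, and these are
dense in `L²`. -/
lemma closure_iSup_harmonicL2 (hd : 0 < d) :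
    (⨆ ℓ, harmonicL2 d ℓ).topologicalClosure = ⊤ := by
  set V := (⨆ ℓ, harmonicL2 d ℓ).topologicalClosure with hV
  have hcl : IsClosed (V : Set (L2 d)) := Submodule.isClosed_topologicalClosure _
  have h1 : ∀ f : C(S d, ℝ), contL2 d f ∈ V := by
    intro f
    have hf : f ∈ (polyCM d).range.topologicalClosure := by
      rw [closure_range_polyCM]; trivial
    have hc : IsClosed {f | contL2 d f ∈ V} := hcl.preimage (contL2 d).continuous
    have hsub : ((polyCM d).range : Set C(S d, ℝ)) ⊆ {f | contL2 d f ∈ V} := by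
      rintro _ ⟨p, rfl⟩
      exact Submodule.le_topologicalClosure _ (contL2_polyCM_mem hd p)
    exact closure_minimal hsub hc hf
  have hdense : DenseRange (contL2 d) :=
    ContinuousMap.toLp_denseRange ℝ (surf d) ℝ (by norm_num)
  rw [eq_top_iff]
  intro F _
  have : F ∈ closure (Set.range (contL2 d)) := hdense F
  exact closure_minimal (by rintro _ ⟨f, rfl⟩; exact h1 f) hcl this

lemma eq_zero_of_forall_inner (hd : 0 < d) {F : L2 d}
    (h : ∀ ℓ, ∀ G ∈ harmonicL2 d ℓ, ⟪G, F⟫ = 0) : F = 0 := by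
  have h1 : F ∈ (⨆ ℓ, harmonicL2 d ℓ)ᗮ := by
    rw [← Submodule.iInf_orthogonal, Submodule.mem_iInf]
    intro ℓ
    rw [Submodule.mem_orthogonal]
    exact h ℓ
  rw [← Submodule.orthogonal_closure, closure_iSup_harmonicL2 hd, Submodule.top_orthogonal_eq_bot] at h1
  simpa using h1

/-! ### Spherical harmonics are restrictions of harmonic polynomials -/

/-- A smooth function as a continuous map. -/
def smoothCM {f : S d → ℝ} (hf : IsSmooth f) : C(S d, ℝ) := ⟨f, hf.continuous⟩

/-- Subtract from `f` its `L²` projection onto the harmonic polynomials of degree `ℓ`. The remainder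
is orthogonal to degree `ℓ` by construction and to every other degree by Green's identity, hence is
zero in `L²` by completeness and everywhere by continuity. -/
theorem exists_polyRestrict_eq (hd : 2 ≤ d) {ℓ : ℕ} {f : S d → ℝ}
    (hf : f ∈ sphericalHarmonics d ℓ) : ∃ p ∈ harmonicPoly d ℓ, polyRestrict p = f := by
  set F := contL2 d (smoothCM hf.1) with hF
  obtain ⟨p, hp, hpF⟩ := (Submodule.mem_map).mp
    ((harmonicL2 d ℓ).starProjection_apply_mem F)
  refine ⟨p, hp, ?_⟩
  have hpm := polyRestrict_mem hp
  set g : S d → ℝ := f - polyRestrict p with hg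
  have hgm : g ∈ sphericalHarmonics d ℓ := Submodule.sub_mem _ hf hpm
  have hG : contL2 d (smoothCM hgm.1) = F - contL2 d (polyCM d p) := by
    rw [hF, ← map_sub]
    congr 1
    ext x
    simp [smoothCM, hg, polyCM_apply]
  have h0 : contL2 d (smoothCM hgm.1) = 0 := by
    refine eq_zero_of_forall_inner (by omega) fun m G hGm => ?_
    by_cases hlm : m = ℓ
    · subst hlm
      rw [hG]
      have : contL2 d (polyCM d p) = (harmonicL2 d m).starProjection F := hpF
      rw [this]
      have := (harmonicL2 d m).sub_starProjection_mem_orthogonal F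
      exact (Submodule.mem_orthogonal _ _).mp this G hGm
    · obtain ⟨q, hq, rfl⟩ := (Submodule.mem_map).mp hGm
      have : ⟪contL2 d (polyCM d q), contL2 d (smoothCM hgm.1)⟫ = 0 := by
        rw [inner_contL2]
        have := integral_mul_eq_zero hd hlm (polyRestrict_mem hq) hgm
        simpa [polyCM_apply, smoothCM] using this
      exact this
  have h1 : smoothCM hgm.1 = 0 := contL2_injective (by rw [h0, map_zero])
  have h2 : g = 0 := congrArg (fun c : C(S d, ℝ) => (c : S d → ℝ)) h1
  rw [hg, sub_eq_zero] at h2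
  exact h2.symm

lemma exists_eq_norm_smul (hd : 2 ≤ d) (x : E d) : ∃ y : S d, x = ‖x‖ • (y : E d) := by
  by_cases hx : x = 0
  · obtain ⟨y⟩ := nonempty_S hd
    exact ⟨y, by simp [hx]⟩
  · refine ⟨⟨‖x‖⁻¹ • x, ?_⟩, ?_⟩
    · rw [mem_sphere_zero_iff_norm, norm_smul, norm_inv, norm_norm,
        inv_mul_cancel₀ (norm_ne_zero_iff.mpr hx)]
    · simp [smul_smul, norm_ne_zero_iff.mpr hx]

lemma eq_zero_of_polyRestrict_eq_zero (hd : 2 ≤ d) {ℓ : ℕ} {p : MvPolynomial (Fin d) ℝ}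
    (hp : p.IsHomogeneous ℓ) (h : polyRestrict p = 0) : p = 0 := by
  refine MvPolynomial.funext fun v => ?_
  obtain ⟨y, hy⟩ := exists_eq_norm_smul hd (WithLp.toLp 2 v)
  have h1 : polyFun p (WithLp.toLp 2 v) = 0 := by
    rw [hy, polyFun_smul hp]
    have : polyFun p (y : E d) = 0 := congrFun h y
    rw [this, mul_zero]
  simpa [polyFun] using h1

/-- Restriction to the sphere identifies harmonic polynomials and spherical harmonics. -/
def harmonicEquiv (hd : 2 ≤ d) (ℓ : ℕ) : harmonicPoly d ℓ ≃ₗ[ℝ] sphericalHarmonics d ℓ :=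
  LinearEquiv.ofBijective
    { toFun := fun p => ⟨polyRestrict p.1, polyRestrict_mem p.2⟩
      map_add' := fun p q => by ext x; simp [polyRestrict, polyFun]
      map_smul' := fun c p => by ext x; simp [polyRestrict, polyFun] }
    (by
      constructor
      · rw [injective_iff_map_eq_zero]
        intro p hp
        exact Subtype.ext (eq_zero_of_polyRestrict_eq_zero hd p.2.1 (congrArg Subtype.val hp))
      · rintro ⟨f, hf⟩
        obtain ⟨p, hp, h⟩ := exists_polyRestrict_eq hd hf
        exact ⟨⟨p, hp⟩, Subtype.ext h⟩)

lemma finiteDimensional_sphericalHarmonics (hd : 2 ≤ d) (ℓ : ℕ) :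
    FiniteDimensional ℝ (sphericalHarmonics d ℓ) :=
  Module.Finite.equiv (harmonicEquiv hd ℓ)

theorem finrank_sphericalHarmonics_zero (hd : 2 ≤ d) :
    Module.finrank ℝ (sphericalHarmonics d 0) = 1 := by
  rw [← (harmonicEquiv hd 0).finrank_eq, finrank_harmonicPoly_zero]

theorem finrank_sphericalHarmonics (hd : 2 ≤ d) {ℓ : ℕ} (hℓ : 1 ≤ ℓ) :
    (Module.finrank ℝ (sphericalHarmonics d ℓ) : ℝ) = harmonicDim d ℓ := by
  rw [← (harmonicEquiv hd ℓ).finrank_eq, finrank_harmonicPoly hd hℓ]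

lemma sphericalHarmonicsL2_eq (hd : 2 ≤ d) (ℓ : ℕ) :
    sphericalHarmonicsL2 d ℓ = harmonicL2 d ℓ := by
  ext F
  constructor
  · rintro ⟨Y, hY, hFY⟩
    obtain ⟨p, hp, rfl⟩ := exists_polyRestrict_eq hd hY
    refine ⟨p, hp, ?_⟩
    apply Lp.ext
    refine (coeFn_contL2 (polyCM d p)).trans (EventuallyEq.trans ?_ hFY.symm)
    exact Filter.Eventually.of_forall fun x => polyCM_apply p x
  · rintro ⟨p, hp, rfl⟩
    refine ⟨polyRestrict p, polyRestrict_mem hp, (coeFn_contL2 (polyCM d p)).trans ?_⟩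
    exact Filter.Eventually.of_forall fun x => polyCM_apply p x

theorem isHilbertSum_sphericalHarmonicsL2 (hd : 2 ≤ d) :
    IsHilbertSum ℝ (fun ℓ : ℕ => sphericalHarmonicsL2 d ℓ)
      (fun ℓ : ℕ => (sphericalHarmonicsL2 d ℓ).subtypeₗᵢ) := by
  have : ∀ ℓ, FiniteDimensional ℝ (sphericalHarmonicsL2 d ℓ) := fun ℓ => by
    rw [sphericalHarmonicsL2_eq hd]; infer_instance
  have : ∀ ℓ, CompleteSpace (sphericalHarmonicsL2 d ℓ) := fun ℓ =>
    FiniteDimensional.complete ℝ _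
  refine IsHilbertSum.mkInternal _ ?_ ?_
  · rintro ℓ m hlm ⟨F, Y, hY, hFY⟩ ⟨G, Z, hZ, hGZ⟩
    change ⟪F, G⟫ = 0
    rw [inner_eq_integral, ← integral_mul_eq_zero hd hlm hY hZ]
    refine integral_congr_ae ?_
    filter_upwards [hFY, hGZ] with x h1 h2
    rw [h1, h2]
  · simp_rw [sphericalHarmonicsL2_eq hd]
    rw [closure_iSup_harmonicL2 (by omega)]

/-! ### Rotations act on spherical harmonics -/

lemma radialExt_comp_sphereMap (R : E d ≃ₗᵢ[ℝ] E d) (f : S d → ℝ) :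
    radialExt (f ∘ sphereMap R) = radialExt f ∘ R := by
  funext x
  by_cases hx : x = 0
  · simp [radialExt, hx]
  · have hRx : R x ≠ 0 := by simpa using hx
    rw [Function.comp_apply, radialExt_of_ne hx, radialExt_of_ne hRx, Function.comp_apply]
    congr 1
    ext1
    simp

lemma IsSmooth.comp_sphereMap {f : S d → ℝ} (hf : IsSmooth f) (R : E d ≃ₗᵢ[ℝ] E d) :
    IsSmooth (f ∘ sphereMap R) := by
  unfold IsSmooth
  rw [radialExt_comp_sphereMap]
  refine ContDiffOn.comp hf R.contDiff.contDiffOn fun x hx => ?_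
  simpa using hx

/-- The Laplacian can be computed in any orthonormal basis: the standard one on the left, its image
under `R` on the right. -/
lemma laplacian_comp_isometry (R : E d ≃ₗᵢ[ℝ] E d) (f : E d → ℝ) (x : E d) :
    Laplacian.laplacian (f ∘ R) x = Laplacian.laplacian f (R x) := by
  rw [InnerProductSpace.laplacian_eq_iteratedFDeriv_orthonormalBasis (f ∘ R)
    (EuclideanSpace.basisFun (Fin d) ℝ),
    InnerProductSpace.laplacian_eq_iteratedFDeriv_orthonormalBasis f
      ((EuclideanSpace.basisFun (Fin d) ℝ).map R)]
  refine Finset.sum_congr rfl fun i _ => ?_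
  have h := R.toContinuousLinearEquiv.iteratedFDerivWithin_comp_right f
    (s := Set.univ) uniqueDiffOn_univ (x := x) (Set.mem_univ _) 2
  rw [Set.preimage_univ, iteratedFDerivWithin_univ, iteratedFDerivWithin_univ] at h
  have h' : iteratedFDeriv ℝ 2 (f ∘ R) x
      = (iteratedFDeriv ℝ 2 f (R x)).compContinuousLinearMap
        fun _ => (R.toContinuousLinearEquiv : E d →L[ℝ] E d) := h
  rw [h', ContinuousMultilinearMap.compContinuousLinearMap_apply]
  congr 1
  funext j
  fin_cases j <;> simp

lemma sphericalHarmonics_comp (R : E d ≃ₗᵢ[ℝ] E d) {ℓ : ℕ} {f : S d → ℝ}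
    (hf : f ∈ sphericalHarmonics d ℓ) : f ∘ sphereMap R ∈ sphericalHarmonics d ℓ := by
  refine ⟨hf.1.comp_sphereMap R, fun x => ?_⟩
  unfold sphereLaplacian
  rw [radialExt_comp_sphereMap, laplacian_comp_isometry]
  exact hf.2 (sphereMap R x)

/-! ### Riesz representation on spherical harmonics -/

lemma eq_zero_of_integral_mul_self {f : S d → ℝ} (hf : Continuous f)
    (h : ∫ x, f x * f x ∂surf d = 0) : f = 0 := by
  rw [integral_eq_zero_iff_of_nonneg (fun x => mul_self_nonneg (f x))
    (integrable_of_continuous (hf.mul hf))] at h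
  have h2 := (Continuous.ae_eq_iff_eq (surf d) (hf.mul hf) continuous_const).mp h
  funext x
  exact mul_self_eq_zero.mp (congrFun h2 x)

lemma integrable_mul_of_continuous {f g : S d → ℝ} (hf : Continuous f) (hg : Continuous g) :
    Integrable (fun x => f x * g x) (surf d) := integrable_of_continuous (hf.mul hg)

lemma integrable_mul_of_mem {ℓ m : ℕ} {f g : S d → ℝ} (hf : f ∈ sphericalHarmonics d ℓ)
    (hg : g ∈ sphericalHarmonics d m) : Integrable (fun x => f x * g x) (surf d) :=
  integrable_of_continuous (hf.1.continuous.mul hg.1.continuous)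

/-- The `L²` inner product on spherical harmonics. -/
def harmonicPairing (d ℓ : ℕ) :
    sphericalHarmonics d ℓ →ₗ[ℝ] sphericalHarmonics d ℓ →ₗ[ℝ] ℝ :=
  LinearMap.mk₂ ℝ (fun f g => ∫ x, f.1 x * g.1 x ∂surf d)
    (fun f f' g => by
      rw [← integral_add (integrable_mul_of_mem f.2 g.2) (integrable_mul_of_mem f'.2 g.2)]
      exact integral_congr_ae (Filter.Eventually.of_forall fun x => add_mul _ _ _))
    (fun c f g => by
      rw [smul_eq_mul, ← integral_const_mul]
      exact integral_congr_ae (Filter.Eventually.of_forall fun x => mul_assoc _ _ _))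
    (fun f g g' => by
      rw [← integral_add (integrable_mul_of_mem f.2 g.2) (integrable_mul_of_mem f.2 g'.2)]
      exact integral_congr_ae (Filter.Eventually.of_forall fun x => mul_add _ _ _))
    (fun c f g => by
      rw [smul_eq_mul, ← integral_const_mul]
      exact integral_congr_ae (Filter.Eventually.of_forall fun x => mul_left_comm _ _ _))

/-- A nondegenerate pairing on a finite-dimensional space represents every functional. Working with
honest functions rather than classes keeps point evaluation available. -/
lemma exists_riesz (hd : 2 ≤ d) {ℓ : ℕ} (Λ : sphericalHarmonics d ℓ →ₗ[ℝ] ℝ) :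
    ∃ Z : sphericalHarmonics d ℓ, ∀ Y, Λ Y = ∫ x, Z.1 x * Y.1 x ∂surf d := by
  have := finiteDimensional_sphericalHarmonics hd ℓ
  have hinj : Function.Injective (harmonicPairing d ℓ) := by
    rw [injective_iff_map_eq_zero]
    intro f hf
    have h : harmonicPairing d ℓ f f = 0 := by rw [hf]; rfl
    exact Subtype.ext (eq_zero_of_integral_mul_self f.2.1.continuous h)
  have hsurj := (LinearMap.injective_iff_surjective_of_finrank_eq_finrank
    (Subspace.dual_finrank_eq (K := ℝ) (V := sphericalHarmonics d ℓ)).symm).mp hinj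
  obtain ⟨Z, hZ⟩ := hsurj Λ
  exact ⟨Z, fun Y => by rw [← hZ]; rfl⟩

/-! ### Zonal functions -/

/-- A function on the sphere that only depends on `k · σ`. -/
def IsZonal (k : S d) (f : S d → ℝ) : Prop :=
  ∀ x y : S d, ⟪(k : E d), (x : E d)⟫ = ⟪(k : E d), (y : E d)⟫ → f x = f y

/-- When `x` and `y` have equal inner product with `k`, the reflection in the hyperplane orthogonal
to `x - y` fixes `k` and sends `x` to `y`. Using reflections rather than rotations covers `d = 2`.
-/
lemma isZonal_of_invariant {k : S d} {f : S d → ℝ}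
    (h : ∀ R : E d ≃ₗᵢ[ℝ] E d, R k = k → f ∘ sphereMap R = f) : IsZonal k f := by
  intro x y hxy
  have hn : ‖(x : E d)‖ = ‖(y : E d)‖ := by simp
  have h1 := Submodule.reflection_sub (F := E d) hn
  set R := (ℝ ∙ ((x : E d) - (y : E d)))ᗮ.reflection
  have hk : R (k : E d) = k := by
    apply Submodule.reflection_mem_subspace_eq_self
    rw [Submodule.mem_orthogonal_singleton_iff_inner_left, inner_sub_right, hxy, sub_self]
  have h2 := congrFun (h R hk) x
  have h3 : sphereMap R x = y := Subtype.ext h1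
  rw [Function.comp_apply, h3] at h2
  exact h2.symm

lemma abs_inner_le_one (k x : S d) : |⟪(k : E d), (x : E d)⟫| ≤ 1 := by
  have := abs_real_inner_le_norm (k : E d) (x : E d)
  simpa using this

lemma inner_mem_Icc (k x : S d) : ⟪(k : E d), (x : E d)⟫ ∈ Set.Icc (-1 : ℝ) 1 :=
  abs_le.mp (abs_inner_le_one k x)

lemma exists_unit_orthogonal (hd : 2 ≤ d) (k : S d) :
    ∃ ω : S d, ⟪(k : E d), (ω : E d)⟫ = 0 := by
  have hne : (ℝ ∙ (k : E d))ᗮ ≠ ⊥ := by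
    intro h
    have h1 := (ℝ ∙ (k : E d)).finrank_add_finrank_orthogonal
    rw [h, finrank_bot, finrank_span_singleton (ne_zero_of_sphere k), finrank_euclideanSpace_fin]
      at h1
    omega
  obtain ⟨v, hv, hv0⟩ := Submodule.exists_mem_ne_zero_of_ne_bot hne
  refine ⟨⟨‖v‖⁻¹ • v, ?_⟩, ?_⟩
  · rw [mem_sphere_zero_iff_norm, norm_smul, norm_inv, norm_norm,
      inv_mul_cancel₀ (norm_ne_zero_iff.mpr hv0)]
  · simp only [inner_smul_right, Submodule.mem_orthogonal_singleton_iff_inner_right.mp hv, mul_zero]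

/-- The profile of a continuous zonal function is continuous. -/
lemma IsZonal.exists_profile (hd : 2 ≤ d) {k : S d} {f : S d → ℝ} (hf : IsZonal k f)
    (hc : Continuous f) : ∃ z : ℝ → ℝ, ContinuousOn z (Set.Icc (-1) 1) ∧
      ∀ x : S d, f x = z ⟪(k : E d), (x : E d)⟫ := by
  obtain ⟨ω, hω⟩ := exists_unit_orthogonal hd k
  have hn : ∀ t : Set.Icc (-1 : ℝ) 1,
      ‖t.1 • (k : E d) + √(1 - t.1 ^ 2) • (ω : E d)‖ = 1 := by
    rintro ⟨t, ht⟩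
    have h0 : 0 ≤ 1 - t ^ 2 := by nlinarith [ht.1, ht.2]
    have h1 : ‖t • (k : E d) + √(1 - t ^ 2) • (ω : E d)‖ ^ 2 = 1 := by
      rw [norm_add_sq_real]
      simp only [inner_smul_left, inner_smul_right, hω, norm_smul, norm_sphere, mul_one,
        mul_zero, add_zero, Real.norm_eq_abs, sq_abs, Real.sq_sqrt h0]
      ring
    exact (pow_eq_one_iff_of_nonneg (norm_nonneg _) two_ne_zero).mp h1
  -- A half great circle from `-k` to `k` meets every level set of `k · σ` once, so the profile is
  -- `f` along it.
  let γ : Set.Icc (-1 : ℝ) 1 → S d := fun t =>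
    ⟨t.1 • (k : E d) + √(1 - t.1 ^ 2) • (ω : E d), by simpa using hn t⟩
  have hγ : Continuous γ := by
    refine Continuous.subtype_mk ?_ _
    fun_prop
  refine ⟨Set.IccExtend (by norm_num) (f ∘ γ),
    ((hc.comp hγ).Icc_extend' (h := by norm_num)).continuousOn, fun x => ?_⟩
  rw [Set.IccExtend_of_mem _ _ (inner_mem_Icc k x), Function.comp_apply]
  apply hf
  simp only [γ, inner_add_right, inner_smul_right, hω, mul_zero, add_zero]
  simp

/-! ### The Legendre polynomials -/

lemma legendre_eval_one (hd : 2 ≤ d) (n : ℕ) : (legendre d n).eval 1 = 1 := by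
  have hd' : (2 : ℝ) ≤ d := by exact_mod_cast hd
  induction n using Nat.twoStepInduction with
  | zero => simp [legendre]
  | one => simp [legendre]
  | more n h0 h1 =>
    have hn := Nat.cast_nonneg (α := ℝ) n
    have hne : ((n : ℝ) + 1 + (d : ℝ) - 2) ≠ 0 := by linarith
    simp only [legendre, Polynomial.eval_mul, Polynomial.eval_sub, Polynomial.eval_C,
      Polynomial.eval_X, h0, h1]
    rw [inv_mul_eq_iff_eq_mul₀ hne]
    ring

/-- The three-term recursion, solved for the middle term. -/
lemma X_mul_legendre_mem (hd : 2 ≤ d) (n : ℕ) :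
    Polynomial.X * legendre d n ∈ Submodule.span ℝ (Set.range (legendre d)) := by
  have hd' : (2 : ℝ) ≤ d := by exact_mod_cast hd
  cases n with
  | zero => exact Submodule.subset_span ⟨1, by simp [legendre]⟩
  | succ n =>
    have hn := Nat.cast_nonneg (α := ℝ) n
    have hne : ((n : ℝ) + 1 + (d : ℝ) - 2) ≠ 0 := by linarith
    have hne' : (2 * ((n : ℝ) + 1) + (d : ℝ) - 2) ≠ 0 := by linarith
    set a := ((n : ℝ) + 1 + (d : ℝ) - 2) with ha
    set b := (2 * ((n : ℝ) + 1) + (d : ℝ) - 2) with hb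
    have h : Polynomial.X * legendre d (n + 1)
        = (b⁻¹ * a) • legendre d (n + 2) + (b⁻¹ * ((n : ℝ) + 1)) • legendre d n := by
      have e1 : Polynomial.C a * Polynomial.C a⁻¹ = (1 : Polynomial ℝ) := by
        rw [← map_mul, mul_inv_cancel₀ hne, map_one]
      have e2 : Polynomial.C b * Polynomial.C b⁻¹ = (1 : Polynomial ℝ) := by
        rw [← map_mul, mul_inv_cancel₀ hne', map_one]
      rw [legendre, Polynomial.smul_eq_C_mul, Polynomial.smul_eq_C_mul, ← ha, ← hb, map_mul,
        map_mul]
      linear_combination (-Polynomial.X * legendre d (n + 1)) * e2 - Polynomial.C b⁻¹ *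
        (Polynomial.C b * Polynomial.X * legendre d (n + 1)
          - Polynomial.C ((n : ℝ) + 1) * legendre d n) * e1
    rw [h]
    exact Submodule.add_mem _ (Submodule.smul_mem _ _ (Submodule.subset_span ⟨_, rfl⟩))
      (Submodule.smul_mem _ _ (Submodule.subset_span ⟨_, rfl⟩))

lemma mem_span_legendre (hd : 2 ≤ d) (q : Polynomial ℝ) :
    q ∈ Submodule.span ℝ (Set.range (legendre d)) := by
  have hX : ∀ p ∈ Submodule.span ℝ (Set.range (legendre d)),
      Polynomial.X * p ∈ Submodule.span ℝ (Set.range (legendre d)) := by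
    intro p hp
    induction hp using Submodule.span_induction with
    | mem x hx => obtain ⟨n, rfl⟩ := hx; exact X_mul_legendre_mem hd n
    | zero => simp
    | add x y _ _ hx hy => rw [mul_add]; exact Submodule.add_mem _ hx hy
    | smul a x _ hx => rw [mul_smul_comm]; exact Submodule.smul_mem _ _ hx
  induction q using Polynomial.induction_on with
  | C a =>
    have : Polynomial.C a = a • legendre d 0 := by simp [legendre, Polynomial.smul_eq_C_mul]
    rw [this]
    exact Submodule.smul_mem _ _ (Submodule.subset_span ⟨0, rfl⟩)
  | add p q hp hq => exact Submodule.add_mem _ hp hq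
  | monomial n a h =>
    have : Polynomial.C a * Polynomial.X ^ (n + 1)
        = Polynomial.X * (Polynomial.C a * Polynomial.X ^ n) := by ring
    rw [this]
    exact hX _ h

/-- The zonal spherical harmonic `σ ↦ P_ℓ(k · σ)`. -/
def zonal (k : S d) (ℓ : ℕ) (x : S d) : ℝ := (legendre d ℓ).eval ⟪(k : E d), (x : E d)⟫

lemma zonal_mem (hd : 2 ≤ d) (k : S d) (ℓ : ℕ) : zonal k ℓ ∈ sphericalHarmonics d ℓ := by
  have : zonal k ℓ = polyRestrict (zonalPoly (k : E d) ℓ) :=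
    funext fun x => (polyRestrict_zonalPoly _ _ _).symm
  rw [this]
  exact polyRestrict_mem (zonalPoly_mem_harmonicPoly hd k ℓ)

lemma zonal_self (hd : 2 ≤ d) (k : S d) (ℓ : ℕ) : zonal k ℓ k = 1 := by
  rw [zonal, real_inner_self_eq_norm_sq]
  simp [legendre_eval_one hd]

lemma isZonal_zonal (k : S d) (ℓ : ℕ) : IsZonal k (zonal k ℓ) := by
  intro x y h
  rw [zonal, zonal, h]

/-- A continuous zonal function orthogonal to all Legendre polynomials vanishes. -/
lemma IsZonal.eq_zero (hd : 2 ≤ d) {k : S d} {f : S d → ℝ} (hf : IsZonal k f)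
    (hc : Continuous f) (h : ∀ m, ∫ x, f x * zonal k m x ∂surf d = 0) : f = 0 := by
  obtain ⟨z, hz, hfz⟩ := hf.exists_profile hd hc
  have hcont : ∀ q : Polynomial ℝ, Continuous fun x : S d => q.eval ⟪(k : E d), (x : E d)⟫ :=
    fun q => q.continuous.comp (by fun_prop)
  have hq : ∀ q : Polynomial ℝ, ∫ x, f x * q.eval ⟪(k : E d), (x : E d)⟫ ∂surf d = 0 := by
    intro q
    have := mem_span_legendre hd q
    induction this using Submodule.span_induction with
    | mem x hx => obtain ⟨n, rfl⟩ := hx; exact h n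
    | zero => simp
    | add p q _ _ hp hq =>
      simp_rw [Polynomial.eval_add, mul_add]
      rw [integral_add (integrable_mul_of_continuous hc (hcont p))
        (integrable_mul_of_continuous hc (hcont q)), hp, hq, add_zero]
    | smul a p _ hp =>
      simp_rw [Polynomial.eval_smul, smul_eq_mul, mul_left_comm _ a]
      rw [integral_const_mul, hp, mul_zero]
  apply eq_zero_of_integral_mul_self hc
  have hI : 0 ≤ ∫ x, |f x| ∂surf d := integral_nonneg fun x => abs_nonneg _
  have hle : ∀ ε > 0, ∫ x, f x * f x ∂surf d ≤ ε * ∫ x, |f x| ∂surf d := by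
    intro ε hε
    -- Since `f` is orthogonal to every polynomial in `k · σ`, one factor of `f²` may be replaced by
    -- `f - q`, where `q` approximates the profile within `ε`.
    obtain ⟨q, hqz⟩ := exists_polynomial_near_of_continuousOn (-1) 1 z hz ε hε
    have e : ∫ x, f x * f x ∂surf d
        = ∫ x, f x * (f x - q.eval ⟪(k : E d), (x : E d)⟫) ∂surf d := by
      simp_rw [mul_sub]
      rw [integral_sub (integrable_mul_of_continuous hc hc)
        (integrable_mul_of_continuous hc (hcont q)), hq, sub_zero]
    rw [e, ← integral_const_mul]
    refine integral_mono (integrable_of_continuous (hc.mul (hc.sub (hcont q))))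
      ((integrable_of_continuous hc.abs).const_mul ε) fun x => ?_
    have h1 := hqz _ (inner_mem_Icc k x)
    rw [← hfz, abs_sub_comm] at h1
    calc f x * (f x - q.eval ⟪(k : E d), (x : E d)⟫)
        ≤ |f x * (f x - q.eval ⟪(k : E d), (x : E d)⟫)| := le_abs_self _
      _ = |f x - q.eval ⟪(k : E d), (x : E d)⟫| * |f x| := by rw [abs_mul, mul_comm]
      _ ≤ ε * |f x| := by gcongr
  refine le_antisymm ?_ (integral_nonneg fun x => mul_self_nonneg _)
  refine le_of_forall_pos_le_add fun δ hδ => ?_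
  have := hle (δ / (1 + ∫ x, |f x| ∂surf d)) (by positivity)
  refine this.trans ?_
  rw [zero_add, div_mul_eq_mul_div, div_le_iff₀ (by positivity)]
  nlinarith

lemma integral_zonal_sq_ne_zero (hd : 2 ≤ d) (k : S d) (ℓ : ℕ) :
    ∫ x, zonal k ℓ x * zonal k ℓ x ∂surf d ≠ 0 := by
  intro h
  have h1 := eq_zero_of_integral_mul_self (zonal_mem hd k ℓ).1.continuous h
  have h2 := zonal_self hd k ℓ
  rw [h1] at h2
  simp at h2

/-- Zonal spherical harmonics are multiples of the Legendre polynomial. -/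
lemma IsZonal.eq_smul_zonal (hd : 2 ≤ d) {k : S d} {ℓ : ℕ} {Z : S d → ℝ}
    (hZ : Z ∈ sphericalHarmonics d ℓ) (hz : IsZonal k Z) :
    ∃ c : ℝ, Z = c • zonal k ℓ := by
  have hP := zonal_mem hd k ℓ
  set I := ∫ x, zonal k ℓ x * zonal k ℓ x ∂surf d with hI
  have hI0 : I ≠ 0 := integral_zonal_sq_ne_zero hd k ℓ
  set c := (∫ x, Z x * zonal k ℓ x ∂surf d) / I with hc
  refine ⟨c, ?_⟩
  have hG : Z - c • zonal k ℓ ∈ sphericalHarmonics d ℓ :=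
    Submodule.sub_mem _ hZ (Submodule.smul_mem _ c hP)
  -- The difference is again zonal. It is orthogonal to `P_ℓ` by the choice of `c` and to the other
  -- `P_m` because the degrees differ.
  have : Z - c • zonal k ℓ = 0 := by
    refine IsZonal.eq_zero hd (k := k) ?_ hG.1.continuous fun m => ?_
    · intro x y hxy
      simp [hz x y hxy, isZonal_zonal k ℓ x y hxy]
    · by_cases hm : ℓ = m
      · subst hm
        simp only [Pi.sub_apply, Pi.smul_apply, smul_eq_mul, sub_mul, mul_assoc]
        rw [integral_sub (integrable_mul_of_mem hZ hP) ((integrable_mul_of_mem hP hP).const_mul c),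
          integral_const_mul, ← hI, hc, div_mul_cancel₀ _ hI0, sub_self]
      · exact integral_mul_eq_zero hd hm hG (zonal_mem hd k m)
  exact sub_eq_zero.mp this

/-- **Funk-Hecke**: a linear functional on spherical harmonics which is invariant under the
isometries fixing `k` is a multiple of the evaluation at `k`. -/
theorem funkHecke (hd : 2 ≤ d) (k : S d) {ℓ : ℕ} (Λ : sphericalHarmonics d ℓ →ₗ[ℝ] ℝ)
    (hΛ : ∀ R : E d ≃ₗᵢ[ℝ] E d, R k = k → ∀ Y : sphericalHarmonics d ℓ,
      Λ ⟨Y.1 ∘ sphereMap R, sphericalHarmonics_comp R Y.2⟩ = Λ Y)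
    (Y : sphericalHarmonics d ℓ) : Λ Y = Y.1 k * Λ ⟨zonal k ℓ, zonal_mem hd k ℓ⟩ := by
  have key : ∀ Λ : sphericalHarmonics d ℓ →ₗ[ℝ] ℝ,
      (∀ R : E d ≃ₗᵢ[ℝ] E d, R k = k → ∀ Y : sphericalHarmonics d ℓ,
        Λ ⟨Y.1 ∘ sphereMap R, sphericalHarmonics_comp R Y.2⟩ = Λ Y) →
      ∃ c : ℝ, ∀ Y, Λ Y = c * ∫ x, zonal k ℓ x * Y.1 x ∂surf d := by
    intro Λ hΛ
    obtain ⟨Z, hZ⟩ := exists_riesz hd Λ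
    have hinv : ∀ R : E d ≃ₗᵢ[ℝ] E d, R k = k → Z.1 ∘ sphereMap R = Z.1 := by
      intro R hR
      set Z' : sphericalHarmonics d ℓ := ⟨Z.1 ∘ sphereMap R, sphericalHarmonics_comp R Z.2⟩
      have h1 : ∀ Y : sphericalHarmonics d ℓ,
          ∫ x, Z'.1 x * Y.1 x ∂surf d = ∫ x, Z.1 x * Y.1 x ∂surf d := by
        intro Y
        have hRs : R.symm k = k := by
          conv_lhs => rw [← hR]
          simp
        -- Invariance under the inverse isometry, followed by a change of variables, moves `R` onto
        -- the representing harmonic.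
        have h2 := hΛ R.symm hRs Y
        rw [hZ, hZ] at h2
        rw [← h2, ← integral_comp_sphereMap R (fun x => Z.1 x * (Y.1 ∘ sphereMap R.symm) x)]
        refine integral_congr_ae (Filter.Eventually.of_forall fun x => ?_)
        have h3 : sphereMap R.symm (sphereMap R x) = x := by ext1; simp
        simp only [Z', Function.comp_apply, h3]
      have hD := h1 (Z' - Z)
      have hD' : ∫ x, (Z' - Z).1 x * (Z' - Z).1 x ∂surf d = 0 := by
        rw [← sub_eq_zero, ← integral_sub (integrable_mul_of_mem Z'.2 (Z' - Z).2)
          (integrable_mul_of_mem Z.2 (Z' - Z).2)] at hD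
        rw [← hD]
        exact integral_congr_ae (Filter.Eventually.of_forall fun x => sub_mul _ _ _)
      exact sub_eq_zero.mp (eq_zero_of_integral_mul_self (Z' - Z).2.1.continuous hD')
    obtain ⟨c, hc⟩ := (isZonal_of_invariant hinv).eq_smul_zonal hd Z.2
    refine ⟨c, fun Y => ?_⟩
    rw [hZ, hc, ← integral_const_mul]
    exact integral_congr_ae (Filter.Eventually.of_forall fun x => mul_assoc _ _ _)
  let ev : sphericalHarmonics d ℓ →ₗ[ℝ] ℝ :=
    { toFun := fun Y => Y.1 k, map_add' := fun _ _ => rfl, map_smul' := fun _ _ => rfl }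
  obtain ⟨a, ha⟩ := key Λ hΛ
  -- Evaluation at `k` is also invariant, so it is `b` times the same pairing as for `Λ`. Its value
  -- `1` on the zonal harmonic normalises the constant.
  obtain ⟨b, hb⟩ := key ev (by
    intro R hR Y
    have hk : sphereMap R k = k := Subtype.ext hR
    change Y.1 (sphereMap R k) = Y.1 k
    rw [hk])
  have hP := hb ⟨zonal k ℓ, zonal_mem hd k ℓ⟩
  have hev : ev ⟨zonal k ℓ, zonal_mem hd k ℓ⟩ = 1 := zonal_self hd k ℓ
  have hY : Y.1 k = b * ∫ x, zonal k ℓ x * Y.1 x ∂surf d := hb Y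
  rw [hev] at hP
  rw [ha, ha, hY]
  linear_combination (a * ∫ x, zonal k ℓ x * Y.1 x ∂surf d) * hP

/-! ### Invariance of zonal integrals -/

lemma exists_isometry_map (k k' : S d) : ∃ R : E d ≃ₗᵢ[ℝ] E d, R (k : E d) = k' := by
  have hn : ‖(k : E d)‖ = ‖(k' : E d)‖ := by simp
  exact ⟨_, Submodule.reflection_sub (F := E d) hn⟩

lemma inner_isometry {R : E d ≃ₗᵢ[ℝ] E d} {k k' : S d} (hR : R (k : E d) = k') (x : S d) :
    ⟪(k' : E d), (sphereMap R x : E d)⟫ = ⟪(k : E d), (x : E d)⟫ := by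
  rw [← hR, coe_sphereMap, LinearIsometryEquiv.inner_map_map]

lemma integral_inner_eq (F : ℝ → ℝ) (k k' : S d) :
    ∫ x, F ⟪(k : E d), (x : E d)⟫ ∂surf d = ∫ x, F ⟪(k' : E d), (x : E d)⟫ ∂surf d := by
  obtain ⟨R, hR⟩ := exists_isometry_map k k'
  rw [← integral_comp_sphereMap R fun x => F ⟪(k' : E d), (x : E d)⟫]
  simp_rw [inner_isometry hR]

/-! ### The second difference of a smooth function -/

/-- The reflection of the sphere in the axis through `k`. -/
def axisRefl (k : S d) : E d ≃ₗᵢ[ℝ] E d := (ℝ ∙ (k : E d)).reflection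

lemma axisRefl_self (k : S d) : axisRefl k (k : E d) = k :=
  Submodule.reflection_mem_subspace_eq_self (Submodule.mem_span_singleton_self _)

lemma axisRefl_apply (k : S d) (x : E d) :
    axisRefl k x = (2 * ⟪(k : E d), x⟫) • (k : E d) - x := by
  rw [axisRefl, Submodule.reflection_apply, Submodule.starProjection_singleton]
  simp [two_mul, add_smul, two_smul]

/-- `f(σ) + f(σ') - 2 f(k)`, where `σ'` is the mirror image of `σ` in the axis through `k`. -/
def secondDiff (f : S d → ℝ) (k σ : S d) : ℝ := f σ + f (sphereMap (axisRefl k) σ) - 2 * f k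

lemma exists_bound_of_continuous {f : S d → ℝ} (hf : Continuous f) :
    ∃ B, 0 ≤ B ∧ ∀ x, |f x| ≤ B := by
  obtain ⟨B, hB⟩ := isCompact_univ.exists_bound_of_continuousOn hf.continuousOn
  exact ⟨max B 0, le_max_right _ _, fun x => (hB x trivial).trans (le_max_left _ _)⟩

lemma exists_secondFDeriv_bound_of_isCompact {V : Type*} [NormedAddCommGroup V]
    [NormedSpace ℝ V] {F : V → ℝ} {K : Set V} (hK : IsCompact K)
    (hF : ∀ x ∈ K, ContDiffAt ℝ 2 F x) : ∃ M, ∀ x ∈ K, ‖fderiv ℝ (fderiv ℝ F) x‖ ≤ M := by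
  refine hK.exists_bound_of_continuousOn (f := fderiv ℝ (fderiv ℝ F)) fun x hx => ?_
  have h1 := (hF x hx).fderiv_right (m := 1) (by norm_num)
  exact (h1.fderiv_right (m := 0) (by norm_num)).continuousAt.continuousWithinAt

/-- The radial extension is singular at the origin, so compactness is used on an annulus. -/
lemma exists_secondFDeriv_bound {f : S d → ℝ} (hf : IsSmooth f) :
    ∃ M, 0 ≤ M ∧ ∀ x : E d, 1 / 2 ≤ ‖x‖ → ‖x‖ ≤ 1 →
      ‖fderiv ℝ (fderiv ℝ (radialExt f)) x‖ ≤ M := by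
  have hK : IsCompact (Metric.closedBall (0 : E d) 1 ∩ {x | 1 / 2 ≤ ‖x‖}) :=
    (isCompact_closedBall _ _).inter_right (isClosed_le continuous_const continuous_norm)
  obtain ⟨M, hM⟩ := exists_secondFDeriv_bound_of_isCompact (F := radialExt f) hK fun x hx => by
    refine hf.contDiffAt_of_ne (n := 2) ?_
    rintro rfl
    have := hx.2
    simp at this
    linarith
  exact ⟨max M 0, le_max_right _ _, fun x h1 h2 =>
    (hM x ⟨by simpa using h2, h1⟩).trans (le_max_left _ _)⟩

/-- A second difference is controlled by the second derivative. -/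
lemma abs_secondDiff_le_of_convex {F : E d → ℝ} {C : Set (E d)} (hC : Convex ℝ C) {M : ℝ}
    (hM : 0 ≤ M)
    (hF : ∀ x ∈ C, ContDiffAt ℝ 2 F x) (hb : ∀ x ∈ C, ‖fderiv ℝ (fderiv ℝ F) x‖ ≤ M) {a v : E d}
    (h1 : a + v ∈ C) (h2 : a - v ∈ C) : |F (a + v) + F (a - v) - 2 * F a| ≤ 2 * M * ‖v‖ ^ 2 := by
  have hseg : ∀ s ∈ Set.Icc (-1 : ℝ) 1, a + s • v ∈ C := by
    intro s hs
    have := hC h1 h2 (a := (1 + s) / 2) (b := (1 - s) / 2) (by linarith [hs.1]) (by linarith [hs.2])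
      (by ring)
    convert this using 1
    module
  have hlip : ∀ x ∈ C, ∀ y ∈ C, ‖fderiv ℝ F y - fderiv ℝ F x‖ ≤ M * ‖y - x‖ := fun x hx y hy =>
    hC.norm_image_sub_le_of_norm_fderiv_le
      (fun z hz => ((hF z hz).fderiv_right (m := 1) (by norm_num)).differentiableAt (by norm_num))
      hb hx hy
  -- The first-order parts of `G'` cancel: `G'(s)` is a difference of derivatives at points `2s‖v‖`
  -- apart, hence at most `2M‖v‖²`. The mean value inequality on `[0,1]` concludes.
  let G : ℝ → ℝ := fun s => F (a + s • v) + F (a + (-s) • v)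
  have hd : ∀ s ∈ Set.Icc (-1 : ℝ) 1, HasDerivAt (fun s => F (a + s • v))
      (fderiv ℝ F (a + s • v) v) s := by
    intro s hs
    have h := ((hF _ (hseg s hs)).differentiableAt (by norm_num)).hasFDerivAt
    have hl : HasDerivAt (fun s : ℝ => a + s • v) v s := by
      simpa using ((hasDerivAt_id s).smul_const v).const_add a
    exact h.comp_hasDerivAt s hl
  have hG : ∀ s ∈ Set.Icc (0 : ℝ) 1, HasDerivAt G
      ((fderiv ℝ F (a + s • v) - fderiv ℝ F (a + (-s) • v)) v) s := by
    intro s hs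
    have e1 := hd s ⟨by linarith [hs.1], hs.2⟩
    have e2 := (hd (-s) ⟨by linarith [hs.2], by linarith [hs.1]⟩).scomp s (hasDerivAt_neg s)
    refine (e1.add e2).congr_deriv ?_
    rw [sub_apply, neg_one_smul]
    ring
  have hbound : ∀ s ∈ Set.Icc (0 : ℝ) 1,
      ‖(fderiv ℝ F (a + s • v) - fderiv ℝ F (a + (-s) • v)) v‖ ≤ 2 * M * ‖v‖ ^ 2 := by
    intro s hs
    refine (ContinuousLinearMap.le_opNorm _ _).trans ?_
    have h := hlip _ (hseg (-s) ⟨by linarith [hs.2], by linarith [hs.1]⟩) _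
      (hseg s ⟨by linarith [hs.1], hs.2⟩)
    have e : a + s • v - (a + (-s) • v) = (2 * s) • v := by module
    rw [e, norm_smul, Real.norm_eq_abs, abs_of_nonneg (by linarith [hs.1])] at h
    calc _ ≤ (M * (2 * s * ‖v‖)) * ‖v‖ := by gcongr
      _ ≤ (M * (2 * 1 * ‖v‖)) * ‖v‖ := by gcongr; exact hs.2
      _ = 2 * M * ‖v‖ ^ 2 := by ring
  have h := norm_image_sub_le_of_norm_deriv_le_segment_01' (f := G)
    (fun s hs => (hG s hs).hasDerivWithinAt) (fun s hs => hbound s ⟨hs.1, hs.2.le⟩)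
  have e : G 1 - G 0 = F (a + v) + F (a - v) - 2 * F a := by
    simp [G, sub_eq_add_neg]
    ring
  rwa [e] at h

/-- With `t = k · σ`, the point `σ` and its mirror image are `t k ± v`, where `v ⊥ k` and `|v|² = 1
- t²`. For `t > 0` the radial extension takes the value `f(k)` at `t k`, so the second difference is
one of the extension centred at `t k`, of size `O(1 - t²)`. When `t < 1/2` the sup bound suffices.
-/
lemma IsSmooth.exists_secondDiff_bound {f : S d → ℝ} (hf : IsSmooth f) :
    ∃ C, 0 ≤ C ∧ ∀ k σ : S d, |secondDiff f k σ| ≤ C * (1 - ⟪(k : E d), (σ : E d)⟫) := by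
  obtain ⟨B, hB0, hB⟩ := exists_bound_of_continuous hf.continuous
  obtain ⟨M, hM0, hM⟩ := exists_secondFDeriv_bound hf
  refine ⟨8 * B + 4 * M, by positivity, fun k σ => ?_⟩
  set t := ⟪(k : E d), (σ : E d)⟫ with ht
  have ht1 : t ≤ 1 := (inner_mem_Icc k σ).2
  by_cases h : t < 1 / 2
  · have h1 : |secondDiff f k σ| ≤ 4 * B := by
      unfold secondDiff
      have a1 := abs_le.mp (hB σ)
      have a2 := abs_le.mp (hB (sphereMap (axisRefl k) σ))
      have a3 := abs_le.mp (hB k)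
      rw [abs_le]
      constructor <;> linarith [a1.1, a1.2, a2.1, a2.2, a3.1, a3.2]
    nlinarith
  · have h : 1 / 2 ≤ t := not_lt.mp h
    -- A spherical cap of the ball: convex, away from the origin, and containing both `t k ± v`.
    let C : Set (E d) := {x | ‖x‖ ≤ 1 ∧ 1 / 2 ≤ ⟪(k : E d), x⟫}
    have hCc : Convex ℝ C := by
      have h1 : Convex ℝ {x : E d | ‖x‖ ≤ 1} := by
        have : {x : E d | ‖x‖ ≤ 1} = Metric.closedBall 0 1 := by ext; simp
        rw [this]; exact convex_closedBall _ _
      have h2 : Convex ℝ {x : E d | 1 / 2 ≤ ⟪(k : E d), x⟫} :=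
        convex_halfSpace_ge (innerSL ℝ (k : E d)).isLinear _
      exact h1.inter h2
    have hC : ∀ x ∈ C, 1 / 2 ≤ ‖x‖ := by
      rintro x ⟨-, hx⟩
      have := real_inner_le_norm (k : E d) x
      rw [norm_sphere, one_mul] at this
      linarith
    have hC0 : ∀ x ∈ C, x ≠ 0 := by
      intro x hx h0
      have := hC x hx
      rw [h0, norm_zero] at this
      linarith
    set v : E d := (σ : E d) - t • (k : E d) with hv
    have e1 : t • (k : E d) + v = σ := by rw [hv]; module
    have e2 : t • (k : E d) - v = (sphereMap (axisRefl k) σ : E d) := by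
      rw [coe_sphereMap, axisRefl_apply, hv, ← ht]; module
    have hm1 : t • (k : E d) + v ∈ C := by
      rw [e1]; exact ⟨(norm_sphere σ).le, h⟩
    have hm2 : t • (k : E d) - v ∈ C := by
      rw [e2]
      refine ⟨(norm_sphere _).le, ?_⟩
      rw [inner_isometry (axisRefl_self k)]; exact h
    have key := abs_secondDiff_le_of_convex hCc hM0 (F := radialExt f)
      (fun x hx => hf.contDiffAt_of_ne (hC0 x hx)) (fun x hx => hM x (hC x hx) hx.1) hm1 hm2
    rw [e1, e2, radialExt_coe, radialExt_coe, radialExt_smul_coe f k (by linarith)] at key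
    have hvn : ‖v‖ ^ 2 = 1 - t ^ 2 := by
      rw [hv, norm_sub_sq_real, inner_smul_right, real_inner_comm, ← ht, norm_smul]
      simp
      ring
    rw [hvn] at key
    unfold secondDiff
    have p1 : 0 ≤ M * ((1 - t) * (1 - t)) := mul_nonneg hM0 (mul_self_nonneg _)
    have p2 : 0 ≤ B * (1 - t) := mul_nonneg hB0 (by linarith)
    nlinarith

/-! ### The truncated Boltzmann operator -/

variable {β : ℝ → ℝ}

/-- The set of collisions `σ` with `k · σ ≤ 1 - ε`. -/
def truncSet (k : S d) (ε : ℝ) : Set (S d) := {σ : S d | ⟪(k : E d), (σ : E d)⟫ ≤ 1 - ε}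

lemma measurableSet_truncSet (k : S d) (ε : ℝ) : MeasurableSet (truncSet k ε) :=
  (isClosed_le (by fun_prop) continuous_const).measurableSet

lemma measurable_kernel (hβ : IsAngularKernel d β) (k : S d) :
    Measurable fun σ : S d => β ⟪(k : E d), (σ : E d)⟫ :=
  hβ.measurable.comp (by fun_prop : Continuous fun σ : S d => ⟪(k : E d), (σ : E d)⟫).measurable

lemma kernel_nonneg (hβ : IsAngularKernel d β) (k σ : S d) :
    0 ≤ β ⟪(k : E d), (σ : E d)⟫ := hβ.nonneg _ (inner_mem_Icc k σ)

/-- Away from grazing collisions `1 - k · σ ≥ ε`, so `β ≤ ε⁻¹ (1 - k · σ) β`. -/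
lemma integrableOn_kernel (hβ : IsAngularKernel d β) (k : S d) {ε : ℝ} (hε : 0 < ε) :
    IntegrableOn (fun σ : S d => β ⟪(k : E d), (σ : E d)⟫) (truncSet k ε) (surf d) := by
  refine Integrable.mono' ((hβ.momentum k).const_mul ε⁻¹).integrableOn
    (measurable_kernel hβ k).aestronglyMeasurable ?_
  filter_upwards [ae_restrict_mem (measurableSet_truncSet k ε)] with σ hσ
  have h1 : ε ≤ 1 - ⟪(k : E d), (σ : E d)⟫ := by
    have : ⟪(k : E d), (σ : E d)⟫ ≤ 1 - ε := hσ
    linarith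
  have h0 := kernel_nonneg hβ k σ
  rw [Real.norm_eq_abs, abs_of_nonneg h0, ← mul_assoc]
  exact le_mul_of_one_le_left h0 (by rwa [inv_mul_eq_div, one_le_div hε])

lemma integrableOn_mul_kernel (hβ : IsAngularKernel d β) (k : S d) {ε : ℝ} (hε : 0 < ε)
    {g : S d → ℝ} (hg : Continuous g) :
    IntegrableOn (fun σ : S d => g σ * β ⟪(k : E d), (σ : E d)⟫) (truncSet k ε) (surf d) := by
  obtain ⟨B, hB0, hB⟩ := exists_bound_of_continuous hg
  exact (integrableOn_kernel hβ k hε).bdd_mul hg.aestronglyMeasurable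
    (Filter.Eventually.of_forall fun x => hB x)

lemma integral_truncSet_comp (k : S d) (ε : ℝ) (R : E d ≃ₗᵢ[ℝ] E d) (hR : R (k : E d) = k)
    (g : S d → ℝ) :
    ∫ σ in truncSet k ε, g (sphereMap R σ) ∂surf d = ∫ σ in truncSet k ε, g σ ∂surf d := by
  rw [← integral_indicator (measurableSet_truncSet k ε),
    ← integral_indicator (measurableSet_truncSet k ε),
    ← integral_comp_sphereMap R ((truncSet k ε).indicator g)]
  refine integral_congr_ae (Filter.Eventually.of_forall fun σ => ?_)
  have : sphereMap R σ ∈ truncSet k ε ↔ σ ∈ truncSet k ε := by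
    simp only [truncSet, Set.mem_ofPred_eq, inner_isometry hR]
  by_cases h : σ ∈ truncSet k ε
  · simp [h, this.mpr h]
  · simp [h, mt this.mp h]

lemma truncBoltzmann_eq (f : S d → ℝ) (k : S d) (ε : ℝ) : truncBoltzmann β f k ε
    = ∫ σ in truncSet k ε, (f σ - f k) * β ⟪(k : E d), (σ : E d)⟫ ∂surf d := rfl

/-- The linear Boltzmann integral of a function with integrable integrand. -/
lemma tendsto_setIntegral_truncSet {g : S d → ℝ} {k : S d} (hg : Integrable g (surf d))
    (h1 : ∀ σ : S d, ⟪(k : E d), (σ : E d)⟫ = 1 → g σ = 0) :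
    Tendsto (fun ε => ∫ σ in truncSet k ε, g σ ∂surf d) (𝓝[>] 0) (𝓝 (∫ σ, g σ ∂surf d)) := by
  simp_rw [← integral_indicator (measurableSet_truncSet k _)]
  refine tendsto_integral_filter_of_dominated_convergence (fun σ => ‖g σ‖)
    (Filter.Eventually.of_forall fun ε =>
      hg.aestronglyMeasurable.indicator (measurableSet_truncSet k ε))
    (Filter.Eventually.of_forall fun ε => Filter.Eventually.of_forall fun σ =>
      norm_indicator_le_norm_self _ _) hg.norm (Filter.Eventually.of_forall fun σ => ?_)
  rcases (inner_mem_Icc k σ).2.lt_or_eq with h | h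
  · refine tendsto_const_nhds.congr' ?_
    have h' : (0 : ℝ) < 1 - ⟪(k : E d), (σ : E d)⟫ := by linarith
    filter_upwards [mem_nhdsWithin_of_mem_nhds (gt_mem_nhds h')] with ε hε
    have : σ ∈ truncSet k ε := by
      change ⟪(k : E d), (σ : E d)⟫ ≤ 1 - ε
      linarith
    simp [this]
  -- At the pole the indicator is `0` for every `ε > 0`, so convergence there uses that `g`
  -- vanishes; no null-set argument is needed.
  · have : ∀ ε, (truncSet k ε).indicator g σ = 0 := fun ε => by
      by_cases hs : σ ∈ truncSet k ε <;> simp [hs, h1 σ h]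
    simp [this, h1 σ h]

lemma eq_of_inner_eq_one {k σ : S d} (h : ⟪(k : E d), (σ : E d)⟫ = 1) : σ = k := by
  have := (inner_eq_one_iff_of_norm_eq_one (𝕜 := ℝ) (norm_sphere k) (norm_sphere σ)).mp h
  exact Subtype.ext this.symm

lemma hasBoltzmannValue_of_integrable {f : S d → ℝ} {k : S d}
    (hf : Integrable (fun σ : S d => (f σ - f k) * β ⟪(k : E d), (σ : E d)⟫) (surf d)) :
    HasBoltzmannValue β f k (∫ σ, (f σ - f k) * β ⟪(k : E d), (σ : E d)⟫ ∂surf d) :=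
  tendsto_setIntegral_truncSet hf fun σ h => by simp [eq_of_inner_eq_one h]

/-! ### The principal value for smooth functions -/

/-- The kernel and the truncated region are invariant under the axis reflection, so the integrand
may be averaged with its mirror image. -/
lemma truncBoltzmann_eq_secondDiff (hβ : IsAngularKernel d β) {f : S d → ℝ} (hf : Continuous f)
    (k : S d) {ε : ℝ} (hε : 0 < ε) : truncBoltzmann β f k ε
      = ∫ σ in truncSet k ε, 2⁻¹ * (secondDiff f k σ * β ⟪(k : E d), (σ : E d)⟫) ∂surf d := by
  have h1 := integral_truncSet_comp k ε (axisRefl k) (axisRefl_self k)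
    fun σ => (f σ - f k) * β ⟪(k : E d), (σ : E d)⟫
  have hR : Continuous (sphereMap (axisRefl k)) := (sphereHomeo (axisRefl k)).continuous
  rw [integral_const_mul]
  have e : ∀ σ : S d, secondDiff f k σ * β ⟪(k : E d), (σ : E d)⟫
      = (f σ - f k) * β ⟪(k : E d), (σ : E d)⟫ + (f (sphereMap (axisRefl k) σ) - f k)
        * β ⟪(k : E d), (sphereMap (axisRefl k) σ : E d)⟫ := by
    intro σ
    rw [inner_isometry (axisRefl_self k), secondDiff]
    ring
  simp_rw [e]
  rw [integral_add, h1, ← truncBoltzmann_eq]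
  · ring
  · exact integrableOn_mul_kernel hβ k hε (hf.sub continuous_const)
  · have := integrableOn_mul_kernel hβ k hε ((hf.comp hR).sub (continuous_const (y := f k)))
    refine this.congr (Filter.Eventually.of_forall fun σ => ?_)
    simp only [inner_isometry (axisRefl_self k), Pi.sub_apply, Function.comp_apply]

/-- The total momentum `∫ (1 - k · σ) β (k · σ) dσ`. -/
def momentum (β : ℝ → ℝ) (k : S d) : ℝ :=
  ∫ σ : S d, (1 - ⟪(k : E d), (σ : E d)⟫) * β ⟪(k : E d), (σ : E d)⟫ ∂surf d

lemma momentum_eq (β : ℝ → ℝ) (k k' : S d) : momentum β k = momentum β k' :=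
  integral_inner_eq (fun t => (1 - t) * β t) k k'

lemma abs_secondDiff_mul_le (hβ : IsAngularKernel d β) {f : S d → ℝ} {C : ℝ}
    (hC : ∀ k σ : S d, |secondDiff f k σ| ≤ C * (1 - ⟪(k : E d), (σ : E d)⟫)) (k σ : S d) :
    ‖2⁻¹ * (secondDiff f k σ * β ⟪(k : E d), (σ : E d)⟫)‖
      ≤ C * ((1 - ⟪(k : E d), (σ : E d)⟫) * β ⟪(k : E d), (σ : E d)⟫) := by
  have h0 := kernel_nonneg hβ k σ
  have h1 := hC k σ
  have h2 : |secondDiff f k σ| * β ⟪(k : E d), (σ : E d)⟫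
      ≤ C * (1 - ⟪(k : E d), (σ : E d)⟫) * β ⟪(k : E d), (σ : E d)⟫ := by gcongr
  have h3 : 0 ≤ |secondDiff f k σ| * β ⟪(k : E d), (σ : E d)⟫ := by positivity
  rw [Real.norm_eq_abs, abs_mul, abs_mul, abs_of_nonneg h0, abs_of_pos (by norm_num)]
  linarith

lemma continuous_secondDiff {f : S d → ℝ} (hf : Continuous f) (k : S d) :
    Continuous (secondDiff f k) := by
  have hR : Continuous (sphereMap (axisRefl k)) := (sphereHomeo (axisRefl k)).continuous
  exact (hf.add (hf.comp hR)).sub continuous_const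

/-- After symmetrisation the integrand is dominated by a multiple of `(1 - k · σ) β(k · σ)`. As that
integral does not depend on `k`, the bound is uniform in `k` and `ε`; it serves as the dominating
constant in later limits. -/
theorem exists_hasBoltzmannValue (hβ : IsAngularKernel d β) {f : S d → ℝ} (hf : IsSmooth f) :
    (∀ k, ∃ v, HasBoltzmannValue β f k v) ∧
      ∃ B, ∀ k, ∀ ε > 0, |truncBoltzmann β f k ε| ≤ B := by
  obtain ⟨C, hC0, hC⟩ := hf.exists_secondDiff_bound
  have hint : ∀ k : S d, Integrable
      (fun σ => 2⁻¹ * (secondDiff f k σ * β ⟪(k : E d), (σ : E d)⟫)) (surf d) := fun k =>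
    Integrable.mono' ((hβ.momentum k).const_mul C)
      (((continuous_secondDiff hf.continuous k).measurable.mul
        (measurable_kernel hβ k)).const_mul _).aestronglyMeasurable
      (Filter.Eventually.of_forall fun σ => abs_secondDiff_mul_le hβ hC k σ)
  constructor
  · intro k
    refine ⟨_, (tendsto_setIntegral_truncSet (k := k) (hint k) fun σ h => ?_).congr' ?_⟩
    · have := hC k σ
      rw [h, sub_self, mul_zero] at this
      simp [abs_nonpos_iff.mp this]
    · filter_upwards [self_mem_nhdsWithin] with ε hε
      exact (truncBoltzmann_eq_secondDiff hβ hf.continuous k hε).symm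
  · rcases isEmpty_or_nonempty (S d) with h | ⟨⟨k₀⟩⟩
    · exact ⟨0, fun k => h.elim k⟩
    · refine ⟨C * momentum β k₀, fun k ε hε => ?_⟩
      rw [truncBoltzmann_eq_secondDiff hβ hf.continuous k hε, momentum_eq β k₀ k, momentum,
        ← integral_const_mul, ← Real.norm_eq_abs]
      refine (norm_integral_le_integral_norm _).trans ?_
      refine (setIntegral_le_integral (hint k).norm
        (Filter.Eventually.of_forall fun σ => norm_nonneg _)).trans ?_
      exact integral_mono (hint k).norm ((hβ.momentum k).const_mul C)
        fun σ => abs_secondDiff_mul_le hβ hC k σ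

lemma HasBoltzmannValue.linBoltzmann_eq {f : S d → ℝ} {k : S d} {v : ℝ}
    (h : HasBoltzmannValue β f k v) : linBoltzmann β f k = v := Tendsto.limUnder_eq h

lemma hasBoltzmannValue_linBoltzmann (hβ : IsAngularKernel d β) {f : S d → ℝ} (hf : IsSmooth f)
    (k : S d) : HasBoltzmannValue β f k (linBoltzmann β f k) := by
  obtain ⟨v, hv⟩ := (exists_hasBoltzmannValue hβ hf).1 k
  rwa [hv.linBoltzmann_eq]

/-! ### The truncated kernel on the product space, measurability and square integrability. -/

/-- The truncated kernel `1_{k · σ ≤ 1 - ε} β(k · σ)`. -/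
def truncKernel (β : ℝ → ℝ) (ε : ℝ) (k σ : S d) : ℝ :=
  (Set.Iic (1 - ε)).indicator β ⟪(k : E d), (σ : E d)⟫

lemma truncKernel_comm (β : ℝ → ℝ) (ε : ℝ) (k σ : S d) :
    truncKernel β ε k σ = truncKernel β ε σ k := by
  rw [truncKernel, truncKernel, real_inner_comm]

lemma measurable_truncKernel (hβ : IsAngularKernel d β) (ε : ℝ) :
    Measurable fun p : S d × S d => truncKernel β ε p.1 p.2 :=
  (hβ.measurable.indicator measurableSet_Iic).comp
    (by fun_prop : Continuous fun p : S d × S d => ⟪(p.1 : E d), (p.2 : E d)⟫).measurable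

lemma truncBoltzmann_eq_truncKernel (f : S d → ℝ) (k : S d) (ε : ℝ) : truncBoltzmann β f k ε
    = ∫ σ, (f σ - f k) * truncKernel β ε k σ ∂surf d := by
  rw [truncBoltzmann_eq, ← integral_indicator (measurableSet_truncSet k ε)]
  refine integral_congr_ae (Filter.Eventually.of_forall fun σ => ?_)
  by_cases h : σ ∈ truncSet k ε
  · have h' : ⟪(k : E d), (σ : E d)⟫ ∈ Set.Iic (1 - ε) := h
    simp only [h, h', truncKernel, Set.indicator_of_mem]
  · have h' : ⟪(k : E d), (σ : E d)⟫ ∉ Set.Iic (1 - ε) := h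
    simp [h, h', truncKernel]

lemma measurable_truncBoltzmann (hβ : IsAngularKernel d β) {f : S d → ℝ} (hf : Continuous f)
    (ε : ℝ) : Measurable fun k => truncBoltzmann β f k ε := by
  simp_rw [truncBoltzmann_eq_truncKernel]
  have h : Measurable fun p : S d × S d => (f p.2 - f p.1) * truncKernel β ε p.1 p.2 :=
    ((hf.measurable.comp measurable_snd).sub (hf.measurable.comp measurable_fst)).mul
      (measurable_truncKernel hβ ε)
  exact h.stronglyMeasurable.integral_prod_right.measurable

lemma tendsto_inv_nat_nhdsGT : Tendsto (fun n : ℕ => 1 / ((n : ℝ) + 1)) atTop (𝓝[>] 0) :=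
  tendsto_nhdsWithin_iff.mpr ⟨tendsto_one_div_add_atTop_nhds_zero_nat,
    Filter.Eventually.of_forall fun n => by simp only [Set.mem_Ioi]; positivity⟩

lemma measurable_linBoltzmann (hβ : IsAngularKernel d β) {f : S d → ℝ} (hf : IsSmooth f) :
    Measurable (linBoltzmann β f) :=
  measurable_of_tendsto_metrizable
    (f := fun (n : ℕ) k => truncBoltzmann β f k (1 / ((n : ℝ) + 1)))
    (fun _ => measurable_truncBoltzmann hβ hf.continuous _)
    (tendsto_pi_nhds.mpr fun k =>
      (hasBoltzmannValue_linBoltzmann hβ hf k).comp tendsto_inv_nat_nhdsGT)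

theorem memLp_linBoltzmann (hβ : IsAngularKernel d β) {f : S d → ℝ} (hf : IsSmooth f) :
    MemLp (linBoltzmann β f) 2 (surf d) := by
  obtain ⟨B, hB⟩ := (exists_hasBoltzmannValue hβ hf).2
  refine MemLp.of_bound (measurable_linBoltzmann hβ hf).aestronglyMeasurable B
    (Filter.Eventually.of_forall fun k => ?_)
  refine le_of_tendsto (hasBoltzmannValue_linBoltzmann hβ hf k).norm ?_
  filter_upwards [self_mem_nhdsWithin] with ε hε using hB k ε hε

/-! ### Symmetry -/

lemma integrable_truncKernel (hβ : IsAngularKernel d β) {ε : ℝ} (hε : 0 < ε) :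
    Integrable (fun p : S d × S d => truncKernel β ε p.1 p.2) ((surf d).prod (surf d)) := by
  rw [integrable_prod_iff (measurable_truncKernel hβ ε).aestronglyMeasurable]
  constructor
  · refine Filter.Eventually.of_forall fun k => ?_
    have h := (integrableOn_kernel hβ k hε).integrable_indicator (measurableSet_truncSet k ε)
    refine h.congr (Filter.Eventually.of_forall fun σ => ?_)
    by_cases h : σ ∈ truncSet k ε
    · have h' : ⟪(k : E d), (σ : E d)⟫ ∈ Set.Iic (1 - ε) := h
      simp only [h, h', truncKernel, Set.indicator_of_mem]
    · have h' : ⟪(k : E d), (σ : E d)⟫ ∉ Set.Iic (1 - ε) := h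
      simp [h, h', truncKernel]
  · rcases isEmpty_or_nonempty (S d) with h | ⟨⟨k₀⟩⟩
    · exact Integrable.of_isEmpty
    · have : ∀ k : S d, ∫ σ, ‖truncKernel β ε k σ‖ ∂surf d
          = ∫ σ, ‖truncKernel β ε k₀ σ‖ ∂surf d := fun k =>
        integral_inner_eq (fun t => ‖(Set.Iic (1 - ε)).indicator β t‖) k k₀
      simp_rw [this]
      exact integrable_const _

lemma integrable_mul_truncKernel (hβ : IsAngularKernel d β) {ε : ℝ} (hε : 0 < ε)
    {h : S d × S d → ℝ} (hh : Continuous h) :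
    Integrable (fun p : S d × S d => h p * truncKernel β ε p.1 p.2)
      ((surf d).prod (surf d)) := by
  obtain ⟨B, hB⟩ := isCompact_univ.exists_bound_of_continuousOn hh.continuousOn
  exact (integrable_truncKernel hβ hε).bdd_mul hh.aestronglyMeasurable
    (Filter.Eventually.of_forall fun x => hB x trivial)

lemma integral_mul_truncBoltzmann (hβ : IsAngularKernel d β) {ε : ℝ} (hε : 0 < ε)
    {f g : S d → ℝ} (hf : Continuous f) (hg : Continuous g) :
    ∫ k, g k * truncBoltzmann β f k ε ∂surf d
      = ∫ p : S d × S d, (g p.1 * (f p.2 - f p.1)) * truncKernel β ε p.1 p.2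
        ∂(surf d).prod (surf d) := by
  rw [integral_prod _ (integrable_mul_truncKernel hβ hε
    (h := fun p => g p.1 * (f p.2 - f p.1)) (by fun_prop))]
  refine integral_congr_ae (Filter.Eventually.of_forall fun k => ?_)
  simp only
  rw [truncBoltzmann_eq_truncKernel, ← integral_const_mul]
  simp_rw [mul_assoc]

/-- The difference of the two integrands on the product is `(g(k) f(σ) - f(k) g(σ))` times a
symmetric kernel, hence odd under the swap. -/
lemma integral_mul_truncBoltzmann_comm (hβ : IsAngularKernel d β) {ε : ℝ} (hε : 0 < ε)
    {f g : S d → ℝ} (hf : Continuous f) (hg : Continuous g) :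
    ∫ k, g k * truncBoltzmann β f k ε ∂surf d = ∫ k, f k * truncBoltzmann β g k ε ∂surf d := by
  rw [integral_mul_truncBoltzmann hβ hε hf hg, integral_mul_truncBoltzmann hβ hε hg hf,
    ← sub_eq_zero, ← integral_sub
      (integrable_mul_truncKernel hβ hε (h := fun p => g p.1 * (f p.2 - f p.1)) (by fun_prop))
      (integrable_mul_truncKernel hβ hε (h := fun p => f p.1 * (g p.2 - g p.1)) (by fun_prop))]
  set A : S d × S d → ℝ := fun p => (g p.1 * (f p.2 - f p.1)) * truncKernel β ε p.1 p.2
    - (f p.1 * (g p.2 - g p.1)) * truncKernel β ε p.1 p.2 with hA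
  have h1 : ∫ p, A p.swap ∂(surf d).prod (surf d) = ∫ p, A p ∂(surf d).prod (surf d) :=
    integral_prod_swap A
  have h2 : ∀ p, A p.swap = -A p := by
    intro p
    simp only [hA, Prod.fst_swap, Prod.snd_swap, truncKernel_comm β ε p.2 p.1]
    ring
  simp_rw [h2] at h1
  rw [integral_neg] at h1
  change ∫ p, A p ∂(surf d).prod (surf d) = 0
  linarith

lemma tendsto_integral_mul_truncBoltzmann (hβ : IsAngularKernel d β) {f g : S d → ℝ}
    (hf : IsSmooth f) (hg : Continuous g) :
    Tendsto (fun ε => ∫ k, g k * truncBoltzmann β f k ε ∂surf d) (𝓝[>] 0)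
      (𝓝 (∫ k, g k * linBoltzmann β f k ∂surf d)) := by
  obtain ⟨B, hB⟩ := (exists_hasBoltzmannValue hβ hf).2
  refine tendsto_integral_filter_of_dominated_convergence (fun k => |g k| * B)
    (Filter.Eventually.of_forall fun ε =>
      (hg.measurable.mul (measurable_truncBoltzmann hβ hf.continuous ε)).aestronglyMeasurable)
    ?_ ((integrable_of_continuous hg.abs).mul_const B)
    (Filter.Eventually.of_forall fun k =>
      (hasBoltzmannValue_linBoltzmann hβ hf k).const_mul (g k))
  filter_upwards [self_mem_nhdsWithin] with ε hε
  refine Filter.Eventually.of_forall fun k => ?_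
  rw [norm_mul]
  exact mul_le_mul_of_nonneg_left (hB k ε hε) (norm_nonneg _)

theorem integral_mul_linBoltzmann_comm (hβ : IsAngularKernel d β) {f g : S d → ℝ}
    (hf : IsSmooth f) (hg : IsSmooth g) :
    ∫ k, g k * linBoltzmann β f k ∂surf d = ∫ k, f k * linBoltzmann β g k ∂surf d := by
  refine tendsto_nhds_unique (tendsto_integral_mul_truncBoltzmann hβ hf hg.continuous)
    ((tendsto_integral_mul_truncBoltzmann hβ hg hf.continuous).congr' ?_)
  filter_upwards [self_mem_nhdsWithin] with ε hε
  exact integral_mul_truncBoltzmann_comm hβ hε hg.continuous hf.continuous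

/-! ### The action on spherical harmonics -/

/-- As `P_ℓ(1) = 1`, the polynomial `1 - P_ℓ` is divisible by `X - 1`, and the quotient is bounded
on `[-1,1]`. -/
lemma exists_one_sub_legendre_bound (hd : 2 ≤ d) (ℓ : ℕ) :
    ∃ C, ∀ t ∈ Set.Icc (-1 : ℝ) 1, |1 - (legendre d ℓ).eval t| ≤ C * (1 - t) := by
  have hroot : (1 - legendre d ℓ).IsRoot 1 := by
    simp [Polynomial.IsRoot, legendre_eval_one hd]
  obtain ⟨q, hq⟩ := Polynomial.dvd_iff_isRoot.mpr hroot
  obtain ⟨C, hC⟩ := isCompact_Icc.exists_bound_of_continuousOn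
    (f := fun t => q.eval t) (s := Set.Icc (-1 : ℝ) 1) q.continuous.continuousOn
  refine ⟨C, fun t ht => ?_⟩
  have h1 : 1 - (legendre d ℓ).eval t = (t - 1) * q.eval t := by
    have := congrArg (Polynomial.eval t) hq
    simpa using this
  have h2 := hC t ht
  rw [Real.norm_eq_abs] at h2
  rw [h1, abs_mul, abs_of_nonpos (by linarith [ht.2]), mul_comm]
  have : 0 ≤ -(t - 1) := by linarith [ht.2]
  nlinarith

lemma integrable_one_sub_legendre (hd : 2 ≤ d) (hβ : IsAngularKernel d β) (ℓ : ℕ) (k : S d) :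
    Integrable (fun σ : S d => (1 - (legendre d ℓ).eval ⟪(k : E d), (σ : E d)⟫)
      * β ⟪(k : E d), (σ : E d)⟫) (surf d) := by
  obtain ⟨C, hC⟩ := exists_one_sub_legendre_bound hd ℓ
  have hc : Continuous fun σ : S d => 1 - (legendre d ℓ).eval ⟪(k : E d), (σ : E d)⟫ :=
    continuous_const.sub ((legendre d ℓ).continuous.comp (by fun_prop))
  refine Integrable.mono' ((hβ.momentum k).const_mul C)
    (hc.measurable.mul (measurable_kernel hβ k)).aestronglyMeasurable
    (Filter.Eventually.of_forall fun σ => ?_)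
  have h1 := hC _ (inner_mem_Icc k σ)
  have h0 := kernel_nonneg hβ k σ
  rw [Real.norm_eq_abs, abs_mul, abs_of_nonneg h0, ← mul_assoc]
  gcongr

/-- `∫ (1 - P_ℓ(k · σ)) β(k · σ) dσ`. -/
def nuAt (β : ℝ → ℝ) (ℓ : ℕ) (k : S d) : ℝ :=
  ∫ σ : S d, (1 - (legendre d ℓ).eval ⟪(k : E d), (σ : E d)⟫) * β ⟪(k : E d), (σ : E d)⟫ ∂surf d

lemma nuAt_eq (β : ℝ → ℝ) (ℓ : ℕ) (k k' : S d) : nuAt β ℓ k = nuAt β ℓ k' :=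
  integral_inner_eq (fun t => (1 - (legendre d ℓ).eval t) * β t) k k'

lemma hasBoltzmannValue_zonal (hd : 2 ≤ d) (hβ : IsAngularKernel d β) (ℓ : ℕ) (k : S d) :
    HasBoltzmannValue β (zonal k ℓ) k (-nuAt β ℓ k) := by
  have e : ∀ σ : S d, (zonal k ℓ σ - zonal k ℓ k) * β ⟪(k : E d), (σ : E d)⟫
      = -((1 - (legendre d ℓ).eval ⟪(k : E d), (σ : E d)⟫) * β ⟪(k : E d), (σ : E d)⟫) := by
    intro σ
    rw [zonal_self hd, zonal]
    ring
  have hint : Integrable (fun σ : S d =>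
      (zonal k ℓ σ - zonal k ℓ k) * β ⟪(k : E d), (σ : E d)⟫) (surf d) := by
    simp_rw [e]
    exact (integrable_one_sub_legendre hd hβ ℓ k).neg
  have h := hasBoltzmannValue_of_integrable hint
  simp_rw [e] at h
  rwa [integral_neg] at h

/-- The truncated operator at `k`, as a functional on spherical harmonics. -/
def truncFunctional (hβ : IsAngularKernel d β) (ℓ : ℕ) (k : S d) {ε : ℝ} (hε : 0 < ε) :
    sphericalHarmonics d ℓ →ₗ[ℝ] ℝ where
  toFun Y := truncBoltzmann β Y.1 k ε
  map_add' Y Z := by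
    have h : ∀ Y : sphericalHarmonics d ℓ, IntegrableOn
        (fun σ : S d => (Y.1 σ - Y.1 k) * β ⟪(k : E d), (σ : E d)⟫) (truncSet k ε) (surf d) :=
      fun Y => integrableOn_mul_kernel hβ k hε (Y.2.1.continuous.sub continuous_const)
    rw [truncBoltzmann_eq, truncBoltzmann_eq, truncBoltzmann_eq, ← integral_add (h Y) (h Z)]
    refine integral_congr_ae (Filter.Eventually.of_forall fun σ => ?_)
    simp only [Submodule.coe_add, Pi.add_apply]
    ring
  map_smul' c Y := by
    rw [truncBoltzmann_eq, truncBoltzmann_eq, RingHom.id_apply, smul_eq_mul, ← integral_const_mul]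
    refine integral_congr_ae (Filter.Eventually.of_forall fun σ => ?_)
    simp only [Submodule.coe_smul, Pi.smul_apply, smul_eq_mul]
    ring

/-- `funkHecke` is applied before `ε → 0`, while the integrals are absolutely convergent and
linearity is immediate. Only the zonal factor then has to be passed to the limit. -/
lemma truncBoltzmann_harmonic (hd : 2 ≤ d) (hβ : IsAngularKernel d β) {ℓ : ℕ} {Y : S d → ℝ}
    (hY : Y ∈ sphericalHarmonics d ℓ) (k : S d) {ε : ℝ} (hε : 0 < ε) :
    truncBoltzmann β Y k ε = Y k * truncBoltzmann β (zonal k ℓ) k ε := by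
  refine funkHecke hd k (truncFunctional hβ ℓ k hε) (fun R hR Z => ?_) ⟨Y, hY⟩
  change truncBoltzmann β (Z.1 ∘ sphereMap R) k ε = truncBoltzmann β Z.1 k ε
  have hk : sphereMap R k = k := Subtype.ext hR
  rw [truncBoltzmann_eq, truncBoltzmann_eq, ← integral_truncSet_comp k ε R hR
    fun σ => (Z.1 σ - Z.1 k) * β ⟪(k : E d), (σ : E d)⟫]
  refine integral_congr_ae (Filter.Eventually.of_forall fun σ => ?_)
  simp only [Function.comp_apply, hk, inner_isometry hR]

theorem hasBoltzmannValue_harmonic (hd : 2 ≤ d) (hβ : IsAngularKernel d β) {ℓ : ℕ} {Y : S d → ℝ}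
    (hY : Y ∈ sphericalHarmonics d ℓ) (k : S d) :
    HasBoltzmannValue β Y k (-nuAt β ℓ k * Y k) := by
  have h := (hasBoltzmannValue_zonal hd hβ ℓ k).const_mul (Y k)
  rw [mul_comm]
  refine Tendsto.congr' ?_ h
  filter_upwards [self_mem_nhdsWithin] with ε hε
  exact (truncBoltzmann_harmonic hd hβ hY k hε).symm

/-! ### Areas of spheres -/

lemma sphereArea_eq {n : ℕ} (hn : 0 < n) :
    sphereArea n = n * (√Real.pi ^ n / Real.Gamma (n / 2 + 1)) := by
  have : Nonempty (Fin n) := ⟨⟨0, hn⟩⟩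
  have hG : 0 < Real.Gamma ((n : ℝ) / 2 + 1) := Real.Gamma_pos_of_pos (by positivity)
  rw [sphereArea, Measure.toSphere_real_apply_univ, finrank_euclideanSpace_fin, measureReal_def,
    EuclideanSpace.volume_ball]
  simp only [ENNReal.ofReal_one, one_pow, one_mul, Fintype.card_fin]
  rw [ENNReal.toReal_ofReal (by positivity)]

lemma sphereArea_add_two {n : ℕ} (hn : 0 < n) :
    n * sphereArea (n + 2) = 2 * Real.pi * sphereArea n := by
  rw [sphereArea_eq hn, sphereArea_eq (by omega)]
  have hG : 0 < Real.Gamma ((n : ℝ) / 2 + 1) := Real.Gamma_pos_of_pos (by positivity)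
  have h1 : Real.Gamma (((n + 2 : ℕ) : ℝ) / 2 + 1)
      = ((n : ℝ) / 2 + 1) * Real.Gamma ((n : ℝ) / 2 + 1) := by
    rw [← Real.Gamma_add_one (by positivity)]
    congr 1
    push_cast
    ring
  have h2 : √Real.pi ^ (n + 2) = Real.pi * √Real.pi ^ n := by
    rw [pow_add, Real.sq_sqrt Real.pi_pos.le, mul_comm]
  rw [h1, h2]
  push_cast
  field_simp

lemma sphereArea_one : sphereArea 1 = 2 := by
  rw [sphereArea_eq one_pos]
  have h : Real.Gamma (((1 : ℕ) : ℝ) / 2 + 1) = √Real.pi / 2 := by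
    rw [Real.Gamma_add_one (by norm_num), Nat.cast_one, Real.Gamma_one_half_eq]
    ring
  have hpi : √Real.pi ≠ 0 := by positivity
  rw [h]
  field_simp
  simp

lemma sphereArea_two : sphereArea 2 = 2 * Real.pi := by
  rw [sphereArea_eq two_pos]
  have h : Real.Gamma (((2 : ℕ) : ℝ) / 2 + 1) = 1 := by
    norm_num
  rw [h, Real.sq_sqrt Real.pi_pos.le]
  simp

lemma sphereArea_pos {n : ℕ} (hn : 0 < n) : 0 < sphereArea n := by
  have hG : 0 < Real.Gamma ((n : ℝ) / 2 + 1) := Real.Gamma_pos_of_pos (by positivity)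
  have : (0 : ℝ) < n := by exact_mod_cast hn
  rw [sphereArea_eq hn]
  positivity

/-- The areas and the Wallis integrals both satisfy recursions in steps of two, which are
compatible; `e = 0` and `e = 1` start the induction. -/
lemma sphereArea_eq_mul_integral (e : ℕ) :
    sphereArea (e + 2) = sphereArea (e + 1) * ∫ θ in (0 : ℝ)..Real.pi, Real.sin θ ^ e := by
  induction e using Nat.twoStepInduction with
  | zero => simp [sphereArea_two, sphereArea_one]
  | one =>
    have h := sphereArea_add_two (n := 1) one_pos
    rw [sphereArea_one] at h
    norm_num at h
    norm_num [sphereArea_two, h]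
  | more n h0 _ =>
    have h1 := sphereArea_add_two (n := n + 2) (by omega)
    have h2 := sphereArea_add_two (n := n + 1) (by omega)
    have h3 : ∫ θ in (0 : ℝ)..Real.pi, Real.sin θ ^ (n + 2)
        = ((n : ℝ) + 1) / (n + 2) * ∫ θ in (0 : ℝ)..Real.pi, Real.sin θ ^ n := by
      rw [integral_sin_pow]; simp
    rw [h3]
    rw [h0] at h1
    push_cast at h1 h2
    have hn : (n : ℝ) + 2 ≠ 0 := by positivity
    have : ((n : ℝ) + 2) * sphereArea (n + 2 + 2) = ((n : ℝ) + 2) * (sphereArea (n + 2 + 1)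
        * (((n : ℝ) + 1) / (n + 2) * ∫ θ in (0 : ℝ)..Real.pi, Real.sin θ ^ n)) := by
      rw [h1]
      field_simp
      rw [show n + 2 + 1 = n + 1 + 2 by ring]
      linear_combination -(∫ θ in (0 : ℝ)..Real.pi, Real.sin θ ^ n) * h2
    exact mul_left_cancel₀ hn this

/-! ### Moments of `k · σ` -/

lemma lapPoly_linPoly_pow (k : S d) (j : ℕ) :
    lapPoly (linPoly (k : E d) ^ (j + 2)) = ((j + 2) * (j + 1)) * linPoly (k : E d) ^ j := by
  have hD : ∀ j : ℕ, dirDeriv (k : E d) (linPoly (k : E d) ^ (j + 1))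
      = (j + 1) * linPoly (k : E d) ^ j := by
    intro j
    rw [Derivation.leibniz_pow, dirDeriv_linPoly]
    simp
  induction j with
  | zero =>
    rw [zero_add, sq, lapPoly_linPoly_mul, dirDeriv_linPoly,
      lapPoly_eq_zero (isHomogeneous_linPoly _) (by norm_num)]
    simp
  | succ j ih =>
    rw [pow_succ' _ (j + 2), lapPoly_linPoly_mul, hD (j + 1), ih]
    push_cast
    ring

lemma polyRestrict_linPoly_pow (k : S d) (j : ℕ) (x : S d) :
    polyRestrict (linPoly (k : E d) ^ j) x = ⟪(k : E d), (x : E d)⟫ ^ j := by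
  have := polyFun_linPoly (k : E d) (x : E d)
  simp only [polyRestrict, polyFun, map_pow] at this ⊢
  rw [this]

lemma isHomogeneous_linPoly_pow (k : E d) (j : ℕ) : (linPoly k ^ j).IsHomogeneous j := by
  simpa using (isHomogeneous_linPoly k).pow j

lemma integral_sphereLaplacian (hd : 2 ≤ d) {f : S d → ℝ} (hf : IsSmooth f) :
    ∫ x, sphereLaplacian f x ∂surf d = 0 := by
  have := nontrivial_E hd
  have h1 : (1 : MvPolynomial (Fin d) ℝ).IsHomogeneous 0 := MvPolynomial.isHomogeneous_one _ _
  have h := integral_mul_sphereLaplacian (isSmooth_polyRestrict h1) hf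
  have e : ∀ x, sphereLaplacian (polyRestrict (1 : MvPolynomial (Fin d) ℝ)) x = 0 := by
    intro x
    rw [sphereLaplacian_polyRestrict h1, lapPoly_eq_zero h1 (by norm_num)]
    simp [polyRestrict, polyFun]
  simpa [e, polyRestrict, polyFun] using h

/-- The moments of `k · σ`. -/
def sphereMoment (k : S d) (j : ℕ) : ℝ := ∫ x, ⟪(k : E d), (x : E d)⟫ ^ j ∂surf d

lemma integrable_inner_pow (k : S d) (j : ℕ) :
    Integrable (fun x : S d => ⟪(k : E d), (x : E d)⟫ ^ j) (surf d) :=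
  integrable_of_continuous (by fun_prop)

lemma sphereMoment_one (hd : 2 ≤ d) (k : S d) : sphereMoment k 1 = 0 := by
  have hh := isHomogeneous_linPoly_pow (k : E d) 1
  have h := integral_sphereLaplacian hd (isSmooth_polyRestrict hh)
  simp_rw [sphereLaplacian_polyRestrict hh, polyRestrict_linPoly_pow] at h
  rw [lapPoly_eq_zero hh (by norm_num)] at h
  have e : ∀ x : S d, polyRestrict (0 : MvPolynomial (Fin d) ℝ) x
      - ((1 : ℕ) : ℝ) * (((1 : ℕ) : ℝ) + d - 2) * ⟪(k : E d), (x : E d)⟫ ^ 1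
      = (1 - (d : ℝ)) * ⟪(k : E d), (x : E d)⟫ ^ 1 := by
    intro x
    simp [polyRestrict, polyFun]
    ring
  simp_rw [e] at h
  rw [integral_const_mul] at h
  have hd' : (2 : ℝ) ≤ d := by exact_mod_cast hd
  exact (mul_eq_zero.mp h).resolve_left (by linarith)

/-- The spherical Laplacian of `(k · x)^{j+2}` is a combination of the powers `j` and `j + 2`, and
its integral is zero. -/
lemma sphereMoment_add_two (hd : 2 ≤ d) (k : S d) (j : ℕ) :
    ((j : ℝ) + d) * sphereMoment k (j + 2) = ((j : ℝ) + 1) * sphereMoment k j := by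
  have hh := isHomogeneous_linPoly_pow (k : E d) (j + 2)
  have h := integral_sphereLaplacian hd (isSmooth_polyRestrict hh)
  simp_rw [sphereLaplacian_polyRestrict hh, lapPoly_linPoly_pow, polyRestrict_linPoly_pow] at h
  have e : ∀ x : S d, polyRestrict ((((j : MvPolynomial (Fin d) ℝ) + 2) * ((j : MvPolynomial (Fin d) ℝ) + 1))
        * linPoly (k : E d) ^ j) x
      - ((j + 2 : ℕ) : ℝ) * (((j + 2 : ℕ) : ℝ) + d - 2) * ⟪(k : E d), (x : E d)⟫ ^ (j + 2)
      = (((j : ℝ) + 2) * (j + 1)) * ⟪(k : E d), (x : E d)⟫ ^ j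
        - (((j : ℝ) + 2) * (j + d)) * ⟪(k : E d), (x : E d)⟫ ^ (j + 2) := by
    intro x
    have h1 := polyRestrict_linPoly_pow k j x
    simp only [polyRestrict, polyFun, map_mul, map_add, map_natCast, map_one, map_ofNat] at h1 ⊢
    rw [h1]
    push_cast
    ring
  simp_rw [e] at h
  rw [integral_sub ((integrable_inner_pow k j).const_mul _)
    ((integrable_inner_pow k (j + 2)).const_mul _), integral_const_mul, integral_const_mul] at h
  change _ * sphereMoment k j - _ * sphereMoment k (j + 2) = 0 at h
  have hj : (j : ℝ) + 2 ≠ 0 := by positivity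
  apply mul_left_cancel₀ hj
  linear_combination -h

/-- The moments of `cos θ` with respect to `sin^e θ dθ` on `[0, π]`. -/
def cosMoment (e j : ℕ) : ℝ := ∫ θ in (0 : ℝ)..Real.pi, Real.cos θ ^ j * Real.sin θ ^ e

lemma cosMoment_one (e : ℕ) : cosMoment e 1 = 0 := by
  have h := intervalIntegral.integral_eq_sub_of_hasDerivAt (a := 0) (b := Real.pi)
    (f := fun θ => Real.sin θ ^ (e + 1))
    (f' := fun θ => ((e : ℝ) + 1) * (Real.cos θ ^ 1 * Real.sin θ ^ e))
    (fun θ _ => ((Real.hasDerivAt_sin θ).pow (e + 1)).congr_deriv (by simp; ring))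
    (Continuous.intervalIntegrable (by fun_prop) _ _)
  rw [intervalIntegral.integral_const_mul] at h
  have h2 : ((e : ℝ) + 1) * cosMoment e 1 = 0 := by
    rw [cosMoment, h]; simp
  exact (mul_eq_zero.mp h2).resolve_left (by positivity)

/-- Integrate the derivative of `cos^{j+1} sin^{e+1}`, which vanishes at both ends. With `d = e + 2`
this is the recursion of `sphereMoment_add_two`. -/
lemma cosMoment_add_two (e j : ℕ) :
    ((j : ℝ) + e + 2) * cosMoment e (j + 2) = ((j : ℝ) + 1) * cosMoment e j := by
  have hder : ∀ θ : ℝ, HasDerivAt (fun θ => Real.cos θ ^ (j + 1) * Real.sin θ ^ (e + 1))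
      (((j : ℝ) + e + 2) * (Real.cos θ ^ (j + 2) * Real.sin θ ^ e)
        - ((j : ℝ) + 1) * (Real.cos θ ^ j * Real.sin θ ^ e)) θ := by
    intro θ
    refine (((Real.hasDerivAt_cos θ).pow (j + 1)).mul
      ((Real.hasDerivAt_sin θ).pow (e + 1))).congr_deriv ?_
    have := Real.sin_sq_add_cos_sq θ
    simp only [Nat.add_sub_cancel, Pi.pow_apply]
    push_cast
    linear_combination (-((j : ℝ) + 1) * Real.cos θ ^ j * Real.sin θ ^ e) * this
  have h := intervalIntegral.integral_eq_sub_of_hasDerivAt (a := 0) (b := Real.pi)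
    (fun θ _ => hder θ) (Continuous.intervalIntegrable (by fun_prop) _ _)
  rw [intervalIntegral.integral_sub (Continuous.intervalIntegrable (by fun_prop) _ _)
    (Continuous.intervalIntegrable (by fun_prop) _ _), intervalIntegral.integral_const_mul,
    intervalIntegral.integral_const_mul] at h
  change _ * cosMoment e (j + 2) - _ * cosMoment e j = _ at h
  simp at h
  linarith

lemma sphereMoment_eq (e : ℕ) (k : S (e + 2)) (j : ℕ) :
    sphereMoment k j = sphereArea (e + 1) * cosMoment e j := by
  have hd : 2 ≤ e + 2 := by omega
  induction j using Nat.twoStepInduction with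
  | zero =>
    have h := sphereArea_eq_mul_integral e
    simp only [sphereMoment, cosMoment, pow_zero, one_mul]
    rw [← h, integral_const, smul_eq_mul, mul_one]
    rfl
  | one => rw [sphereMoment_one hd, cosMoment_one, mul_zero]
  | more j h0 _ =>
    have h1 := sphereMoment_add_two hd k j
    have h2 := cosMoment_add_two e j
    rw [h0] at h1
    have hne : (j : ℝ) + e + 2 ≠ 0 := by positivity
    apply mul_left_cancel₀ hne
    push_cast at h1
    linear_combination h1 - sphereArea (e + 1) * h2

/-! ### The distribution of `k · σ` -/

/-- The density `|S^{e}| sin^e θ dθ` on `(0, π]`. -/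
def angleMeasure (e : ℕ) : Measure ℝ :=
  (volume.restrict (Set.Ioc 0 Real.pi)).withDensity
    fun θ => ENNReal.ofReal (sphereArea (e + 1) * Real.sin θ ^ e)

lemma sin_nonneg_of_mem_Ioc {θ : ℝ} (h : θ ∈ Set.Ioc 0 Real.pi) : 0 ≤ Real.sin θ :=
  Real.sin_nonneg_of_nonneg_of_le_pi h.1.le h.2

lemma integral_angleMeasure (e : ℕ) (F : ℝ → ℝ) : ∫ θ, F θ ∂angleMeasure e
    = sphereArea (e + 1) * ∫ θ in (0 : ℝ)..Real.pi, F θ * Real.sin θ ^ e := by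
  rw [angleMeasure, integral_withDensity_eq_integral_toReal_smul (by fun_prop)
    (Filter.Eventually.of_forall fun _ => ENNReal.ofReal_lt_top),
    intervalIntegral.integral_of_le Real.pi_pos.le, ← integral_const_mul]
  refine setIntegral_congr_fun measurableSet_Ioc fun θ hθ => ?_
  rw [ENNReal.toReal_ofReal (mul_nonneg (sphereArea_pos (by omega)).le
    (pow_nonneg (sin_nonneg_of_mem_Ioc hθ) _)), smul_eq_mul]
  ring

lemma integrable_angleMeasure {e : ℕ} {F : ℝ → ℝ} (hF : Integrable F (angleMeasure e)) :
    IntervalIntegrable (fun θ => F θ * Real.sin θ ^ e) volume 0 Real.pi := by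
  rw [angleMeasure, integrable_withDensity_iff_integrable_smul' (by fun_prop)
    (Filter.Eventually.of_forall fun _ => ENNReal.ofReal_lt_top)] at hF
  rw [intervalIntegrable_iff_integrableOn_Ioc_of_le Real.pi_pos.le]
  have hA := sphereArea_pos (n := e + 1) (by omega)
  refine (hF.const_mul (sphereArea (e + 1))⁻¹).congr ?_
  filter_upwards [ae_restrict_mem measurableSet_Ioc] with θ hθ
  rw [ENNReal.toReal_ofReal (mul_nonneg hA.le (pow_nonneg (sin_nonneg_of_mem_Ioc hθ) _)),
    smul_eq_mul]
  field_simp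

instance (e : ℕ) : IsFiniteMeasure (angleMeasure e) := by
  refine isFiniteMeasure_withDensity_ofReal ?_
  exact (Continuous.integrableOn_Icc (by fun_prop)).mono_set Set.Ioc_subset_Icc_self |>.2

/-- The image of the surface measure under `σ ↦ k · σ`. -/
theorem map_inner_surf (e : ℕ) (k : S (e + 2)) :
    (surf (e + 2)).map (fun σ : S (e + 2) => ⟪(k : E (e + 2)), (σ : E (e + 2))⟫)
      = (angleMeasure e).map Real.cos := by
  have hc : Continuous fun σ : S (e + 2) => ⟪(k : E (e + 2)), (σ : E (e + 2))⟫ := by fun_prop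
  set μ := (surf (e + 2)).map (fun σ : S (e + 2) => ⟪(k : E (e + 2)), (σ : E (e + 2))⟫) with hμ
  set ν := (angleMeasure e).map Real.cos with hν
  have : IsFiniteMeasure μ := Measure.isFiniteMeasure_map _ _
  have : IsFiniteMeasure ν := Measure.isFiniteMeasure_map _ _
  have hμs : ∀ᵐ t ∂μ, t ∈ Set.Icc (-1 : ℝ) 1 := by
    exact (ae_map_iff hc.aemeasurable (p := fun t => t ∈ Set.Icc (-1 : ℝ) 1)
      measurableSet_Icc).mpr (Filter.Eventually.of_forall fun σ => inner_mem_Icc k σ)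
  have hνs : ∀ᵐ t ∂ν, t ∈ Set.Icc (-1 : ℝ) 1 := by
    exact (ae_map_iff Real.continuous_cos.aemeasurable (p := fun t => t ∈ Set.Icc (-1 : ℝ) 1)
      measurableSet_Icc).mpr (Filter.Eventually.of_forall fun θ =>
        ⟨Real.neg_one_le_cos θ, Real.cos_le_one θ⟩)
  have hint : ∀ (ρ : Measure ℝ) [IsFiniteMeasure ρ], (∀ᵐ t ∂ρ, t ∈ Set.Icc (-1 : ℝ) 1) →
      ∀ f : ℝ → ℝ, Continuous f → Integrable f ρ := by
    intro ρ _ hρ f hf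
    obtain ⟨B, hB⟩ := isCompact_Icc.exists_bound_of_continuousOn
      (s := Set.Icc (-1 : ℝ) 1) hf.continuousOn
    exact Integrable.of_bound hf.aestronglyMeasurable B (hρ.mono fun t ht => hB t ht)
  have hmom : ∀ j : ℕ, ∫ t, t ^ j ∂μ = ∫ t, t ^ j ∂ν := by
    intro j
    rw [hμ, hν, integral_map hc.aemeasurable (by fun_prop), integral_map (by fun_prop)
      (by fun_prop), integral_angleMeasure]
    exact sphereMoment_eq e k j
  have hpoly : ∀ q : Polynomial ℝ, ∫ t, q.eval t ∂μ = ∫ t, q.eval t ∂ν := by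
    intro q
    simp_rw [Polynomial.eval_eq_sum_range]
    rw [integral_finsetSum _ fun i _ => hint μ hμs _ (by fun_prop),
      integral_finsetSum _ fun i _ => hint ν hνs _ (by fun_prop)]
    refine Finset.sum_congr rfl fun i _ => ?_
    rw [integral_const_mul, integral_const_mul, hmom]
  refine ext_of_forall_integral_eq_of_IsFiniteMeasure fun f => ?_
  -- Both measures are finite and carried by `[-1,1]`, so Weierstrass approximation upgrades
  -- equality of moments to equality on bounded continuous functions.
  have hclose : ∀ ε > 0, |∫ t, f t ∂μ - ∫ t, f t ∂ν| ≤ ε * (μ.real Set.univ + ν.real Set.univ) := by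
    intro ε hε
    obtain ⟨q, hq⟩ := exists_polynomial_near_of_continuousOn (-1) 1 f
      f.continuous.continuousOn ε hε
    have hb : ∀ (ρ : Measure ℝ) [IsFiniteMeasure ρ], (∀ᵐ t ∂ρ, t ∈ Set.Icc (-1 : ℝ) 1) →
        |∫ t, f t ∂ρ - ∫ t, q.eval t ∂ρ| ≤ ε * ρ.real Set.univ := by
      intro ρ _ hρ
      rw [← integral_sub (hint ρ hρ _ f.continuous) (hint ρ hρ _ q.continuous),
        ← Real.norm_eq_abs]
      refine norm_integral_le_of_norm_le_const (hρ.mono fun t ht => ?_)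
      rw [Real.norm_eq_abs, abs_sub_comm]
      exact (hq t ht).le
    have h1 := abs_le.mp (hb μ hμs)
    have h2 := abs_le.mp (hb ν hνs)
    rw [hpoly] at h1
    rw [abs_le]
    constructor <;> linarith [h1.1, h1.2, h2.1, h2.2]
  rw [← sub_eq_zero, ← abs_nonpos_iff]
  refine le_of_forall_pos_le_add fun δ hδ => ?_
  have hm : 0 ≤ μ.real Set.univ + ν.real Set.univ := by positivity
  refine (hclose (δ / (1 + (μ.real Set.univ + ν.real Set.univ))) (by positivity)).trans ?_
  rw [zero_add, div_mul_eq_mul_div, div_le_iff₀ (by positivity)]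
  nlinarith

/-- Equality of the image measures, not just of their moments, is needed because `F` involves the
merely measurable `β`. -/
theorem intervalIntegrable_and_integral_inner (hd : 2 ≤ d) (k : S d) {F : ℝ → ℝ}
    (hF : Measurable F) (hi : Integrable (fun σ : S d => F ⟪(k : E d), (σ : E d)⟫) (surf d)) :
    IntervalIntegrable (fun θ => F (Real.cos θ) * Real.sin θ ^ (d - 2)) volume 0 Real.pi ∧
      ∫ σ : S d, F ⟪(k : E d), (σ : E d)⟫ ∂surf d
        = sphereArea (d - 1)
          * ∫ θ in (0 : ℝ)..Real.pi, F (Real.cos θ) * Real.sin θ ^ (d - 2) := by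
  obtain ⟨e, rfl⟩ : ∃ e, d = e + 2 := ⟨d - 2, by omega⟩
  have hc : Continuous fun σ : S (e + 2) => ⟪(k : E (e + 2)), (σ : E (e + 2))⟫ := by fun_prop
  have hi' : Integrable F ((surf (e + 2)).map
      fun σ : S (e + 2) => ⟪(k : E (e + 2)), (σ : E (e + 2))⟫) :=
    (integrable_map_measure hF.aestronglyMeasurable hc.aemeasurable).mpr hi
  have hi2 := hi'
  rw [map_inner_surf, integrable_map_measure hF.aestronglyMeasurable
    Real.continuous_cos.aemeasurable] at hi2
  refine ⟨integrable_angleMeasure hi2, ?_⟩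
  rw [← integral_map hc.aemeasurable hF.aestronglyMeasurable, map_inner_surf,
    integral_map Real.continuous_cos.aemeasurable hF.aestronglyMeasurable, integral_angleMeasure]
  rfl

/-! ### Diagonal operators on Hilbert sums -/

section HilbertSum

variable {H : Type*} [NormedAddCommGroup H] [InnerProductSpace ℝ H] [CompleteSpace H]
  {V : ℕ → Submodule ℝ H}

lemma exists_hasSum_of_isHilbertSum
    (hV : IsHilbertSum ℝ (fun ℓ => V ℓ) (fun ℓ => (V ℓ).subtypeₗᵢ)) (x : H) :
    ∃ w : ∀ ℓ, V ℓ, HasSum (fun ℓ => (w ℓ : H)) x := by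
  refine ⟨fun ℓ => hV.linearIsometryEquiv x ℓ, ?_⟩
  simpa using hV.hasSum_linearIsometryEquiv_symm (hV.linearIsometryEquiv x)

lemma inner_eq_inner_component
    (hV : IsHilbertSum ℝ (fun ℓ => V ℓ) (fun ℓ => (V ℓ).subtypeₗᵢ)) {x : H} {w : ∀ ℓ, V ℓ}
    (hw : HasSum (fun ℓ => (w ℓ : H)) x) {ℓ : ℕ} (y : V ℓ) : ⟪(y : H), x⟫ = ⟪(y : H), w ℓ⟫ := by
  have h1 : HasSum (fun m => ⟪(y : H), (w m : H)⟫) ⟪(y : H), x⟫ :=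
    hw.mapL (innerSL ℝ (y : H))
  refine h1.unique (hasSum_single ℓ fun m hm => ?_)
  exact hV.OrthogonalFamily hm.symm y (w m)

/-- Diagonal operators on a Hilbert sum, with real entries, are symmetric. -/
theorem inner_eq_inner_of_diagonal
    (hV : IsHilbertSum ℝ (fun ℓ => V ℓ) (fun ℓ => (V ℓ).subtypeₗᵢ)) {c : ℕ → ℝ} {f g A B : H}
    (hfg : ∀ ℓ, ∀ y ∈ V ℓ, ⟪y, g⟫ = c ℓ * ⟪y, f⟫) (hBA : ∀ ℓ, ∀ y ∈ V ℓ, ⟪y, A⟫ = c ℓ * ⟪y, B⟫) :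
    ⟪f, A⟫ = ⟪g, B⟫ := by
  obtain ⟨u, hu⟩ := exists_hasSum_of_isHilbertSum hV f
  obtain ⟨w, hw⟩ := exists_hasSum_of_isHilbertSum hV B
  -- One side is expanded along the components of `f`, the other along those of `B`; both terms of
  -- index `ℓ` equal `c ℓ * ⟪u ℓ, w ℓ⟫`. Boundedness of `c` plays no role.
  have h1 : HasSum (fun ℓ => ⟪A, (u ℓ : H)⟫) ⟪A, f⟫ := hu.mapL (innerSL ℝ A)
  have h2 : HasSum (fun ℓ => ⟪g, (w ℓ : H)⟫) ⟪g, B⟫ := hw.mapL (innerSL ℝ g)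
  rw [real_inner_comm]
  refine h1.unique ?_
  convert h2 using 2 with ℓ
  rw [real_inner_comm, real_inner_comm (w ℓ : H) g, hBA ℓ _ (u ℓ).2, hfg ℓ _ (w ℓ).2,
    inner_eq_inner_component hV hw, inner_eq_inner_component hV hu, real_inner_comm]

end HilbertSum

/-! ### The domain of `L_β` -/

lemma integral_mul_smooth (f : L2 d) {φ : S d → ℝ} (hφ : IsSmooth φ) :
    ∫ x, f x * φ x ∂surf d = ⟪f, contL2 d (smoothCM hφ)⟫ := by
  rw [inner_eq_integral]
  refine integral_congr_ae ?_
  filter_upwards [coeFn_contL2 (smoothCM hφ)] with x hx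
  rw [hx]
  rfl

lemma integral_mul_linBoltzmann {β : ℝ → ℝ} (hβ : IsAngularKernel d β) (f : L2 d) {φ : S d → ℝ}
    (hφ : IsSmooth φ) :
    ∫ x, f x * linBoltzmann β φ x ∂surf d = ⟪f, (memLp_linBoltzmann hβ hφ).toLp _⟫ := by
  rw [inner_eq_integral]
  refine integral_congr_ae ?_
  filter_upwards [(memLp_linBoltzmann hβ hφ).coeFn_toLp] with x hx
  rw [hx]

lemma mem_sphericalHarmonicsL2_iff {ℓ : ℕ} {F : L2 d} : F ∈ sphericalHarmonicsL2 d ℓ ↔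
    ∃ (Y : S d → ℝ) (hY : Y ∈ sphericalHarmonics d ℓ), F = contL2 d (smoothCM hY.1) := by
  constructor
  · rintro ⟨Y, hY, hFY⟩
    exact ⟨Y, hY, Lp.ext (hFY.trans (coeFn_contL2 (smoothCM hY.1)).symm)⟩
  · rintro ⟨Y, hY, rfl⟩
    exact ⟨Y, hY, coeFn_contL2 (smoothCM hY.1)⟩

lemma linBoltzmann_harmonic (hd : 2 ≤ d) {β : ℝ → ℝ} (hβ : IsAngularKernel d β) (k₀ : S d)
    {ℓ : ℕ} {Y : S d → ℝ} (hY : Y ∈ sphericalHarmonics d ℓ) (k : S d) :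
    linBoltzmann β Y k = -nuAt β ℓ k₀ * Y k := by
  rw [(hasBoltzmannValue_harmonic hd hβ hY k).linBoltzmann_eq, nuAt_eq β ℓ k k₀]

lemma toLp_linBoltzmann_harmonic (hd : 2 ≤ d) {β : ℝ → ℝ} (hβ : IsAngularKernel d β) (k₀ : S d)
    {ℓ : ℕ} {Y : S d → ℝ} (hY : Y ∈ sphericalHarmonics d ℓ) :
    (memLp_linBoltzmann hβ hY.1).toLp _ = -nuAt β ℓ k₀ • contL2 d (smoothCM hY.1) := by
  refine Lp.ext ?_
  filter_upwards [(memLp_linBoltzmann hβ hY.1).coeFn_toLp, coeFn_contL2 (smoothCM hY.1),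
    Lp.coeFn_smul (-nuAt β ℓ k₀) (contL2 d (smoothCM hY.1))] with x h1 h2 h3
  rw [h1, h3, Pi.smul_apply, h2, linBoltzmann_harmonic hd hβ k₀ hY, smul_eq_mul]
  rfl

/-- Symmetry moves `L_β` from `φ` onto the harmonic, where it acts by the scalar `-ν_ℓ`. -/
lemma inner_toLp_linBoltzmann (hd : 2 ≤ d) {β : ℝ → ℝ} (hβ : IsAngularKernel d β) (k₀ : S d)
    {φ : S d → ℝ} (hφ : IsSmooth φ) {ℓ : ℕ} {Y : L2 d} (hY : Y ∈ sphericalHarmonicsL2 d ℓ) :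
    ⟪Y, (memLp_linBoltzmann hβ hφ).toLp _⟫ = -nuAt β ℓ k₀ * ⟪Y, contL2 d (smoothCM hφ)⟫ := by
  obtain ⟨Z, hZ, rfl⟩ := mem_sphericalHarmonicsL2_iff.mp hY
  have h1 : ∫ x, contL2 d (smoothCM hZ.1) x * linBoltzmann β φ x ∂surf d
      = ∫ x, Z x * linBoltzmann β φ x ∂surf d := by
    refine integral_congr_ae ?_
    filter_upwards [coeFn_contL2 (smoothCM hZ.1)] with x hx
    rw [hx]
    rfl
  rw [← integral_mul_linBoltzmann hβ _ hφ, h1, integral_mul_linBoltzmann_comm hβ hφ hZ.1, inner_contL2,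
    ← integral_const_mul]
  refine integral_congr_ae (Filter.Eventually.of_forall fun x => ?_)
  change φ x * linBoltzmann β Z x = -nuAt β ℓ k₀ * (Z x * φ x)
  rw [linBoltzmann_harmonic hd hβ k₀ hZ]
  ring

/-- In `L²`, the operator `L_β` is diagonal with respect to the spherical harmonics. -/
theorem isBoltzmannImage_iff (hd : 2 ≤ d) {β : ℝ → ℝ} (hβ : IsAngularKernel d β) (k₀ : S d)
    (f g : L2 d) : IsBoltzmannImage β f g ↔
      ∀ ℓ : ℕ, ∀ Y ∈ sphericalHarmonicsL2 d ℓ, ⟪Y, g⟫ = -nuAt β ℓ k₀ * ⟪Y, f⟫ := by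
  constructor
  · intro h ℓ Y hY
    obtain ⟨Z, hZ, rfl⟩ := mem_sphericalHarmonicsL2_iff.mp hY
    have h1 := h Z hZ.1
    rw [integral_mul_linBoltzmann hβ f hZ.1, integral_mul_smooth g hZ.1,
      toLp_linBoltzmann_harmonic hd hβ k₀ hZ, real_inner_smul_right] at h1
    rw [real_inner_comm, ← h1, real_inner_comm]
  · intro h φ hφ
    rw [integral_mul_linBoltzmann hβ f hφ, integral_mul_smooth g hφ]
    exact inner_eq_inner_of_diagonal (isHilbertSum_sphericalHarmonicsL2 hd) h
      fun ℓ Y hY => inner_toLp_linBoltzmann hd hβ k₀ hφ hY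

/-- If `r` differs from every `ν_ℓ`, all harmonic coefficients of an eigenfunction vanish, so it is
zero by completeness. Conversely the zonal harmonic of degree `ℓ` is a nonzero eigenfunction, since
its value at the pole is `1`. -/
theorem exists_eigenfunction_iff (hd : 2 ≤ d) {β : ℝ → ℝ} (hβ : IsAngularKernel d β) (k₀ : S d)
    (r : ℝ) : (∃ f : L2 d, f ≠ 0 ∧ IsBoltzmannImage β f (-(r • f))) ↔
      ∃ ℓ : ℕ, nuAt β ℓ k₀ = r := by
  simp_rw [isBoltzmannImage_iff hd hβ k₀, inner_neg_right, real_inner_smul_right]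
  constructor
  · rintro ⟨f, hf, h⟩
    by_contra! hr
    refine hf (eq_zero_of_forall_inner (by omega) fun ℓ Y hY => ?_)
    rw [← sphericalHarmonicsL2_eq hd] at hY
    have h1 : (nuAt β ℓ k₀ - r) * ⟪Y, f⟫ = 0 := by linear_combination h ℓ Y hY
    exact (mul_eq_zero.mp h1).resolve_left (sub_ne_zero.mpr (hr ℓ))
  · rintro ⟨ℓ, rfl⟩
    have hZ := zonal_mem hd k₀ ℓ
    refine ⟨contL2 d (smoothCM hZ.1), fun h0 => ?_, fun m Y hY => ?_⟩
    · have h1 : smoothCM hZ.1 = 0 := contL2_injective (by rw [h0, map_zero])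
      have h2 : zonal k₀ ℓ k₀ = 0 := congrArg (fun c : C(S d, ℝ) => c k₀) h1
      rw [zonal_self hd] at h2
      exact one_ne_zero h2
    · by_cases hm : m = ℓ
      · rw [hm, neg_mul]
      · obtain ⟨Z, hZ', rfl⟩ := mem_sphericalHarmonicsL2_iff.mp hY
        have h1 : ⟪contL2 d (smoothCM hZ'.1), contL2 d (smoothCM hZ.1)⟫ = 0 := by
          rw [inner_contL2]
          exact integral_mul_eq_zero hd hm hZ' hZ
        rw [h1, mul_zero, mul_zero, neg_zero]

end SphereBoltzmann

end

theorem mainTheorem10 (d : ℕ) (hd : 2 ≤ d) (β : ℝ → ℝ)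
    (hβ : SphereBoltzmann.IsAngularKernel d β) :
    -- `L_β φ` is well defined, pointwise and in `L^2`, for every smooth `φ`
    (∀ φ : SphereBoltzmann.S d → ℝ, SphereBoltzmann.IsSmooth φ →
      (∀ k, ∃ v, SphereBoltzmann.HasBoltzmannValue β φ k v) ∧
      MemLp (SphereBoltzmann.linBoltzmann β φ) 2 (SphereBoltzmann.surf d)) ∧
    -- `L^2(S^{d-1})` is the Hilbert sum of the spaces of spherical harmonics
    IsHilbertSum ℝ (fun ℓ : ℕ => SphereBoltzmann.sphericalHarmonicsL2 d ℓ)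
      (fun ℓ : ℕ => (SphereBoltzmann.sphericalHarmonicsL2 d ℓ).subtypeₗᵢ) ∧
    -- dimensions
    Module.finrank ℝ (SphereBoltzmann.sphericalHarmonics d 0) = 1 ∧
    (∀ ℓ : ℕ, 1 ≤ ℓ → (Module.finrank ℝ (SphereBoltzmann.sphericalHarmonics d ℓ) : ℝ)
      = SphereBoltzmann.harmonicDim d ℓ) ∧
    ∃ ν : ℕ → ℝ,
      -- the two formulae for `ν_ℓ`
      (∀ (ℓ : ℕ) (k : SphereBoltzmann.S d),
        Integrable (fun σ : SphereBoltzmann.S d =>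
          (1 - (SphereBoltzmann.legendre d ℓ).eval ⟪(k : SphereBoltzmann.E d), σ⟫)
            * β ⟪(k : SphereBoltzmann.E d), σ⟫) (SphereBoltzmann.surf d) ∧
        ν ℓ = ∫ σ : SphereBoltzmann.S d,
          (1 - (SphereBoltzmann.legendre d ℓ).eval ⟪(k : SphereBoltzmann.E d), σ⟫)
            * β ⟪(k : SphereBoltzmann.E d), σ⟫ ∂(SphereBoltzmann.surf d)) ∧
      (∀ ℓ : ℕ,
        IntervalIntegrable (fun θ : ℝ =>
          (1 - (SphereBoltzmann.legendre d ℓ).eval (Real.cos θ)) * β (Real.cos θ)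
            * Real.sin θ ^ (d - 2)) volume 0 Real.pi ∧
        ν ℓ = SphereBoltzmann.sphereArea (d - 1) * ∫ θ in (0 : ℝ)..Real.pi,
          (1 - (SphereBoltzmann.legendre d ℓ).eval (Real.cos θ)) * β (Real.cos θ)
            * Real.sin θ ^ (d - 2)) ∧
      -- `L_β Y = -ν_ℓ Y` pointwise for every `Y ∈ H_ℓ`
      (∀ (ℓ : ℕ), ∀ Y ∈ SphereBoltzmann.sphericalHarmonics d ℓ, ∀ k : SphereBoltzmann.S d,
        SphereBoltzmann.HasBoltzmannValue β Y k (-ν ℓ * Y k) ∧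
        (Integrable (fun σ : SphereBoltzmann.S d =>
            (Y σ - Y k) * β ⟪(k : SphereBoltzmann.E d), σ⟫) (SphereBoltzmann.surf d) →
          ∫ σ : SphereBoltzmann.S d, (Y σ - Y k) * β ⟪(k : SphereBoltzmann.E d), σ⟫
            ∂(SphereBoltzmann.surf d) = -ν ℓ * Y k)) ∧
      -- `L_β` on `L^2` is the diagonal operator with entries `-ν_ℓ` on the `H_ℓ`
      (∀ f g : SphereBoltzmann.L2 d, SphereBoltzmann.IsBoltzmannImage β f g ↔
        ∀ ℓ : ℕ, ∀ Y ∈ SphereBoltzmann.sphericalHarmonicsL2 d ℓ, ⟪Y, g⟫ = -ν ℓ * ⟪Y, f⟫) ∧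
      -- the eigenvalues of `-L_β` are exactly the `ν_ℓ`
      (∀ r : ℝ, (∃ f : SphereBoltzmann.L2 d, f ≠ 0 ∧
        SphereBoltzmann.IsBoltzmannImage β f (-(r • f))) ↔ ∃ ℓ : ℕ, ν ℓ = r) := by
  -- An arbitrary base point at which `ν_ℓ` is computed; rotation invariance (`nuAt_eq`) makes the
  -- value independent of it.
  obtain ⟨k₀⟩ := SphereBoltzmann.nonempty_S hd
  have hform : ∀ (ℓ : ℕ) (k : SphereBoltzmann.S d), _ :=
    SphereBoltzmann.integrable_one_sub_legendre hd hβ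
  refine ⟨fun φ hφ => ⟨(SphereBoltzmann.exists_hasBoltzmannValue hβ hφ).1,
      SphereBoltzmann.memLp_linBoltzmann hβ hφ⟩,
    SphereBoltzmann.isHilbertSum_sphericalHarmonicsL2 hd,
    SphereBoltzmann.finrank_sphericalHarmonics_zero hd,
    fun ℓ hℓ => SphereBoltzmann.finrank_sphericalHarmonics hd hℓ,
    fun ℓ => SphereBoltzmann.nuAt β ℓ k₀,
    fun ℓ k => ⟨hform ℓ k, SphereBoltzmann.nuAt_eq β ℓ k₀ k⟩,
    fun ℓ => SphereBoltzmann.intervalIntegrable_and_integral_inner hd k₀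
      (F := fun t => (1 - (SphereBoltzmann.legendre d ℓ).eval t) * β t)
      ((measurable_const.sub (SphereBoltzmann.legendre d ℓ).continuous.measurable).mul
        hβ.measurable) (hform ℓ k₀),
    fun ℓ Y hY k => ?_,
    SphereBoltzmann.isBoltzmannImage_iff hd hβ k₀,
    SphereBoltzmann.exists_eigenfunction_iff hd hβ k₀⟩
  have h := SphereBoltzmann.hasBoltzmannValue_harmonic hd hβ hY k
  rw [SphereBoltzmann.nuAt_eq β ℓ k k₀] at h
  exact ⟨h, fun hint =>
    tendsto_nhds_unique (SphereBoltzmann.hasBoltzmannValue_of_integrable hint) h⟩
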